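/- \textbf{Setting.} Fix a real $z\ge 1$ and an integer $a\ge 0$. A multiset $X$ of $n\ge 1$ points of the grid $\{1,\dots,\Delta\}^d$, where $\Delta,d\le (n+1)^a$, is partitioned into datasets $X_1,\dots,X_s$ held by $s\ge 1$ sites, and $k\ge 1$. For a finite nonempty $C\subset\mathbb{R}^d$ let $\mathrm{Cost}(X,C)=\sum_{x\in X}\min_{c\in C}\|x-c\|_2^z$, and let $\mathrm{OPT}=\min\{\mathrm{Cost}(X,C): C\subset\mathbb{R}^d,\ 1\le |C|\le k\}$. In the blackboard model, the sites and a coordinator without input use private randomness and communicate by writing self-delimiting messages on a blackboard that everybody reads; in one round all of them may write, and the message of a site depends only on its dataset, its randomness and the blackboard. The communication is the total number of bits written. \textbf{Algorithm.} The parameters are $N=c_Nk$, $\delta=c_\delta/\log^2(n+1)$, $R=\lceil c_R\log(1/\delta)\rceil$ and $\mu=8$, for constants $c_N,c_\delta,c_R>0$. For a number $m>0$ and a base $b>1$, $\mathrm{PowerApprox}(m,b)$ is the integer $r$ with $m\le b^r<bm$; zero is encoded by a special symbol. Write $D_j=\mathrm{Cost}(X_j,S)$ for the current set $S$. (1) $S$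 consists of one uniformly random point of $X$ (the sites write $|X_j|$, the coordinator chooses a site with probability $|X_j|/n$, and this site writes a uniformly random point of its dataset). Every site writes $r_j=\mathrm{PowerApprox}(D_j,2)$; put $\widetilde D_j=2^{r_j}$ ($\widetilde D_j=0$ if $D_j=0$), and $M=0$. (2) While $M<N$ and $\widetilde D:=\sum_j\widetilde D_j>0$: put $i=1$ and repeat the following steps until L1Sampling returns True or $2^i>k$. (2a) LazySampling is performed $2^i$ times in parallel, with the current $S$: the coordinator writes $2^i$ independent site indices, $j$ having probability $\widetilde D_j/\widetilde D$, and for each request the chosen site $j$ answers with the point $y\in X_j$ with probability $\mathrm{Cost}(\{y\},S)/\widetilde D_j$, and otherwise with $\bot$. All the sampled points are added to $S$, and their number is added to $M$. (2b) L1Sampling with the new $S$: the coordinator writes $R$ independent site indices $j_1,\dots,j_R$, again with probabilities $\widetilde D_j/\widetilde D$, the chosen sites write $\rho_j=\mathrm{PowerApprox}(D_j,\mu/4)$, and the result is True if and only if $2\mu\sum_{l=1}^R \frac{\widetilde D}{\widetilde D_{j_l}}(\mu/4)^{\rho_{j_l}}\le R\,\widetilde D$ (a site with $D_j=0$ contributes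 $0$). (2c) If the result is True, every site updates $r_j=\mathrm{PowerApprox}(D_j,2)$ on the blackboard (or writes that it has not changed), and $\widetilde D_j$ becomes $2^{r_j}$ (or $0$). If it is False, $i$ increases by $1$. (3) Return $S$. \textbf{Statement.} For all $z\ge 1$ and $a\ge 0$ the constants $c_N,c_\delta,c_R>0$ can be chosen, and there are constants $C>0$ and $p\in\mathbb{N}$, all of them depending only on $z$ and $a$, such that for all $s,d,\Delta,k,n$ and all inputs as above: \begin{itemize} \item the algorithm is a blackboard protocol with self-delimiting messages which, with probability $1$, terminates and returns a set $S$ with $|S|\le Ck$; \item with probability at least $0.98$, $\mathrm{Cost}(X,S)\le C\cdot \mathrm{OPT}$; \item with probability at least $0.99$, the algorithm uses at most $C\,F\log^p(F+2)$ bits of communication, where $F=s\log(n+1)+kd\log(n+1)$, and at most $C\log(n+1)\log(k+1)$ rounds of communication. \end{itemize} -/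

import Mathlib

open scoped ENNReal NNReal

noncomputable section

namespace Clustering

/-! ### The `(k,z)`-clustering cost -/

/-- A point of the grid `{1, …, Δ}^d`; the value `p t : Fin Δ` stands for the coordinate `p t + 1`. -/
abbrev GridPoint (d Δ : ℕ) : Type := Fin d → Fin Δ

/-- The grid point as a vector of Euclidean space. -/
def GridPoint.toE {d Δ : ℕ} (p : GridPoint d Δ) : EuclideanSpace ℝ (Fin d) :=
  WithLp.toLp 2 fun t => ((p t : ℕ) : ℝ) + 1

/-- `dist(x, C)^z`, with `dist(x, C) = min_{c ∈ C} ‖x - c‖₂` (for finite nonempty `C`). -/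
def pointCost {d Δ : ℕ} (z : ℝ) (C : Set (EuclideanSpace ℝ (Fin d))) (x : GridPoint d Δ) : ℝ :=
  Metric.infDist x.toE C ^ z

/-- `Cost(X, C) = ∑_{x ∈ X} dist(x, C)^z`; a dataset is a multiset of grid points. -/
def cost {d Δ : ℕ} (z : ℝ) (X : Multiset (GridPoint d Δ)) (C : Set (EuclideanSpace ℝ (Fin d))) :
    ℝ :=
  (X.map (pointCost z C)).sum

/-- The optimal `(k,z)`-clustering cost: the infimum of `Cost(X, C)` over all nonempty sets
`C ⊆ ℝ^d` of at most `k` centers. -/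
def optCost {d Δ : ℕ} (k : ℕ) (z : ℝ) (X : Multiset (GridPoint d Δ)) : ℝ :=
  sInf {v : ℝ | ∃ C : Finset (EuclideanSpace ℝ (Fin d)),
    C.Nonempty ∧ C.card ≤ k ∧ v = cost z X (C : Set (EuclideanSpace ℝ (Fin d)))}

/-- A finite set of grid points as a set of centers. -/
def centers {d Δ : ℕ} (S : Finset (GridPoint d Δ)) : Set (EuclideanSpace ℝ (Fin d)) :=
  GridPoint.toE '' (S : Set (GridPoint d Δ))

/-! ### Elementary random choices -/

/-- A random element of `ι`, the element `i` being chosen with probability `w i / ∑ j, w j`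
(and the given default if all the weights are zero). -/
def draw {ι : Type} [Fintype ι] (w : ι → ℝ≥0) (default : ι) : PMF ι :=
  open Classical in
  if h : (∑' i, (w i : ℝ≥0∞)) ≠ 0 ∧ (∑' i, (w i : ℝ≥0∞)) ≠ ∞ then
    PMF.normalize (fun i => (w i : ℝ≥0∞)) h.1 h.2
  else PMF.pure default

/-- `m` independent samples. -/
def iidList {α : Type} (p : PMF α) : ℕ → PMF (List α)
  | 0 => PMF.pure []
  | m + 1 => p.bind fun a => (iidList p m).bind fun l => PMF.pure (a :: l)

/-- Independent samples, one from each of the given distributions. -/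
def independent {α : Type} : (m : ℕ) → (Fin m → PMF α) → PMF (Fin m → α)
  | 0, _ => PMF.pure Fin.elim0
  | m + 1, p => (p 0).bind fun a =>
      (independent m fun j => p j.succ).bind fun f => PMF.pure (Fin.cons a f)

/-! ### The blackboard model -/

/-- A randomized protocol in the blackboard model with `s` sites and a coordinator who has no
input. `State` is what can be computed from the content of the blackboard. In each round, the
coordinator and all the sites write a message (possibly empty) on the blackboard, independently of
each other given the blackboard: the law of the message of a site depends only on the blackboard
and on the input of this site, and the law of the message of the coordinator only on the
blackboard. The bits that are written for a message are given by `code`. -/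
structure BlackboardProtocol (s : ℕ) (Input Output : Type) : Type 1 where
  State : Type
  Msg : Type
  code : Msg → List Bool
  start : State
  coordinator : State → PMF Msg
  site : State → Fin s → Input → PMF Msg
  next : State → Msg → (Fin s → Msg) → State
  /-- `some o` if the protocol has ended with output `o`. -/
  output : State → Option Output

namespace BlackboardProtocol

variable {s : ℕ} {Input Output : Type}

/-- Messages are self-delimiting: given the blackboard, no bit string that a participant may write
is a proper prefix of another one that he may write, whatever his input is, and the bit string
determines the message. Hence everybody can parse the content of the blackboard. -/
def SelfDelimiting (P : BlackboardProtocol s Input Output) : Prop :=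
  (∀ q : P.State, ∀ m ∈ (P.coordinator q).support, ∀ m' ∈ (P.coordinator q).support,
    P.code m <+: P.code m' → m = m') ∧
  (∀ q : P.State, ∀ j : Fin s, ∀ x y : Input,
    ∀ m ∈ (P.site q j x).support, ∀ m' ∈ (P.site q j y).support,
      P.code m <+: P.code m' → m = m')

/-- The public state, the number of bits written so far, and the number of rounds so far. -/
structure Config (P : BlackboardProtocol s Input Output) : Type where
  state : P.State
  bits : ℕ
  rounds : ℕ

/-- One round of communication on the inputs `X`; nothing happens once the protocol has ended. -/
def round (P : BlackboardProtocol s Input Output) (X : Fin s → Input) (c : P.Config) :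
    PMF P.Config :=
  match P.output c.state with
  | some _ => PMF.pure c
  | none =>
    (P.coordinator c.state).bind fun mc =>
      (independent s fun j => P.site c.state j (X j)).bind fun ms =>
        PMF.pure
          { state := P.next c.state mc ms
            bits := c.bits + (P.code mc).length + ∑ j, (P.code (ms j)).length
            rounds := c.rounds + 1 }

/-- The law of the configuration after (at most) `t` rounds on the inputs `X`. -/
def run (P : BlackboardProtocol s Input Output) (X : Fin s → Input) : ℕ → PMF P.Config
  | 0 => PMF.pure { state := P.start, bits := 0, rounds := 0 }
  | t + 1 => (run P X t).bind (P.round X)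

/-- The probability that the protocol ends on the inputs `X`, with an output, a total number of
written bits and a number of rounds that satisfy `E`. -/
def prob (P : BlackboardProtocol s Input Output) (X : Fin s → Input)
    (E : Output → ℕ → ℕ → Prop) : ℝ≥0∞ :=
  ⨆ t : ℕ, (P.run X t).toOuterMeasure
    {c | ∃ o, P.output c.state = some o ∧ E o c.bits c.rounds}

end BlackboardProtocol

/-! ### Messages of the algorithm and their encoding -/

/-- Self-delimiting code of a natural number `m`, of length `2 * Nat.size m + 1`. -/
def natCode (m : ℕ) : List Bool :=
  List.replicate (Nat.size m) true ++ false :: Nat.bits m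

def optionCode {α : Type} (f : α → List Bool) : Option α → List Bool
  | none => [false]
  | some a => true :: f a

def pointCode {d Δ : ℕ} (p : GridPoint d Δ) : List Bool :=
  (List.finRange d).flatMap fun t => natCode (p t)

/-- The messages of the algorithm. -/
inductive Msg (s d Δ : ℕ) : Type where
  | silent
  /-- a natural number -/
  | number (m : ℕ)
  /-- a list of requests, each addressed to a site -/
  | request (l : List (Fin s))
  /-- answers to sampling requests; `none` is `⊥` -/
  | samples (l : List (Option (GridPoint d Δ)))
  /-- an exponent, where `none` encodes the number zero -/
  | exponent (r : Option ℕ)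
  /-- a new exponent, or `none` if the exponent on the blackboard is still correct -/
  | update (u : Option (Option ℕ))

namespace Msg

variable {s d Δ : ℕ}

def code : Msg s d Δ → List Bool
  | silent => []
  | number m => natCode m
  | request l => l.flatMap fun j => natCode j
  | samples l => l.flatMap (optionCode pointCode)
  | exponent r => optionCode natCode r
  | update u => optionCode (optionCode natCode) u

def getNumber : Msg s d Δ → ℕ
  | number m => m
  | _ => 0

def getRequest : Msg s d Δ → List (Fin s)
  | request l => l
  | _ => []

/-- The points that have been sampled, without the answers `⊥`. -/
def getPoints : Msg s d Δ → List (GridPoint d Δ)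
  | samples l => l.reduceOption
  | _ => []

def getExponent : Msg s d Δ → Option ℕ
  | exponent r => r
  | _ => none

/-- The exponent that is valid after the message, `old` being the previous one. -/
def getUpdate (old : Option ℕ) : Msg s d Δ → Option ℕ
  | update (some r) => r
  | _ => old

end Msg

/-! ### The subroutines -/

/-- PowerApprox: the exponent `r` with `m ≤ base^r < base * m`, and `none` for `m = 0`. (Costs of
grid points are `0` or at least `1`, so that the exponent is a natural number.) -/
def powerApprox (base m : ℝ) : Option ℕ :=
  open Classical in if m = 0 then none else some ⌈Real.logb base m⌉₊

/-- The number that is encoded by an exponent. -/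
def powerValue (base : ℝ≥0) : Option ℕ → ℝ≥0
  | none => 0
  | some r => base ^ r

/-- The choice of a site by the coordinator: site `j` with probability `D̃_j / ∑ i, D̃_i`. -/
def drawSite {s : ℕ} [NeZero s] (Dt : Fin s → ℝ≥0) : PMF (Fin s) := draw Dt 0

/-- The answer of a site with dataset `X` to one request of LazySampling: the point `y` with
probability `d_y / D̃` for each data point `y`, where `d_y = Cost(y, S)`, and otherwise `⊥`
(here `∑ y, d_y ≤ D̃`). -/
def lazyAnswer {d Δ : ℕ} (z : ℝ) (X : Multiset (GridPoint d Δ)) (S : Finset (GridPoint d Δ))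
    (Dt : ℝ≥0) : PMF (Option (GridPoint d Δ)) :=
  draw
    (fun o => match o with
      | none => Dt - (cost z X (centers S)).toNNReal
      | some y => X.count y * (pointCost z (centers S) y).toNNReal)
    none

/-- A uniformly random data point of a site (`none` only if there is none). -/
def uniformAnswer {d Δ : ℕ} (X : Multiset (GridPoint d Δ)) : PMF (Option (GridPoint d Δ)) :=
  draw
    (fun o => match o with
      | none => 0
      | some y => (X.count y : ℝ≥0))
    none

/-- The distortion parameter of L1Sampling. -/
def l1Mu : ℝ≥0 := 8

/-- The base of the exponents in L1Sampling. -/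
def l1Base : ℝ≥0 := l1Mu / 4

/-- The decision of L1Sampling: `l` lists the sites that have been chosen, with repetitions, and
`r j` is the exponent written by site `j`. -/
def l1Test {s : ℕ} (Dt : Fin s → ℝ≥0) (l : List (Fin s)) (r : Fin s → Option ℕ) : Prop :=
  2 * l1Mu * (l.map fun j => (∑ i, Dt i) / Dt j * powerValue l1Base (r j)).sum
    ≤ l.length * ∑ i, Dt i

/-! ### The algorithm -/

/-- The steps of the algorithm, each taking one round of communication. -/
inductive Phase (s : ℕ) : Type where
  /-- every site writes the size of its dataset -/
  | sizes
  /-- the coordinator chooses the site of the first point -/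
  | chooseFirst (size : Fin s → ℕ)
  /-- the chosen site writes a uniformly random point -/
  | first (j : Fin s)
  /-- every site writes its exponent -/
  | report
  /-- the coordinator writes `2^i` requests of LazySampling -/
  | lazyRequest
  /-- the sites answer these requests -/
  | lazyReply (l : List (Fin s))
  /-- the coordinator writes the requests of L1Sampling -/
  | l1Request
  /-- the chosen sites write the exponents of their costs -/
  | l1Reply (l : List (Fin s))
  /-- every site updates its exponent -/
  | refresh
  | done

/-- The public state: the current step, the set `S`, the exponents of the estimates `D̃_j` (to base
`2`), the counter `M` of sampled points, and the batch index `i`. -/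
structure PublicState (s d Δ : ℕ) : Type where
  phase : Phase s
  S : Finset (GridPoint d Δ)
  est : Fin s → Option ℕ
  M : ℕ
  i : ℕ

namespace PublicState

variable {s d Δ : ℕ}

/-- The estimates `D̃_j`. -/
def Dt (q : PublicState s d Δ) (j : Fin s) : ℝ≥0 := powerValue 2 (q.est j)

/-- The test of the outer loop: start a new sequence of batches if `M < N`, and end otherwise. The
algorithm also ends if all the estimates are zero; then the cost of every site is zero. -/
def outerLoop (N : ℕ) (q : PublicState s d Δ) : PublicState s d Δ :=
  open Classical in
  if q.M < N ∧ ∃ j, q.est j ≠ none then { q with phase := .lazyRequest, i := 1 }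
  else { q with phase := .done }

/-- The evaluation of a round, in which the coordinator wrote `mc` and site `j` wrote `ms j`. -/
def advance (k N : ℕ) (q : PublicState s d Δ) (mc : Msg s d Δ) (ms : Fin s → Msg s d Δ) :
    PublicState s d Δ :=
  open Classical in
  match q.phase with
  | .sizes => { q with phase := .chooseFirst fun j => (ms j).getNumber }
  | .chooseFirst _ =>
    match mc.getRequest with
    | j :: _ => { q with phase := .first j }
    | [] => { q with phase := .done }
  | .first j => { q with S := (ms j).getPoints.toFinset, phase := .report }
  | .report => outerLoop N { q with est := fun j => (ms j).getExponent }
  | .lazyRequest => { q with phase := .lazyReply mc.getRequest }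
  | .lazyReply _ =>
    { q with
      S := q.S ∪ Finset.univ.biUnion fun j => (ms j).getPoints.toFinset
      M := q.M + ∑ j, (ms j).getPoints.length
      phase := .l1Request }
  | .l1Request => { q with phase := .l1Reply mc.getRequest }
  | .l1Reply l =>
    if l1Test q.Dt l (fun j => (ms j).getExponent) then { q with phase := .refresh }
    else if 2 ^ (q.i + 1) ≤ k then { q with phase := .lazyRequest, i := q.i + 1 }
    else outerLoop N q
  | .refresh => outerLoop N { q with est := fun j => (ms j).getUpdate (q.est j) }
  | .done => q

end PublicState

/-- The round-reduced lazy adaptive sampling algorithm as a blackboard protocol. It stops when at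
least `N` points have been sampled, and each call of L1Sampling uses `R` repetitions. -/
def lazyAdaptiveSampling (s d Δ : ℕ) [NeZero s] (z : ℝ) (k N R : ℕ) :
    BlackboardProtocol s (Multiset (GridPoint d Δ)) (Finset (GridPoint d Δ)) where
  State := PublicState s d Δ
  Msg := Msg s d Δ
  code := Msg.code
  start := { phase := .sizes, S := ∅, est := fun _ => none, M := 0, i := 1 }
  coordinator q :=
    match q.phase with
    | .chooseFirst size => (drawSite fun j => (size j : ℝ≥0)).map fun j => .request [j]
    | .lazyRequest => (iidList (drawSite q.Dt) (2 ^ q.i)).map .request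
    | .l1Request => (iidList (drawSite q.Dt) R).map .request
    | _ => PMF.pure .silent
  site q j X :=
    match q.phase with
    | .sizes => PMF.pure (.number X.card)
    | .first j' =>
      if j = j' then (uniformAnswer X).map fun o => .samples [o] else PMF.pure .silent
    | .report => PMF.pure (.exponent (powerApprox 2 (cost z X (centers q.S))))
    | .lazyReply l => (iidList (lazyAnswer z X q.S (q.Dt j)) (l.count j)).map .samples
    | .l1Reply l =>
      if j ∈ l then PMF.pure (.exponent (powerApprox l1Base (cost z X (centers q.S))))
      else PMF.pure .silent
    | .refresh =>
      let r := powerApprox 2 (cost z X (centers q.S))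
      PMF.pure (.update (if r = q.est j then none else some r))
    | _ => PMF.pure .silent
  next := PublicState.advance k N
  output q :=
    match q.phase with
    | .done => some q.S
    | _ => none

/-- The failure probability `δ = c / log² n` of L1Sampling; `log (n + 1)` is used, so that `n = 1`
is no exception. -/
def l1Delta (c : ℝ) (n : ℕ) : ℝ := c / Real.log (n + 1) ^ 2

/-- The number of repetitions in L1Sampling, a constant times `log (1 / δ)`, rounded up. -/
def l1Reps (c δ : ℝ) : ℕ := ⌈c * Real.log (1 / δ)⌉₊

end Clustering

end

/-! Two nonnegative supermartingales along the run, each combined with Markov's inequality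
(`BlackboardProtocol.ex_run_le`, `mul_toOuterMeasure_le_ex`), carry the proof: one for the cost and
one for the number of rounds.

Cost. Fix at most `k` grid points that are optimal up to the factor `2 ^ z`, and their clusters
(`exists_clusters`). A cluster is covered as soon as `S` contains one of its good points, and in an
uncovered cluster the good points hold a constant share `κ` of its current cost
(`cluster_good_share`). While the cost is large, almost all of it lies in uncovered clusters, so
sampled points tend to cover new ones. The potential is `M + W * (number of uncovered clusters) +
credit` with `W = 72 / κ`; it is at most `W * k` at the start and is set to zero once the cost is
small. A large batch can waste many points on one cluster. The credit, a multiple of `2 ^ i * D /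
D̃`, pays for this: it is left by a batch after which much cost remains, and is spent by the next,
doubled batch (`costPotential_batch`). A bad output requires `M ≥ N`, hence a potential of at least
`N = cN * k`, which is unlikely. The decisions of L1Sampling are irrelevant for this part.

Rounds. Progress is measured by `log D̃` plus a multiple of `(N + 4 * k - M) / k`. A sequence of
batches takes `O(log k)` rounds and should lower the progress by two units in expectation. Either
L1Sampling returns True with `D̃ > 8 * D`, and the update divides `D̃` by four; or a last batch of
more than `k / 2 - 1` requests meets `D̃ ≤ 64 * D` and yields `Ω(k)` points in expectation. Wrong
decisions have probability at most `δ` by a Chernoff bound (`toOuterMeasure_le_of_rpow`). A wrong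
True needs `D̃ ≤ 8 * D` after the batch, which has probability at most `8 * n / 2 ^ i`
(`batchEx_cost_le`), so these risks sum to `O(δ * log n)`, however large `k` is. Thus the expected
number of rounds is `O(log n * log k)` (`ex_rounds_le`), which also gives almost sure termination.

Bits. Given the number of rounds, the bits are bounded surely (`invariant_step`): the sampled points
are charged to `M`, and everything else to the rounds. Hence the bound on the bits follows from the
tail bound for the rounds (`bits_le`). -/

open scoped ENNReal NNReal

noncomputable section

namespace Clustering

/-! ### Expectations -/

/-- The expectation of a nonnegative function. -/
def ex {α : Type*} (p : PMF α) (f : α → ℝ≥0∞) : ℝ≥0∞ := ∑' a, p a * f a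

section ex
variable {α β : Type*}

lemma ex_pure (a : α) (f : α → ℝ≥0∞) : ex (PMF.pure a) f = f a := by
  classical
  unfold ex
  rw [tsum_eq_single a]
  · simp
  · intro b hb; simp [PMF.pure_apply, hb]

lemma ex_bind (p : PMF α) (g : α → PMF β) (f : β → ℝ≥0∞) :
    ex (p.bind g) f = ex p fun a => ex (g a) f := by
  unfold ex
  simp only [PMF.bind_apply, ← ENNReal.tsum_mul_right, ← ENNReal.tsum_mul_left]
  rw [ENNReal.tsum_comm]
  simp only [mul_assoc]

lemma ex_map (p : PMF α) (g : α → β) (f : β → ℝ≥0∞) :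
    ex (p.map g) f = ex p fun a => f (g a) := by
  rw [← PMF.bind_pure_comp, ex_bind]
  simp [ex_pure]

lemma ex_mono (p : PMF α) {f g : α → ℝ≥0∞} (h : ∀ a ∈ p.support, f a ≤ g a) :
    ex p f ≤ ex p g := by
  refine ENNReal.tsum_le_tsum fun a => ?_
  by_cases ha : a ∈ p.support
  · gcongr; exact h a ha
  · rw [PMF.mem_support_iff, not_not] at ha; simp [ha]

lemma ex_congr (p : PMF α) {f g : α → ℝ≥0∞} (h : ∀ a ∈ p.support, f a = g a) :
    ex p f = ex p g :=
  le_antisymm (ex_mono p fun a ha => (h a ha).le) (ex_mono p fun a ha => (h a ha).ge)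

lemma ex_const (p : PMF α) (c : ℝ≥0∞) : ex p (fun _ => c) = c := by
  unfold ex; rw [ENNReal.tsum_mul_right, p.tsum_coe, one_mul]

lemma ex_le_const (p : PMF α) {f : α → ℝ≥0∞} {c : ℝ≥0∞} (h : ∀ a ∈ p.support, f a ≤ c) :
    ex p f ≤ c := (ex_mono p h).trans (ex_const p c).le

lemma ex_add (p : PMF α) (f g : α → ℝ≥0∞) :
    ex p (fun a => f a + g a) = ex p f + ex p g := by
  unfold ex; rw [← ENNReal.tsum_add]; simp only [mul_add]

lemma ex_mul_left (p : PMF α) (c : ℝ≥0∞) (f : α → ℝ≥0∞) :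
    ex p (fun a => c * f a) = c * ex p f := by
  unfold ex; rw [← ENNReal.tsum_mul_left]; simp only [mul_left_comm]

lemma ex_mul_right (p : PMF α) (c : ℝ≥0∞) (f : α → ℝ≥0∞) :
    ex p (fun a => f a * c) = ex p f * c := by
  unfold ex; rw [← ENNReal.tsum_mul_right]; simp only [mul_assoc]

lemma ex_sum (p : PMF α) {ι : Type*} (s : Finset ι) (f : ι → α → ℝ≥0∞) :
    ex p (fun a => ∑ i ∈ s, f i a) = ∑ i ∈ s, ex p (f i) := by
  classical
  induction s using Finset.induction_on with
  | empty => simp [ex_const]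
  | insert i s hi ih => simp [Finset.sum_insert hi, ex_add, ih]

lemma toOuterMeasure_eq_ex (p : PMF α) (A : Set α) :
    p.toOuterMeasure A = ex p (A.indicator 1) := by
  rw [PMF.toOuterMeasure_apply]
  refine tsum_congr fun a => ?_
  by_cases ha : a ∈ A <;> simp [ha]

/-- Markov's inequality. -/
lemma mul_toOuterMeasure_le_ex (p : PMF α) (f : α → ℝ≥0∞) (A : Set α) (c : ℝ≥0∞)
    (h : ∀ a ∈ p.support, a ∈ A → c ≤ f a) : c * p.toOuterMeasure A ≤ ex p f := by
  rw [toOuterMeasure_eq_ex, ← ex_mul_left]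
  refine ex_mono p fun a ha => ?_
  by_cases haA : a ∈ A
  · simpa [haA] using h a ha haA
  · simp [haA]

lemma one_le_add_toOuterMeasure (p : PMF α) (A B : Set α)
    (h : ∀ a ∈ p.support, a ∈ A ∨ a ∈ B) : 1 ≤ p.toOuterMeasure A + p.toOuterMeasure B := by
  rw [toOuterMeasure_eq_ex, toOuterMeasure_eq_ex, ← ex_add, ← ex_const p 1]
  refine ex_mono p fun a ha => ?_
  rcases h a ha with h | h <;> simp [h]

lemma toOuterMeasure_mono_support (p : PMF α) (A B : Set α)
    (h : ∀ a ∈ p.support, a ∈ A → a ∈ B) : p.toOuterMeasure A ≤ p.toOuterMeasure B := by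
  rw [toOuterMeasure_eq_ex, toOuterMeasure_eq_ex]
  refine ex_mono p fun a ha => ?_
  by_cases haA : a ∈ A
  · simp [haA, h a ha haA]
  · simp [haA]

end ex

/-! ### The elementary random choices -/

section draw
variable {ι : Type} [Fintype ι]

lemma draw_apply (w : ι → ℝ≥0) (i₀ i : ι) (h : ∑ j, w j ≠ 0) :
    draw w i₀ i = ((w i / ∑ j, w j : ℝ≥0) : ℝ≥0∞) := by
  have hs : (∑' j, (w j : ℝ≥0∞)) = ((∑ j, w j : ℝ≥0) : ℝ≥0∞) := by
    rw [tsum_fintype]; push_cast; rfl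
  unfold draw
  rw [dif_pos ⟨by rw [hs]; exact_mod_cast h, by rw [hs]; exact ENNReal.coe_ne_top⟩,
    PMF.normalize_apply, hs, ENNReal.coe_div h, div_eq_mul_inv]

lemma ex_draw (w : ι → ℝ≥0) (i₀ : ι) (h : ∑ j, w j ≠ 0) (f : ι → ℝ≥0∞) :
    ex (draw w i₀) f = ∑ i, ((w i / ∑ j, w j : ℝ≥0) : ℝ≥0∞) * f i := by
  unfold ex
  rw [tsum_fintype]
  exact Finset.sum_congr rfl fun i _ => by rw [draw_apply w i₀ i h]

lemma ne_zero_of_mem_support_draw {w : ι → ℝ≥0} {i₀ i : ι} (h : ∑ j, w j ≠ 0)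
    (hi : i ∈ (draw w i₀).support) : w i ≠ 0 := by
  rw [PMF.mem_support_iff, draw_apply w i₀ i h] at hi
  intro h0; simp [h0] at hi

end draw

section iidList
variable {α : Type}

lemma mem_support_iidList {p : PMF α} : ∀ {m : ℕ} {l : List α}, l ∈ (iidList p m).support →
    l.length = m ∧ ∀ a ∈ l, a ∈ p.support
  | 0, l, h => by
      simp only [iidList, PMF.support_pure, Set.mem_singleton_iff] at h
      simp [h]
  | m + 1, l, h => by
      simp only [iidList, PMF.mem_support_bind_iff, PMF.support_pure, Set.mem_singleton_iff] at h
      obtain ⟨a, ha, l', hl', rfl⟩ := h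
      obtain ⟨h1, h2⟩ := mem_support_iidList hl'
      exact ⟨by simp [h1], List.forall_mem_cons.2 ⟨ha, h2⟩⟩

lemma ex_iidList_prod (p : PMF α) (f : α → ℝ≥0∞) (m : ℕ) :
    ex (iidList p m) (fun l => (l.map f).prod) = ex p f ^ m := by
  induction m with
  | zero => simp [iidList, ex_pure]
  | succ m ih => simp [iidList, ex_bind, ex_pure, ex_mul_left, ex_mul_right, ih, pow_succ']

lemma ex_iidList_sum (p : PMF α) (f : α → ℝ≥0∞) (m : ℕ) :
    ex (iidList p m) (fun l => (l.map f).sum) = m * ex p f := by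
  induction m with
  | zero => simp [iidList, ex_pure]
  | succ m ih =>
    simp [iidList, ex_bind, ex_pure, ex_add, ex_const, ih]
    ring

end iidList

section independent
variable {α : Type}

lemma mem_support_independent : ∀ {m : ℕ} {p : Fin m → PMF α} {f : Fin m → α},
    f ∈ (independent m p).support → ∀ j, f j ∈ (p j).support
  | 0, _, _, _ => fun j => j.elim0
  | m + 1, p, f, h => by
      simp only [independent, PMF.mem_support_bind_iff, PMF.support_pure,
        Set.mem_singleton_iff] at h
      obtain ⟨a, ha, g, hg, rfl⟩ := h
      intro j
      refine Fin.cases ?_ (fun j => ?_) j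
      · simpa using ha
      · simpa using mem_support_independent hg j

lemma independent_pure : ∀ {m : ℕ} (g : Fin m → α),
    independent m (fun j => PMF.pure (g j)) = PMF.pure g
  | 0, g => by simp only [independent]; congr 1; exact Subsingleton.elim _ _
  | m + 1, g => by
      simp only [independent, independent_pure, PMF.pure_bind]
      congr 1
      exact Fin.cons_self_tail g

lemma ex_independent_prod : ∀ {m : ℕ} (p : Fin m → PMF α) (g : Fin m → α → ℝ≥0∞),
    ex (independent m p) (fun f => ∏ j, g j (f j)) = ∏ j, ex (p j) (g j)
  | 0, p, g => by simp [independent, ex_pure]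
  | m + 1, p, g => by
      simp only [independent, ex_bind, ex_pure, Fin.prod_univ_succ, Fin.cons_zero, Fin.cons_succ,
        ex_mul_left, ex_mul_right]
      rw [ex_independent_prod (fun j => p j.succ) fun j => g j.succ]

lemma ex_independent_sum : ∀ {m : ℕ} (p : Fin m → PMF α) (g : Fin m → α → ℝ≥0∞),
    ex (independent m p) (fun f => ∑ j, g j (f j)) = ∑ j, ex (p j) (g j)
  | 0, p, g => by simp [independent, ex_pure]
  | m + 1, p, g => by
      simp only [independent, ex_bind, ex_pure, Fin.sum_univ_succ, Fin.cons_zero, Fin.cons_succ,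
        ex_add, ex_const]
      rw [ex_independent_sum (fun j => p j.succ) fun j => g j.succ]

end independent

/-! ### Runs of a protocol -/

namespace BlackboardProtocol
variable {s : ℕ} {Input Output : Type} (P : BlackboardProtocol s Input Output)
  (X : Fin s → Input)

/-- An invariant that is preserved by each round holds throughout the run. -/
lemma invariant_run (I : P.Config → Prop) (h0 : I ⟨P.start, 0, 0⟩)
    (hs : ∀ c, I c → ∀ c' ∈ (P.round X c).support, I c') :
    ∀ t, ∀ c ∈ (P.run X t).support, I c
  | 0, c, hc => by
      simp only [run, PMF.support_pure, Set.mem_singleton_iff] at hc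
      exact hc ▸ h0
  | t + 1, c, hc => by
      simp only [run, PMF.mem_support_bind_iff] at hc
      obtain ⟨c', hc', hcc⟩ := hc
      exact hs c' (invariant_run I h0 hs t c' hc') c hcc

/-- A nonnegative supermartingale has bounded expectation. -/
lemma ex_run_le (I : P.Config → Prop) (h0 : I ⟨P.start, 0, 0⟩)
    (hs : ∀ c, I c → ∀ c' ∈ (P.round X c).support, I c') (Φ : P.Config → ℝ≥0∞)
    (hΦ : ∀ c, I c → ex (P.round X c) Φ ≤ Φ c) :
    ∀ t, ex (P.run X t) Φ ≤ Φ ⟨P.start, 0, 0⟩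
  | 0 => by simp [run, ex_pure]
  | t + 1 => by
      rw [run, ex_bind]
      exact (ex_mono _ fun c hc => hΦ c (P.invariant_run X I h0 hs t c hc)).trans
        (ex_run_le I h0 hs Φ hΦ t)

lemma round_of_output {c : P.Config} {o : Output} (h : P.output c.state = some o) :
    P.round X c = PMF.pure c := by
  unfold round; rw [h]

lemma ex_round {c : P.Config} (h : P.output c.state = none) (Φ : P.Config → ℝ≥0∞) :
    ex (P.round X c) Φ = ex (P.coordinator c.state) fun mc =>
      ex (independent s fun j => P.site c.state j (X j)) fun ms =>
        Φ { state := P.next c.state mc ms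
            bits := c.bits + (P.code mc).length + ∑ j, (P.code (ms j)).length
            rounds := c.rounds + 1 } := by
  unfold round; rw [h]; simp [ex_bind, ex_pure]

lemma mem_support_round {c c' : P.Config} (h : P.output c.state = none)
    (hc : c' ∈ (P.round X c).support) :
    ∃ mc ∈ (P.coordinator c.state).support, ∃ ms : Fin s → P.Msg,
      (∀ j, ms j ∈ (P.site c.state j (X j)).support) ∧
      c' = { state := P.next c.state mc ms
             bits := c.bits + (P.code mc).length + ∑ j, (P.code (ms j)).length
             rounds := c.rounds + 1 } := by
  unfold round at hc; rw [h] at hc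
  simp only [PMF.mem_support_bind_iff, PMF.support_pure, Set.mem_singleton_iff] at hc
  obtain ⟨mc, hmc, ms, hms, rfl⟩ := hc
  exact ⟨mc, hmc, ms, mem_support_independent hms, rfl⟩

/-- An unfinished run has counted every round, so a bound on the expected number of rounds bounds
the probability of being unfinished at time `t`. -/
lemma rounds_eq_of_output_none : ∀ t, ∀ c ∈ (P.run X t).support,
    P.output c.state = none → c.rounds = t
  | 0, c, hc => by
      simp only [run, PMF.support_pure, Set.mem_singleton_iff] at hc
      simp [hc]
  | t + 1, c, hc => by
      simp only [run, PMF.mem_support_bind_iff] at hc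
      obtain ⟨c', hc', hcc⟩ := hc
      intro hn
      rcases ho : P.output c'.state with _ | o
      · obtain ⟨mc, -, ms, -, rfl⟩ := P.mem_support_round X ho hcc
        simp [rounds_eq_of_output_none t c' hc' ho]
      · rw [P.round_of_output X ho] at hcc
        simp only [PMF.support_pure, Set.mem_singleton_iff] at hcc
        subst hcc; simp [ho] at hn

lemma toOuterMeasure_run_le_prob (E : Output → ℕ → ℕ → Prop) (t : ℕ) :
    (P.run X t).toOuterMeasure {c | ∃ o, P.output c.state = some o ∧ E o c.bits c.rounds} ≤
      P.prob X E :=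
  le_iSup (fun t : ℕ => (P.run X t).toOuterMeasure
    {c | ∃ o, P.output c.state = some o ∧ E o c.bits c.rounds}) t

/-- If the expected number of rounds is bounded, then the protocol ends almost surely, and an event
that fails with probability at most `ε` at any time has probability at least `1 - ε`. -/
lemma one_le_prob_add (E : Output → ℕ → ℕ → Prop) {B : ℝ≥0∞} (hB : B ≠ ∞)
    (hr : ∀ t, ex (P.run X t) (fun c => (c.rounds : ℝ≥0∞)) ≤ B) (ε : ℝ≥0∞)
    (hbad : ∀ t, (P.run X t).toOuterMeasure
      {c | ∃ o, P.output c.state = some o ∧ ¬ E o c.bits c.rounds} ≤ ε) :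
    1 ≤ P.prob X E + ε := by
  have key : ∀ t : ℕ, 1 ≤ (P.prob X E + ε) + B / t := by
    intro t
    rcases Nat.eq_zero_or_pos t with rfl | ht
    -- For `t = 0` the term `B / 0` is `∞`, except that `0 / 0 = 0` in `ℝ≥0∞`. If `B = 0`, the run
    -- of one round has ended with probability one and is used instead.
    · by_cases h0 : B = 0
      · have := mul_toOuterMeasure_le_ex (P.run X 1) (fun c => (c.rounds : ℝ≥0∞))
          {c | P.output c.state = none} 1 (fun c hc hn => by
            rw [P.rounds_eq_of_output_none X 1 c hc hn]; simp)
        have hz : (P.run X 1).toOuterMeasure {c | P.output c.state = none} ≤ 0 := by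
          rw [one_mul] at this; exact (this.trans (hr 1)).trans h0.le
        have h1 := one_le_add_toOuterMeasure (P.run X 1)
          {c | ∃ o, P.output c.state = some o ∧ E o c.bits c.rounds}
          ({c | ∃ o, P.output c.state = some o ∧ ¬ E o c.bits c.rounds} ∪
            {c | P.output c.state = none}) (fun c _ => by
              rcases ho : P.output c.state with _ | o
              · right; right; exact ho
              · by_cases hE : E o c.bits c.rounds
                · left; exact ⟨o, ho, hE⟩
                · right; left; exact ⟨o, ho, hE⟩)
        refine h1.trans ?_
        have h2 := MeasureTheory.measure_union_le (μ := (P.run X 1).toOuterMeasure)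
          {c | ∃ o, P.output c.state = some o ∧ ¬ E o c.bits c.rounds}
          {c | P.output c.state = none}
        calc _ ≤ P.prob X E + (ε + 0) :=
              add_le_add (P.toOuterMeasure_run_le_prob X E 1)
                (h2.trans (add_le_add (hbad 1) hz))
          _ ≤ _ := by rw [add_zero]; exact le_self_add
      · simp [ENNReal.div_zero h0]
    · have h3 := mul_toOuterMeasure_le_ex (P.run X t) (fun c => (c.rounds : ℝ≥0∞))
        {c | P.output c.state = none} t (fun c hc hn => by
          rw [P.rounds_eq_of_output_none X t c hc hn])
      have hz : (P.run X t).toOuterMeasure {c | P.output c.state = none} ≤ B / t := by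
        rw [ENNReal.le_div_iff_mul_le (by left; exact_mod_cast ht.ne') (by simp), mul_comm]
        exact h3.trans (hr t)
      have h1 := one_le_add_toOuterMeasure (P.run X t)
        {c | ∃ o, P.output c.state = some o ∧ E o c.bits c.rounds}
        ({c | ∃ o, P.output c.state = some o ∧ ¬ E o c.bits c.rounds} ∪
          {c | P.output c.state = none}) (fun c _ => by
            rcases ho : P.output c.state with _ | o
            · right; right; exact ho
            · by_cases hE : E o c.bits c.rounds
              · left; exact ⟨o, ho, hE⟩
              · right; left; exact ⟨o, ho, hE⟩)
      refine h1.trans ?_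
      have h2 := MeasureTheory.measure_union_le (μ := (P.run X t).toOuterMeasure)
        {c | ∃ o, P.output c.state = some o ∧ ¬ E o c.bits c.rounds}
        {c | P.output c.state = none}
      rw [add_assoc]
      exact add_le_add (P.toOuterMeasure_run_le_prob X E t)
        (h2.trans (add_le_add (hbad t) hz))
  have hlim : Filter.Tendsto (fun t : ℕ => (P.prob X E + ε) + B / (t : ℝ≥0∞)) Filter.atTop
      (nhds (P.prob X E + ε + 0)) := by
    refine Filter.Tendsto.const_add _ ?_
    have := ENNReal.Tendsto.const_div (a := B) ENNReal.tendsto_nat_nhds_top (Or.inr hB)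
    simpa using this
  rw [add_zero] at hlim
  exact ge_of_tendsto' hlim key

end BlackboardProtocol

/-! ### Costs of grid points -/

section cost
variable {d Δ : ℕ} {z : ℝ}

lemma pointCost_nonneg (C : Set (EuclideanSpace ℝ (Fin d))) (y : GridPoint d Δ) :
    0 ≤ pointCost z C y := Real.rpow_nonneg Metric.infDist_nonneg _

lemma cost_eq_sum (X : Multiset (GridPoint d Δ)) (C : Set (EuclideanSpace ℝ (Fin d))) :
    cost z X C = ∑ y, (X.count y : ℝ) * pointCost z C y := by
  unfold cost
  rw [Finset.sum_multiset_map_count]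
  simp only [nsmul_eq_mul]
  refine Finset.sum_subset (Finset.subset_univ _) fun y _ hy => ?_
  rw [Multiset.mem_toFinset] at hy
  rw [Multiset.count_eq_zero_of_notMem hy]; simp

lemma cost_nonneg (X : Multiset (GridPoint d Δ)) (C : Set (EuclideanSpace ℝ (Fin d))) :
    0 ≤ cost z X C := by
  rw [cost_eq_sum]
  exact Finset.sum_nonneg fun y _ => mul_nonneg (Nat.cast_nonneg _) (pointCost_nonneg _ _)

lemma cost_sum {s : ℕ} (X : Fin s → Multiset (GridPoint d Δ))
    (C : Set (EuclideanSpace ℝ (Fin d))) : cost z (∑ j, X j) C = ∑ j, cost z (X j) C := by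
  simp only [cost_eq_sum]
  rw [Finset.sum_comm]
  refine Finset.sum_congr rfl fun y _ => ?_
  rw [Multiset.count_sum', Nat.cast_sum, Finset.sum_mul]

lemma centers_nonempty {S : Finset (GridPoint d Δ)} (hS : S.Nonempty) : (centers S).Nonempty :=
  hS.to_set.image _

lemma pointCost_anti (hz : 0 ≤ z) {S S' : Finset (GridPoint d Δ)} (hS : S.Nonempty) (h : S ⊆ S')
    (y : GridPoint d Δ) : pointCost z (centers S') y ≤ pointCost z (centers S) y :=
  Real.rpow_le_rpow Metric.infDist_nonneg
    (Metric.infDist_le_infDist_of_subset (Set.image_mono (by exact_mod_cast h))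
      (centers_nonempty hS)) hz

lemma cost_anti (hz : 0 ≤ z) {S S' : Finset (GridPoint d Δ)} (hS : S.Nonempty) (h : S ⊆ S')
    (X : Multiset (GridPoint d Δ)) : cost z X (centers S') ≤ cost z X (centers S) := by
  rw [cost_eq_sum, cost_eq_sum]
  exact Finset.sum_le_sum fun y _ =>
    mul_le_mul_of_nonneg_left (pointCost_anti hz hS h y) (Nat.cast_nonneg _)

lemma pointCost_le (hz : 0 ≤ z) {S : Finset (GridPoint d Δ)} {c : GridPoint d Δ} (hc : c ∈ S)
    (y : GridPoint d Δ) : pointCost z (centers S) y ≤ dist y.toE c.toE ^ z :=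
  Real.rpow_le_rpow Metric.infDist_nonneg
    (Metric.infDist_le_dist_of_mem (Set.mem_image_of_mem _ (by exact_mod_cast hc))) hz

lemma pointCost_eq_zero (hz : 1 ≤ z) {S : Finset (GridPoint d Δ)} {c : GridPoint d Δ}
    (hc : c ∈ S) : pointCost z (centers S) c = 0 :=
  le_antisymm ((pointCost_le (by linarith) hc c).trans
    (by rw [dist_self, Real.zero_rpow (by linarith)])) (pointCost_nonneg _ _)

lemma exists_pointCost_eq {S : Finset (GridPoint d Δ)} (hS : S.Nonempty) (y : GridPoint d Δ) :
    ∃ c ∈ S, Metric.infDist y.toE (centers S) = dist y.toE c.toE := by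
  have hcomp : IsCompact (centers S) := ((S.finite_toSet).image _).isCompact
  obtain ⟨_, ⟨c, hc, rfl⟩, h⟩ := hcomp.exists_infDist_eq_dist (centers_nonempty hS) y.toE
  exact ⟨c, by exact_mod_cast hc, h⟩

lemma one_le_dist {x y : GridPoint d Δ} (h : x ≠ y) : 1 ≤ dist x.toE y.toE := by
  obtain ⟨t, ht⟩ := Function.ne_iff.1 h
  have h1 : ‖(x.toE - y.toE) t‖ ≤ ‖x.toE - y.toE‖ := PiLp.norm_apply_le _ t
  rw [dist_eq_norm]
  refine le_trans ?_ h1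
  have h2 : (x.toE - y.toE) t = (((x t : ℕ) : ℤ) - ((y t : ℕ) : ℤ) : ℤ) := by
    simp [GridPoint.toE]
  rw [h2, Real.norm_eq_abs, ← Int.cast_abs]
  have h3 : ((x t : ℕ) : ℤ) - ((y t : ℕ) : ℤ) ≠ 0 := by
    intro h0; apply ht; ext; omega
  exact_mod_cast Int.one_le_abs h3

lemma dist_le_mul (x y : GridPoint d Δ) : dist x.toE y.toE ≤ d * Δ := by
  rw [EuclideanSpace.dist_eq]
  have h : ∑ t, dist (x.toE t) (y.toE t) ^ 2 ≤ ((d : ℝ) * Δ) ^ 2 := by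
    have h1 : ∀ t, dist (x.toE t) (y.toE t) ^ 2 ≤ (Δ : ℝ) ^ 2 := by
      intro t
      have h2 : dist (x.toE t) (y.toE t) = |((x t : ℕ) : ℝ) - ((y t : ℕ) : ℝ)| := by
        simp [GridPoint.toE, Real.dist_eq]
      rw [h2]
      gcongr
      have hx : ((x t : ℕ) : ℝ) ≤ Δ := by exact_mod_cast (x t).2.le
      have hy : ((y t : ℕ) : ℝ) ≤ Δ := by exact_mod_cast (y t).2.le
      rw [abs_le]; constructor <;> linarith [Nat.cast_nonneg (α := ℝ) (x t : ℕ),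
        Nat.cast_nonneg (α := ℝ) (y t : ℕ)]
    calc _ ≤ ∑ _t : Fin d, (Δ : ℝ) ^ 2 := Finset.sum_le_sum fun t _ => h1 t
      _ = d * (Δ : ℝ) ^ 2 := by simp
      _ ≤ (d : ℝ) ^ 2 * (Δ : ℝ) ^ 2 := by
          gcongr
          exact_mod_cast Nat.le_self_pow (by norm_num) d
      _ = _ := by ring
  exact Real.sqrt_le_iff.2 ⟨by positivity, h⟩

lemma pointCost_eq_zero_or_one_le (hz : 1 ≤ z) {S : Finset (GridPoint d Δ)} (hS : S.Nonempty)
    (y : GridPoint d Δ) : pointCost z (centers S) y = 0 ∨ 1 ≤ pointCost z (centers S) y := by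
  obtain ⟨c, hc, h⟩ := exists_pointCost_eq hS y
  by_cases hyc : y = c
  · left; rw [hyc]; exact pointCost_eq_zero hz hc
  · right; unfold pointCost; rw [h]
    exact Real.one_le_rpow (one_le_dist hyc) (by linarith)

/-- Distinct grid points differ by at least one in some coordinate. This gap makes natural numbers
sufficient as exponents. -/
lemma cost_eq_zero_or_one_le (hz : 1 ≤ z) {S : Finset (GridPoint d Δ)} (hS : S.Nonempty)
    (X : Multiset (GridPoint d Δ)) : cost z X (centers S) = 0 ∨ 1 ≤ cost z X (centers S) := by
  by_cases h : ∃ y ∈ X, pointCost z (centers S) y ≠ 0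
  · right
    obtain ⟨y, hy, hy0⟩ := h
    have h1 := (pointCost_eq_zero_or_one_le hz hS y).resolve_left hy0
    have h2 : (1 : ℝ) ≤ X.count y := by exact_mod_cast Multiset.one_le_count_iff_mem.2 hy
    rw [cost_eq_sum]
    refine le_trans (by nlinarith) (Finset.single_le_sum (f := fun y => (X.count y : ℝ) *
      pointCost z (centers S) y) (fun y _ => mul_nonneg (Nat.cast_nonneg _)
        (pointCost_nonneg _ _)) (Finset.mem_univ y))
  · left
    push Not at h
    exact Multiset.sum_eq_zero (by
      intro v hv
      obtain ⟨y, hy, rfl⟩ := Multiset.mem_map.1 hv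
      exact h y hy)

lemma cost_le_of_nonempty (hz : 0 ≤ z) {S : Finset (GridPoint d Δ)} (hS : S.Nonempty)
    (X : Multiset (GridPoint d Δ)) :
    cost z X (centers S) ≤ X.card * ((d : ℝ) * Δ) ^ z := by
  obtain ⟨c, hc⟩ := hS
  unfold cost
  have := Multiset.sum_le_card_nsmul (X.map (pointCost z (centers S))) (((d : ℝ) * Δ) ^ z) (by
    intro v hv
    obtain ⟨y, hy, rfl⟩ := Multiset.mem_map.1 hv
    exact (pointCost_le hz hc y).trans (Real.rpow_le_rpow dist_nonneg (dist_le_mul y c) hz))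
  simpa using this

end cost

/-! ### Powers -/

lemma powerApprox_zero (b : ℝ) : powerApprox b 0 = none := by simp [powerApprox]

lemma le_powerValue {m : ℝ} (hm : 0 ≤ m) : m ≤ powerValue 2 (powerApprox 2 m) := by
  unfold powerApprox
  split_ifs with h
  · simp [h]
  · have hm' : 0 < m := lt_of_le_of_ne hm (Ne.symm h)
    simp only [powerValue]
    push_cast
    have h1 := Nat.le_ceil (Real.logb 2 m)
    rw [Real.logb_le_iff_le_rpow (by norm_num) hm', Real.rpow_natCast] at h1
    exact h1

/-- Positive values below one are excluded because the natural ceiling would round a negative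
exponent up to zero. -/
lemma powerValue_le_two_mul {m : ℝ} (hm : m = 0 ∨ 1 ≤ m) :
    (powerValue 2 (powerApprox 2 m) : ℝ) ≤ 2 * m := by
  unfold powerApprox
  split_ifs with h
  · simp [h, powerValue]
  · have hm' := hm.resolve_left h
    simp only [powerValue]
    push_cast
    have h1 := (Nat.ceil_lt_add_one (Real.logb_nonneg (b := 2) (by norm_num) hm')).le
    rw [← Real.rpow_natCast]
    calc (2 : ℝ) ^ ((⌈Real.logb 2 m⌉₊ : ℕ) : ℝ) ≤ 2 ^ (Real.logb 2 m + 1) :=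
          Real.rpow_le_rpow_of_exponent_le (by norm_num) h1
      _ = 2 * m := by
          rw [Real.rpow_add (by norm_num), Real.rpow_logb (by norm_num) (by norm_num)
            (by linarith)]
          norm_num [mul_comm]

/-- Minimality of the exponent: an update never raises an estimate that is still an upper bound. -/
lemma powerValue_powerApprox_le {m : ℝ} (hm : 0 ≤ m) {r : Option ℕ}
    (h : m ≤ powerValue 2 r) : powerValue 2 (powerApprox 2 m) ≤ powerValue 2 r := by
  unfold powerApprox
  split_ifs with h0
  · simp [powerValue]
  · have hm' : 0 < m := lt_of_le_of_ne hm (Ne.symm h0)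
    rcases r with _ | r
    · simp only [powerValue, NNReal.coe_zero] at h; linarith
    · simp only [powerValue] at h ⊢
      push_cast at h
      refine pow_le_pow_right₀ (by norm_num) ?_
      rw [Nat.ceil_le, Real.logb_le_iff_le_rpow (by norm_num) hm', Real.rpow_natCast]
      exact h

lemma one_le_powerValue {r : Option ℕ} (h : r ≠ none) : 1 ≤ powerValue 2 r := by
  rcases r with _ | r
  · exact absurd rfl h
  · exact one_le_pow₀ (by norm_num)

/-! ### Replacing centers by grid points -/

section opt
variable {d Δ : ℕ} {z : ℝ}

/-- Some set of at most `k` grid points is an approximately optimal set of centers. -/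
lemma exists_gridCenters (hz : 1 ≤ z) {k : ℕ} (hk : 1 ≤ k) {X : Multiset (GridPoint d Δ)}
    (hX : X ≠ 0) : ∃ K : Finset (GridPoint d Δ), K.Nonempty ∧ K.card ≤ k ∧
      cost z X (centers K) ≤ 2 ^ z * optCost k z X := by
  classical
  obtain ⟨x₀, hx₀⟩ := Multiset.exists_mem_of_ne_zero hX
  -- There are finitely many sets of grid points, so a best one exists; whether the infimum over
  -- `ℝ^d` is attained plays no role.
  obtain ⟨K, hK, hmin⟩ := Finset.exists_min_image
    (Finset.univ.filter fun K : Finset (GridPoint d Δ) => K.Nonempty ∧ K.card ≤ k)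
    (fun K => cost z X (centers K)) ⟨{x₀}, by simpa using hk⟩
  simp only [Finset.mem_filter, Finset.mem_univ, true_and] at hK hmin
  refine ⟨K, hK.1, hK.2, ?_⟩
  have h2z : (0 : ℝ) < 2 ^ z := by positivity
  rw [mul_comm, ← div_le_iff₀ h2z]
  refine le_csInf ⟨_, {x₀.toE}, by simp, by simpa using hk, rfl⟩ ?_
  rintro v ⟨C, hC, hCk, rfl⟩
  rw [div_le_iff₀ h2z, mul_comm]
  have hne : X.toFinset.Nonempty := ⟨x₀, by simpa using hx₀⟩
  -- `f c` is a data point nearest to `c`. Moving `c` to `f c` at most doubles its distance to each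
  -- data point, by the triangle inequality; hence the factor `2 ^ z`.
  choose f hf hfmin using fun c : EuclideanSpace ℝ (Fin d) =>
    Finset.exists_min_image X.toFinset (fun x => dist x.toE c) hne
  refine (hmin (C.image f) ⟨hC.image f, Finset.card_image_le.trans hCk⟩).trans ?_
  unfold cost
  rw [← Multiset.sum_map_mul_left]
  refine Multiset.sum_map_le_sum_map _ _ fun x hx => ?_
  obtain ⟨c, hc, hcd⟩ := C.finite_toSet.isCompact.exists_infDist_eq_dist
    (by exact_mod_cast hC) x.toE
  refine (pointCost_le (by linarith) (Finset.mem_image_of_mem f (by exact_mod_cast hc)) x).trans ?_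
  unfold pointCost
  rw [hcd, ← Real.mul_rpow (by norm_num) dist_nonneg]
  refine Real.rpow_le_rpow dist_nonneg ?_ (by linarith)
  have h1 := hfmin c x (by simpa using hx)
  have h2 := dist_triangle x.toE c (f c).toE
  rw [dist_comm c] at h2
  linarith

end opt

/-! ### Sampling from a cluster -/

section cluster
variable {d Δ : ℕ} {z : ℝ}

lemma add_rpow_le (hz : 1 ≤ z) {a b : ℝ} (ha : 0 ≤ a) (hb : 0 ≤ b) :
    (a + b) ^ z ≤ 2 ^ (z - 1) * (a ^ z + b ^ z) := by
  have := NNReal.rpow_add_le_mul_rpow_add_rpow ⟨a, ha⟩ ⟨b, hb⟩ hz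
  exact_mod_cast this

variable (A : Finset (GridPoint d Δ)) (w : GridPoint d Δ → ℝ) (c : GridPoint d Δ)

/-- A center that is close to the center of a cluster is a good center for the whole cluster. -/
lemma cluster_cost_le (hz : 1 ≤ z) (hw : ∀ y, 0 ≤ w y) {S : Finset (GridPoint d Δ)}
    {y : GridPoint d Δ} (hy : y ∈ S)
    (h : (∑ x ∈ A, w x) * dist y.toE c.toE ^ z ≤ 2 * ∑ x ∈ A, w x * dist x.toE c.toE ^ z) :
    ∑ x ∈ A, w x * pointCost z (centers S) x ≤
      3 * 2 ^ (z - 1) * ∑ x ∈ A, w x * dist x.toE c.toE ^ z := by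
  have h1 : ∀ x ∈ A, w x * pointCost z (centers S) x ≤
      2 ^ (z - 1) * (w x * dist x.toE c.toE ^ z + w x * dist y.toE c.toE ^ z) := by
    intro x _
    have h2 : pointCost z (centers S) x ≤
        2 ^ (z - 1) * (dist x.toE c.toE ^ z + dist y.toE c.toE ^ z) := by
      refine (pointCost_le (by linarith) hy x).trans ?_
      refine le_trans (Real.rpow_le_rpow dist_nonneg ?_ (by linarith))
        (add_rpow_le hz dist_nonneg dist_nonneg)
      rw [dist_comm y.toE]; exact dist_triangle _ _ _
    calc _ ≤ w x * (2 ^ (z - 1) * (dist x.toE c.toE ^ z + dist y.toE c.toE ^ z)) :=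
          mul_le_mul_of_nonneg_left h2 (hw x)
      _ = _ := by ring
  refine (Finset.sum_le_sum h1).trans ?_
  rw [← Finset.mul_sum, Finset.sum_add_distrib, ← Finset.sum_mul, mul_comm (3 : ℝ), mul_assoc]
  refine mul_le_mul_of_nonneg_left ?_ (by positivity)
  linarith

/-- If a set of centers is bad for a cluster, then the points near the center of this cluster have a
constant share of its cost. -/
lemma cluster_good_share (hz : 1 ≤ z) (hw : ∀ y, 0 ≤ w y) {S : Finset (GridPoint d Δ)}
    (h : 2 ^ (z - 1) * (1 + 4 * 2 ^ (z - 1)) * ∑ x ∈ A, w x * dist x.toE c.toE ^ z <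
      ∑ x ∈ A, w x * pointCost z (centers S) x) :
    ∑ x ∈ A, w x * pointCost z (centers S) x ≤ 8 * (2 ^ (z - 1)) ^ 2 *
      ∑ x ∈ A with (∑ x ∈ A, w x) * dist x.toE c.toE ^ z ≤ 2 * ∑ x ∈ A, w x * dist x.toE c.toE ^ z,
        w x * pointCost z (centers S) x := by
  set H : ℝ := 2 ^ (z - 1) with hH
  have hH1 : 1 ≤ H := Real.one_le_rpow (by norm_num) (by linarith)
  set W := ∑ x ∈ A, w x with hW
  set O := ∑ x ∈ A, w x * dist x.toE c.toE ^ z with hO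
  set Cs := ∑ x ∈ A, w x * pointCost z (centers S) x with hCs
  set l := pointCost z (centers S) c with hl
  have hl0 : 0 ≤ l := pointCost_nonneg _ _
  have hW0 : 0 ≤ W := Finset.sum_nonneg fun x _ => hw x
  have hd0 : ∀ x : GridPoint d Δ, 0 ≤ dist x.toE c.toE ^ z := fun x => Real.rpow_nonneg dist_nonneg _
  have hO0 : 0 ≤ O := Finset.sum_nonneg fun x _ => mul_nonneg (hw x) (hd0 x)
  have hup : ∀ x : GridPoint d Δ, pointCost z (centers S) x ≤ H * (l + dist x.toE c.toE ^ z) := by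
    intro x
    refine le_trans (Real.rpow_le_rpow Metric.infDist_nonneg ?_ (by linarith))
      (add_rpow_le hz Metric.infDist_nonneg dist_nonneg)
    exact Metric.infDist_le_infDist_add_dist
  have hlow : ∀ x : GridPoint d Δ, l ≤ H * (pointCost z (centers S) x + dist x.toE c.toE ^ z) := by
    intro x
    refine le_trans (Real.rpow_le_rpow Metric.infDist_nonneg ?_ (by linarith))
      (add_rpow_le hz Metric.infDist_nonneg dist_nonneg)
    rw [dist_comm]
    exact Metric.infDist_le_infDist_add_dist
  have hCsup : Cs ≤ H * (W * l + O) := by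
    calc Cs ≤ ∑ x ∈ A, w x * (H * (l + dist x.toE c.toE ^ z)) :=
          Finset.sum_le_sum fun x _ => mul_le_mul_of_nonneg_left (hup x) (hw x)
      _ = _ := by
          rw [hW, hO, Finset.sum_mul, ← Finset.sum_add_distrib, Finset.mul_sum]
          exact Finset.sum_congr rfl fun x _ => by ring
  -- The factor `1 + 4 * H` in the threshold is chosen for this: an uncovered cluster is far from
  -- `S` compared with its average radius.
  have h4 : 4 * H * O < W * l := by
    have : H * (1 + 4 * H) * O < H * (W * l + O) := h.trans_le hCsup
    have h5 : H * ((1 + 4 * H) * O) < H * (W * l + O) := by linarith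
    have := lt_of_mul_lt_mul_left h5 (by linarith)
    linarith
  have hWpos : 0 < W := by
    rcases hW0.eq_or_lt with h0 | h0
    · rw [← h0] at h4; nlinarith
    · exact h0
  set G := A.filter fun x => W * dist x.toE c.toE ^ z ≤ 2 * O with hG
  have hsplit : ∑ x ∈ G, w x + ∑ x ∈ A with ¬ (W * dist x.toE c.toE ^ z ≤ 2 * O), w x = W :=
    Finset.sum_filter_add_sum_filter_not _ _ _
  -- Markov's inequality for the distances to `c`: if more than half of the weight were farther out
  -- than twice the average, the cost would exceed `O`.
  have hhalf : W / 2 ≤ ∑ x ∈ G, w x := by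
    by_contra hcon
    push Not at hcon
    set G' := A.filter fun x => ¬ (W * dist x.toE c.toE ^ z ≤ 2 * O) with hG'
    have hb : W / 2 < ∑ x ∈ G', w x := by linarith
    have h6 : ∑ x ∈ G', w x * (2 * O) < ∑ x ∈ G', w x * (W * dist x.toE c.toE ^ z) := by
      have hlt : ∀ x ∈ G', 2 * O < W * dist x.toE c.toE ^ z := fun x hx =>
        not_le.1 (Finset.mem_filter.1 hx).2
      obtain ⟨x, hx, hx0⟩ : ∃ x ∈ G', 0 < w x := by
        by_contra hno
        push Not at hno
        have := Finset.sum_nonpos hno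
        linarith
      exact Finset.sum_lt_sum (fun x hx => mul_le_mul_of_nonneg_left (hlt x hx).le (hw x))
        ⟨x, hx, mul_lt_mul_of_pos_left (hlt x hx) hx0⟩
    have h7 : ∑ x ∈ G', w x * (W * dist x.toE c.toE ^ z) ≤ W * O := by
      rw [hO, Finset.mul_sum]
      refine le_trans (Finset.sum_le_sum_of_subset_of_nonneg (Finset.filter_subset _ _)
        fun x _ _ => mul_nonneg (hw x) (mul_nonneg hW0 (hd0 x))) (le_of_eq ?_)
      exact Finset.sum_congr rfl fun x _ => by ring
    rw [← Finset.sum_mul] at h6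
    nlinarith
  -- For a good point, `W * l ≤ H * (W * cost x + 2 * O)`, and by `h4` the term `2 * H * O` is less
  -- than half of the left side.
  have hGlow : (∑ x ∈ G, w x) * (W * l) ≤ ∑ x ∈ G, w x * (2 * H * (W * pointCost z (centers S) x)) := by
    rw [Finset.sum_mul]
    refine Finset.sum_le_sum fun x hx => mul_le_mul_of_nonneg_left ?_ (hw x)
    have h8 := (Finset.mem_filter.1 hx).2
    have h9 := mul_le_mul_of_nonneg_left (hlow x) hW0
    nlinarith
  have hGsum : ∑ x ∈ G, w x * (2 * H * (W * pointCost z (centers S) x)) =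
      2 * H * W * ∑ x ∈ G, w x * pointCost z (centers S) x := by
    rw [Finset.mul_sum]; exact Finset.sum_congr rfl fun x _ => by ring
  rw [hGsum] at hGlow
  set Gs := ∑ x ∈ G, w x * pointCost z (centers S) x
  have h10 : W / 2 * (W * l) ≤ 2 * H * W * Gs :=
    (mul_le_mul_of_nonneg_right hhalf (mul_nonneg hW0 hl0)).trans hGlow
  have h11 : W * l ≤ 4 * H * Gs := by
    have : W * (W * l) ≤ W * (4 * H * Gs) := by linarith
    exact le_of_mul_le_mul_left this hWpos
  have h12 : Cs ≤ H * (2 * (W * l)) := hCsup.trans (by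
    refine mul_le_mul_of_nonneg_left ?_ (by linarith)
    nlinarith)
  calc Cs ≤ H * (2 * (W * l)) := h12
    _ ≤ H * (2 * (4 * H * Gs)) := by
        refine mul_le_mul_of_nonneg_left ?_ (by linarith)
        linarith
    _ = _ := by ring

end cluster

/-! ### The clusters of an approximately optimal solution -/

section clusters
variable {d Δ : ℕ}

/-- The cost of a dataset restricted to the points of a set. -/
def partCost (z : ℝ) (X : Multiset (GridPoint d Δ)) (S : Finset (GridPoint d Δ))
    (A : Finset (GridPoint d Δ)) : ℝ := ∑ y ∈ A, (X.count y : ℝ) * pointCost z (centers S) y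

/-- The distortion for which a cluster is considered as covered. -/
def coverFactor (z : ℝ) : ℝ := 2 ^ (z - 1) * (1 + 4 * 2 ^ (z - 1))

/-- The share of the good points in the cost of a cluster that is not covered. -/
def goodShare (z : ℝ) : ℝ := 1 / (8 * (2 ^ (z - 1)) ^ 2)

/-- A partition of the grid into at most `k` clusters `A c`, with costs `o c` that sum up to
`O(OPT)`, and a set `G c` of good points for each of the clusters. -/
structure Clusters (z : ℝ) (k : ℕ) (X : Multiset (GridPoint d Δ)) where
  K : Finset (GridPoint d Δ)
  A : GridPoint d Δ → Finset (GridPoint d Δ)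
  G : GridPoint d Δ → Finset (GridPoint d Δ)
  o : GridPoint d Δ → ℝ
  card_le : K.card ≤ k
  o_nonneg : ∀ c, 0 ≤ o c
  sum_o_le : ∑ c ∈ K, o c ≤ 2 ^ z * optCost k z X
  sum_partCost : ∀ S, ∑ c ∈ K, partCost z X S (A c) = cost z X (centers S)
  covered : ∀ S c y, y ∈ S → y ∈ G c → partCost z X S (A c) ≤ coverFactor z * o c
  share : ∀ S c, coverFactor z * o c < partCost z X S (A c) →
    goodShare z * partCost z X S (A c) ≤ partCost z X S (G c)

/-- The clusters are the cells of nearest centers for a best set of grid centers; the good points of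
a cell are those whose cost to its center is at most twice the average over the cell, weighted by
multiplicity. -/
lemma exists_clusters {z : ℝ} (hz : 1 ≤ z) {k : ℕ} (hk : 1 ≤ k) {X : Multiset (GridPoint d Δ)}
    (hX : X ≠ 0) : Nonempty (Clusters z k X) := by
  classical
  obtain ⟨K, hK, hKk, hKc⟩ := exists_gridCenters hz hk hX
  choose near hnear hdist using fun y => exists_pointCost_eq hK y
  set A : GridPoint d Δ → Finset (GridPoint d Δ) := fun c => Finset.univ.filter fun y => near y = c
  set w : GridPoint d Δ → ℝ := fun y => X.count y
  have hw : ∀ y, 0 ≤ w y := fun y => Nat.cast_nonneg _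
  set o : GridPoint d Δ → ℝ := fun c => ∑ x ∈ A c, w x * dist x.toE c.toE ^ z
  have hH1 : (1 : ℝ) ≤ 2 ^ (z - 1) := Real.one_le_rpow (by norm_num) (by linarith)
  have ho : ∀ c, 0 ≤ o c := fun c =>
    Finset.sum_nonneg fun x _ => mul_nonneg (hw x) (Real.rpow_nonneg dist_nonneg _)
  have hfib : ∀ f : GridPoint d Δ → ℝ, ∑ c ∈ K, ∑ y ∈ A c, f y = ∑ y, f y := fun f =>
    Finset.sum_fiberwise_of_maps_to (fun y _ => hnear y) f
  refine ⟨⟨K, A, fun c => (A c).filter fun x => (∑ x ∈ A c, w x) * dist x.toE c.toE ^ z ≤ 2 * o c,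
    o, hKk, ho, ?_, ?_, ?_, ?_⟩⟩
  · refine le_trans (le_of_eq ?_) hKc
    rw [cost_eq_sum, ← hfib]
    refine Finset.sum_congr rfl fun c _ => Finset.sum_congr rfl fun x hx => ?_
    rw [pointCost, hdist, (Finset.mem_filter.1 hx).2]
  · intro S
    rw [cost_eq_sum, ← hfib]; rfl
  · intro S c y hy hyG
    refine (cluster_cost_le (A c) w c hz hw hy (Finset.mem_filter.1 hyG).2).trans ?_
    refine mul_le_mul_of_nonneg_right ?_ (ho c)
    unfold coverFactor; nlinarith
  · intro S c h
    have := cluster_good_share (A c) w c hz hw h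
    unfold goodShare
    rw [div_mul_eq_mul_div, one_mul, div_le_iff₀ (by positivity), mul_comm]
    exact this

end clusters

/-! ### Lazy sampling -/

/-- The list of answers in a message. -/
def Msg.answers {s d Δ : ℕ} : Msg s d Δ → List (Option (GridPoint d Δ))
  | .samples l => l
  | _ => []

lemma prod_map_eq_prod_pow_count {s : ℕ} (l : List (Fin s)) (f : Fin s → ℝ≥0∞) :
    (l.map f).prod = ∏ j, f j ^ l.count j := by
  induction l with
  | nil => simp
  | cons a l ih =>
    simp only [List.map_cons, List.prod_cons, ih, List.count_cons, pow_add, Finset.prod_mul_distrib,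
      mul_comm (f a)]
    congr 1
    rw [Finset.prod_eq_single a (fun j _ hj => by simp [hj.symm]) (by simp)]
    simp

lemma sum_map_eq_sum_count {s : ℕ} (l : List (Fin s)) (f : Fin s → ℝ≥0∞) :
    (l.map f).sum = ∑ j, l.count j * f j := by
  induction l with
  | nil => simp
  | cons a l ih =>
    simp only [List.map_cons, List.sum_cons, ih, List.count_cons, Nat.cast_add, add_mul,
      Finset.sum_add_distrib, add_comm (f a)]
    congr 1
    rw [Finset.sum_eq_single a (fun j _ hj => by simp [hj.symm]) (by simp)]
    simp

section partCost
variable {s d Δ : ℕ} {z : ℝ} {X : Fin s → Multiset (GridPoint d Δ)}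
  {S : Finset (GridPoint d Δ)} {Dt : Fin s → ℝ≥0}

lemma partCost_nonneg (X : Multiset (GridPoint d Δ)) (A : Finset (GridPoint d Δ)) :
    0 ≤ partCost z X S A :=
  Finset.sum_nonneg fun _ _ => mul_nonneg (Nat.cast_nonneg _) (pointCost_nonneg _ _)

lemma partCost_univ (X : Multiset (GridPoint d Δ)) :
    partCost z X S Finset.univ = cost z X (centers S) := (cost_eq_sum _ _).symm

lemma partCost_le_cost (X : Multiset (GridPoint d Δ)) (A : Finset (GridPoint d Δ)) :
    partCost z X S A ≤ cost z X (centers S) := by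
  rw [cost_eq_sum]
  exact Finset.sum_le_sum_of_subset_of_nonneg (Finset.subset_univ _) fun _ _ _ =>
    mul_nonneg (Nat.cast_nonneg _) (pointCost_nonneg _ _)

lemma cost_sum_le (hD : ∀ j, cost z (X j) (centers S) ≤ Dt j) :
    cost z (∑ j, X j) (centers S) ≤ ∑ j, (Dt j : ℝ) := by
  rw [cost_sum]; exact Finset.sum_le_sum fun j _ => hD j

end partCost

section lazySampling
variable {s d Δ : ℕ} [NeZero s] (z : ℝ) (X : Fin s → Multiset (GridPoint d Δ))
  (S : Finset (GridPoint d Δ)) (Dt : Fin s → ℝ≥0)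

/-- The law of the answers to a list of requests. -/
def lazyReplies (l : List (Fin s)) : PMF (Fin s → Msg s d Δ) :=
  independent s fun j => (iidList (lazyAnswer z (X j) S (Dt j)) (l.count j)).map .samples

/-- The expectation of a function of the answers in a batch of `m` requests. -/
def batchEx (m : ℕ) (f : (Fin s → Msg s d Δ) → ℝ≥0∞) : ℝ≥0∞ :=
  ex (iidList (drawSite Dt) m) fun l => ex (lazyReplies z X S Dt l) f

/-- The expectation of a function of the answer to a single request. -/
def requestEx (g : Option (GridPoint d Δ) → ℝ≥0∞) : ℝ≥0∞ :=
  ex (drawSite Dt) fun j => ex (lazyAnswer z (X j) S (Dt j)) g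

/-- The requests are grouped by site, but a product over all answers is blind to the grouping:
conditionally on the chosen sites, the answers are independent, so the batch behaves like `m`
independent single requests. -/
lemma batchEx_prod (m : ℕ) (g : Option (GridPoint d Δ) → ℝ≥0∞) :
    batchEx z X S Dt m (fun ms => ∏ j, ((ms j).answers.map g).prod) =
      requestEx z X S Dt g ^ m := by
  unfold batchEx lazyReplies requestEx
  rw [← ex_iidList_prod]
  refine ex_congr _ fun l _ => ?_
  rw [ex_independent_prod _ fun j (a : Msg s d Δ) => (a.answers.map g).prod,
    prod_map_eq_prod_pow_count]
  refine Finset.prod_congr rfl fun j _ => ?_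
  rw [ex_map]
  exact ex_iidList_prod _ _ _

lemma batchEx_sum (m : ℕ) (g : Option (GridPoint d Δ) → ℝ≥0∞) :
    batchEx z X S Dt m (fun ms => ∑ j, ((ms j).answers.map g).sum) =
      m * requestEx z X S Dt g := by
  unfold batchEx lazyReplies requestEx
  rw [← ex_iidList_sum]
  refine ex_congr _ fun l _ => ?_
  rw [ex_independent_sum _ fun j (a : Msg s d Δ) => (a.answers.map g).sum,
    sum_map_eq_sum_count]
  refine Finset.sum_congr rfl fun j _ => ?_
  rw [ex_map]
  exact ex_iidList_sum _ _ _

variable {z X S Dt}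

/-- The weights of the answers of a site. -/
def lazyWeight (z : ℝ) (X : Multiset (GridPoint d Δ)) (S : Finset (GridPoint d Δ)) (Dt : ℝ≥0) :
    Option (GridPoint d Δ) → ℝ≥0
  | none => Dt - (cost z X (centers S)).toNNReal
  | some y => X.count y * (pointCost z (centers S) y).toNNReal

lemma lazyAnswer_eq_draw (X : Multiset (GridPoint d Δ)) (Dt : ℝ≥0) :
    lazyAnswer z X S Dt = draw (lazyWeight z X S Dt) none := by
  rfl

lemma sum_lazyWeight {X : Multiset (GridPoint d Δ)} {Dt : ℝ≥0}
    (h : cost z X (centers S) ≤ Dt) : ∑ o, lazyWeight z X S Dt o = Dt := by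
  have h1 : ∑ y, lazyWeight z X S Dt (some y) = (cost z X (centers S)).toNNReal := by
    rw [cost_eq_sum, Real.toNNReal_sum_of_nonneg fun y _ =>
      mul_nonneg (Nat.cast_nonneg _) (pointCost_nonneg _ _)]
    refine Finset.sum_congr rfl fun y _ => ?_
    rw [Real.toNNReal_mul (Nat.cast_nonneg _), Real.toNNReal_natCast]; rfl
  rw [Fintype.sum_option, h1]
  exact tsub_add_cancel_of_le (Real.toNNReal_le_iff_le_coe.2 h)

/-- The factor `D̃_j` from the choice of the site cancels against the normalization at the site, so
the laziness costs only rejections. If `D̃_j = 0`, the site has cost zero and both sides vanish,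
whatever the default of `draw` is. -/
lemma requestEx_eq (hD : ∀ j, cost z (X j) (centers S) ≤ Dt j) (hDt : ∑ j, Dt j ≠ 0)
    (g : Option (GridPoint d Δ) → ℝ≥0∞) :
    requestEx z X S Dt g =
      ∑ j, ∑ o, ((lazyWeight z (X j) S (Dt j) o / ∑ i, Dt i : ℝ≥0) : ℝ≥0∞) * g o := by
  unfold requestEx drawSite
  rw [ex_draw _ _ hDt]
  refine Finset.sum_congr rfl fun j _ => ?_
  have hs := sum_lazyWeight (hD j)
  by_cases hj : Dt j = 0
  · have h0 : ∀ o, lazyWeight z (X j) S (Dt j) o = 0 := by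
      rw [hj, Finset.sum_eq_zero_iff] at hs
      intro o; rw [hj]; exact hs o (Finset.mem_univ o)
    simp [hj ▸ h0, hj]
  · rw [lazyAnswer_eq_draw, ex_draw _ _ (by rw [hs]; exact hj), hs, Finset.mul_sum]
    refine Finset.sum_congr rfl fun o _ => ?_
    rw [← mul_assoc, ← ENNReal.coe_mul]
    congr 2
    field_simp

open Classical in
/-- The probability that a request is answered with a point of `A`. -/
lemma requestEx_mem (hD : ∀ j, cost z (X j) (centers S) ≤ Dt j) (hDt : ∑ j, Dt j ≠ 0)
    (A : Finset (GridPoint d Δ)) :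
    requestEx z X S Dt (fun o => if ∃ y ∈ A, o = some y then 1 else 0) =
      ENNReal.ofReal (partCost z (∑ j, X j) S A / ∑ j, (Dt j : ℝ)) := by
  rw [requestEx_eq hD hDt, ENNReal.ofReal]
  have h1 : ∀ j, ∑ o, ((lazyWeight z (X j) S (Dt j) o / ∑ i, Dt i : ℝ≥0) : ℝ≥0∞) *
      (if ∃ y ∈ A, o = some y then 1 else 0) =
      ((∑ y ∈ A, ((X j).count y * (pointCost z (centers S) y).toNNReal) / ∑ i, Dt i : ℝ≥0) :
        ℝ≥0∞) := by
    intro j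
    rw [Fintype.sum_option]
    simp only [reduceCtorEq, and_false, exists_false, if_false, mul_zero, zero_add,
      Option.some.injEq, exists_eq_right', mul_ite, mul_one]
    rw [← Finset.sum_filter, Finset.filter_mem_eq_inter, Finset.univ_inter]
    push_cast
    rfl
  rw [Finset.sum_congr rfl fun j _ => h1 j]
  have hsum : (0 : ℝ) ≤ ∑ j, (Dt j : ℝ) := Finset.sum_nonneg fun j _ => (Dt j).2
  rw [← ENNReal.ofNNReal_finsetSum, ENNReal.coe_inj, ← NNReal.coe_inj, Real.coe_toNNReal _
    (div_nonneg (partCost_nonneg _ _) hsum)]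
  push_cast
  rw [Finset.sum_comm, partCost, Finset.sum_div]
  refine Finset.sum_congr rfl fun y _ => ?_
  rw [Real.coe_toNNReal _ (pointCost_nonneg _ _), Multiset.count_sum', Nat.cast_sum,
    Finset.sum_mul, Finset.sum_div]

lemma requestEx_add (g h : Option (GridPoint d Δ) → ℝ≥0∞) :
    requestEx z X S Dt (fun o => g o + h o) = requestEx z X S Dt g + requestEx z X S Dt h := by
  simp only [requestEx, ex_add]

open Classical in
lemma requestEx_not_mem (hD : ∀ j, cost z (X j) (centers S) ≤ Dt j) (hDt : ∑ j, Dt j ≠ 0)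
    (A : Finset (GridPoint d Δ)) :
    requestEx z X S Dt (fun o => if ∃ y ∈ A, o = some y then 0 else 1) =
      ENNReal.ofReal (1 - partCost z (∑ j, X j) S A / ∑ j, (Dt j : ℝ)) := by
  have h1 := requestEx_add (z := z) (X := X) (S := S) (Dt := Dt)
    (fun o => if ∃ y ∈ A, o = some y then 1 else 0) (fun o => if ∃ y ∈ A, o = some y then 0 else 1)
  have h2 : requestEx z X S Dt (fun o => (if ∃ y ∈ A, o = some y then (1 : ℝ≥0∞) else 0) +
      (if ∃ y ∈ A, o = some y then 0 else 1)) = 1 := by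
    have h3 : ∀ o : Option (GridPoint d Δ), (if ∃ y ∈ A, o = some y then (1 : ℝ≥0∞) else 0) +
        (if ∃ y ∈ A, o = some y then 0 else 1) = 1 := fun o => by split_ifs <;> simp
    simp only [h3, requestEx, ex_const]
  rw [h2, requestEx_mem hD hDt] at h1
  have hpos : 0 < ∑ j, (Dt j : ℝ) := by
    have : 0 < ∑ j, Dt j := pos_iff_ne_zero.2 hDt
    exact_mod_cast this
  have hp : partCost z (∑ j, X j) S A / ∑ j, (Dt j : ℝ) ≤ 1 := by
    rw [div_le_one hpos]; exact (partCost_le_cost _ _).trans (cost_sum_le hD)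
  rw [ENNReal.ofReal_sub _ (div_nonneg (partCost_nonneg _ _) hpos.le), ENNReal.ofReal_one]
  exact (ENNReal.sub_eq_of_eq_add ENNReal.ofReal_ne_top (h1.trans (add_comm _ _))).symm

end lazySampling

/-! ### Concentration of L1Sampling -/

lemma coe_l1Base : (l1Base : ℝ) = 2 := by norm_num [l1Base, l1Mu]

section l1Sampling
variable {s : ℕ} {Dt V : Fin s → ℝ≥0}

/-- The total estimate cancels and `2 * μ = 16`, so the test compares the empirical mean of `V j /
D̃_j` with `1 / 16`. The expectation of this mean is the ratio of the totals. -/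
lemma l1Test_iff (hDt : ∑ j, Dt j ≠ 0) {l : List (Fin s)} {r : Fin s → Option ℕ}
    (hr : ∀ j ∈ l, powerValue l1Base (r j) = V j) :
    l1Test Dt l r ↔ 16 * (l.map fun j => ((V j / Dt j : ℝ≥0) : ℝ)).sum ≤ l.length := by
  unfold l1Test
  have h1 : (l.map fun j => (∑ i, Dt i) / Dt j * powerValue l1Base (r j)).sum =
      (∑ i, Dt i) * (l.map fun j => V j / Dt j).sum := by
    rw [← List.sum_map_mul_left]
    congr 1
    refine List.map_congr_left fun j hj => ?_
    rw [hr j hj, div_mul_eq_mul_div, mul_div_assoc]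
  have h2 : (l.map fun j => ((V j / Dt j : ℝ≥0) : ℝ)).sum =
      (((l.map fun j => V j / Dt j).sum : ℝ≥0) : ℝ) := by
    rw [NNReal.coe_list_sum, List.map_map]; rfl
  have hpos : 0 < ∑ j, Dt j := pos_iff_ne_zero.2 hDt
  rw [h1, h2]
  have h3 : 2 * l1Mu * ((∑ i, Dt i) * (l.map fun j => V j / Dt j).sum) =
      (16 * (l.map fun j => V j / Dt j).sum) * ∑ i, Dt i := by
    rw [show l1Mu = 8 from rfl]; ring
  rw [h3, mul_le_mul_iff_left₀ hpos, ← NNReal.coe_le_coe]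
  push_cast
  rfl

variable [NeZero s]

/-- The exponential moments of the terms of L1Sampling. -/
lemma ex_iidList_rpow_sum (b : ℝ) (hb : 0 < b) (hDt : ∑ j, Dt j ≠ 0) (hV : ∀ j, V j ≤ Dt j)
    (R : ℕ) :
    ex (iidList (drawSite Dt) R)
        (fun l => ENNReal.ofReal (b ^ ((l.map fun j => ((V j / Dt j : ℝ≥0) : ℝ)).sum))) ≤
      ENNReal.ofReal (1 + (b - 1) * ((∑ j, (V j : ℝ)) / ∑ j, (Dt j : ℝ))) ^ R := by
  have h1 : ∀ l : List (Fin s),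
      ENNReal.ofReal (b ^ ((l.map fun j => ((V j / Dt j : ℝ≥0) : ℝ)).sum)) =
      (l.map fun j => ENNReal.ofReal (b ^ ((V j / Dt j : ℝ≥0) : ℝ))).prod := by
    intro l
    induction l with
    | nil => simp
    | cons a l ih =>
      rw [List.map_cons, List.sum_cons, Real.rpow_add hb, ENNReal.ofReal_mul (by positivity), ih,
        List.map_cons, List.prod_cons]
  simp only [h1]
  rw [ex_iidList_prod]
  gcongr
  unfold drawSite
  rw [ex_draw _ _ hDt]
  have hpos : 0 < ∑ j, (Dt j : ℝ) := by
    have : 0 < ∑ j, Dt j := pos_iff_ne_zero.2 hDt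
    exact_mod_cast this
  have h2 : ∀ j, ((Dt j / ∑ i, Dt i : ℝ≥0) : ℝ≥0∞) *
      ENNReal.ofReal (b ^ ((V j / Dt j : ℝ≥0) : ℝ)) ≤
      ENNReal.ofReal ((Dt j + (b - 1) * V j) / ∑ i, (Dt i : ℝ)) := by
    intro j
    -- Bernoulli's inequality: on `[0, 1]` the convex function `b ^ x` lies below its chord, whose
    -- expectation depends only on the mean.
    have h3 : b ^ ((V j / Dt j : ℝ≥0) : ℝ) ≤ 1 + ((V j / Dt j : ℝ≥0) : ℝ) * (b - 1) := by
      have := rpow_one_add_le_one_add_mul_self (s := b - 1) (by linarith)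
        (p := ((V j / Dt j : ℝ≥0) : ℝ)) (NNReal.coe_nonneg _)
        (by exact_mod_cast div_le_one_of_le₀ (hV j) zero_le)
      rwa [add_sub_cancel] at this
    rw [← ENNReal.ofReal_coe_nnreal, ← ENNReal.ofReal_mul (NNReal.coe_nonneg _)]
    refine ENNReal.ofReal_le_ofReal ((mul_le_mul_of_nonneg_left h3 (NNReal.coe_nonneg _)).trans ?_)
    push_cast
    by_cases hj : Dt j = 0
    · have hV0 : V j = 0 := le_antisymm (hj ▸ hV j) zero_le
      simp [hj, hV0]
    · have hj' : (Dt j : ℝ) ≠ 0 := by exact_mod_cast hj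
      refine le_of_eq ?_
      field_simp
      try ring
  have hnn : ∀ j, 0 ≤ ((Dt j : ℝ) + (b - 1) * V j) / ∑ i, (Dt i : ℝ) := by
    intro j
    have : (V j : ℝ) ≤ Dt j := hV j
    refine div_nonneg ?_ hpos.le
    nlinarith [(V j).2]
  refine (Finset.sum_le_sum fun j _ => h2 j).trans ?_
  rw [← ENNReal.ofReal_sum_of_nonneg fun j _ => hnn j]
  refine ENNReal.ofReal_le_ofReal (le_of_eq ?_)
  rw [← Finset.sum_div, Finset.sum_add_distrib, ← Finset.mul_sum]
  field_simp

/-- Chernoff bound at the threshold `R / 16`, for the lower tail if `b < 1` and for the upper tail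
if `b > 1`. Markov's inequality leaves the ratio `c / b ^ (1 / 16)` to the power `R`; the
requirement that this ratio is at most `0.99` is stated as a sixteenth power, so that it is a
comparison of rationals. -/
lemma toOuterMeasure_le_of_rpow (b c : ℝ) (hb : 0 < b) (hDt : ∑ j, Dt j ≠ 0)
    (hV : ∀ j, V j ≤ Dt j) (R : ℕ) (E : Set (List (Fin s)))
    (hE : ∀ l ∈ E, l.length = R →
      (b ^ (1 / 16 : ℝ)) ^ R ≤ b ^ ((l.map fun j => ((V j / Dt j : ℝ≥0) : ℝ)).sum))
    (hle : 1 + (b - 1) * ((∑ j, (V j : ℝ)) / ∑ j, (Dt j : ℝ)) ≤ c)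
    (hcb : c ^ 16 ≤ 0.99 ^ 16 * b) :
    (iidList (drawSite Dt) R).toOuterMeasure E ≤ ENNReal.ofReal (0.99 ^ R) := by
  have h1 := mul_toOuterMeasure_le_ex (iidList (drawSite Dt) R)
    (fun l => ENNReal.ofReal (b ^ ((l.map fun j => ((V j / Dt j : ℝ≥0) : ℝ)).sum))) E
    (ENNReal.ofReal ((b ^ (1 / 16 : ℝ)) ^ R))
    (fun l hl hlE => ENNReal.ofReal_le_ofReal (hE l hlE (mem_support_iidList hl).1))
  have h2 := h1.trans (ex_iidList_rpow_sum b hb hDt hV R)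
  have hb16 : 0 < b ^ (1 / 16 : ℝ) := Real.rpow_pos_of_pos hb _
  have hroot : c ≤ 0.99 * b ^ (1 / 16 : ℝ) := by
    refine le_of_pow_le_pow_left₀ (n := 16) (by norm_num) (by positivity) ?_
    rw [mul_pow, ← Real.rpow_natCast (b ^ (1 / 16 : ℝ)), ← Real.rpow_mul hb.le]
    norm_num at hcb ⊢
    exact hcb
  have h3 : ENNReal.ofReal (1 + (b - 1) * ((∑ j, (V j : ℝ)) / ∑ j, (Dt j : ℝ))) ^ R ≤
      ENNReal.ofReal ((b ^ (1 / 16 : ℝ)) ^ R) * ENNReal.ofReal (0.99 ^ R) := by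
    rw [← ENNReal.ofReal_mul (by positivity), ← mul_pow, ENNReal.ofReal_pow (by positivity)]
    gcongr
    linarith
  have h4 := h2.trans h3
  rwa [ENNReal.mul_le_mul_iff_right (by simpa using pow_pos hb16 R) ENNReal.ofReal_ne_top] at h4

/-- L1Sampling hardly ever returns True if the estimates are tight. -/
lemma l1Test_true_le (hDt : ∑ j, Dt j ≠ 0) (hV : ∀ j, V j ≤ Dt j)
    (h : (∑ j, (Dt j : ℝ)) ≤ 8 * ∑ j, (V j : ℝ)) (R : ℕ) :
    (iidList (drawSite Dt) R).toOuterMeasure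
      {l | 16 * (l.map fun j => ((V j / Dt j : ℝ≥0) : ℝ)).sum ≤ l.length} ≤
        ENNReal.ofReal (0.99 ^ R) := by
  have hpos : 0 < ∑ j, (Dt j : ℝ) := by
    have : 0 < ∑ j, Dt j := pos_iff_ne_zero.2 hDt
    exact_mod_cast this
  -- The mean is at least `1 / 8`, so the moment for `b = 1 / 2` is at most `1 - 1 / 2 * (1 / 8) =
  -- 15 / 16`.
  refine toOuterMeasure_le_of_rpow (1 / 2) (15 / 16) (by norm_num) hDt hV R _ ?_ ?_
    (by norm_num)
  · intro l hl hR
    rw [← Real.rpow_natCast, ← Real.rpow_mul (by norm_num)]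
    refine Real.rpow_le_rpow_of_exponent_ge (by norm_num) (by norm_num) ?_
    simp only [Set.mem_ofPred_eq, hR] at hl
    linarith
  · have : 1 / 8 ≤ (∑ j, (V j : ℝ)) / ∑ j, (Dt j : ℝ) := by
      rw [le_div_iff₀ hpos]; linarith
    linarith

/-- L1Sampling hardly ever returns False if the estimates are far too large. -/
lemma l1Test_false_le (hDt : ∑ j, Dt j ≠ 0) (hV : ∀ j, V j ≤ Dt j)
    (h : 32 * ∑ j, (V j : ℝ) ≤ ∑ j, (Dt j : ℝ)) (R : ℕ) :
    (iidList (drawSite Dt) R).toOuterMeasure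
      {l | ¬ 16 * (l.map fun j => ((V j / Dt j : ℝ≥0) : ℝ)).sum ≤ l.length} ≤
        ENNReal.ofReal (0.99 ^ R) := by
  have hpos : 0 < ∑ j, (Dt j : ℝ) := by
    have : 0 < ∑ j, Dt j := pos_iff_ne_zero.2 hDt
    exact_mod_cast this
  -- The mean is at most `1 / 32`, so the moment for `b = 2` is at most `33 / 32`.
  refine toOuterMeasure_le_of_rpow 2 (33 / 32) (by norm_num) hDt hV R _ ?_ ?_
    (by norm_num)
  · intro l hl hR
    rw [← Real.rpow_natCast, ← Real.rpow_mul (by norm_num)]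
    refine Real.rpow_le_rpow_of_exponent_le (by norm_num) ?_
    simp only [Set.mem_ofPred_eq, hR, not_le] at hl
    linarith
  · have : (∑ j, (V j : ℝ)) / ∑ j, (Dt j : ℝ) ≤ 1 / 32 := by
      rw [div_le_iff₀ hpos]; linarith
    linarith

end l1Sampling

/-! ### Lengths of the messages -/

lemma eq_of_mem_support_pure {α : Type*} {a b : α} (h : a ∈ (PMF.pure b).support) : a = b := by
  simpa using h

lemma length_natCode (m : ℕ) : (natCode m).length = 2 * Nat.size m + 1 := by
  simp [natCode, Nat.size_eq_bits_len]; ring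

lemma length_natCode_le {m m' : ℕ} (h : m ≤ m') : (natCode m).length ≤ 2 * Nat.size m' + 1 := by
  rw [length_natCode]; have := Nat.size_le_size h; omega

lemma length_optionCode_le {α : Type} {f : α → List Bool} {o : Option α} {b : ℕ}
    (h : ∀ a, o = some a → (f a).length ≤ b) : (optionCode f o).length ≤ b + 1 := by
  rcases o with _ | a
  · simp [optionCode]
  · simpa [optionCode] using h a rfl

lemma length_flatMap_le {α : Type} (f : α → List Bool) (b : ℕ) (l : List α)
    (h : ∀ a ∈ l, (f a).length ≤ b) : (l.flatMap f).length ≤ l.length * b := by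
  rw [List.length_flatMap]
  have := List.sum_le_card_nsmul (l.map fun a => (f a).length) b (by simpa using h)
  simpa using this

lemma length_pointCode_le {d Δ : ℕ} (p : GridPoint d Δ) :
    (pointCode p).length ≤ d * (2 * Nat.size Δ + 1) := by
  have := length_flatMap_le (fun t => natCode (p t)) (2 * Nat.size Δ + 1) (List.finRange d)
    fun t _ => length_natCode_le (p t).2.le
  simpa [pointCode] using this

/-- A rejection costs a single bit; only accepted points cost coordinates, and these are charged to
the counter `M`. -/
lemma length_code_samples_le {s d Δ : ℕ} (l : List (Option (GridPoint d Δ))) :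
    (Msg.code (.samples l : Msg s d Δ)).length ≤
      l.length + (Msg.getPoints (.samples l : Msg s d Δ)).length * (d * (2 * Nat.size Δ + 1)) := by
  simp only [Msg.code, Msg.getPoints]
  induction l with
  | nil => simp
  | cons o l ih =>
    rcases o with _ | y
    · simp only [List.flatMap_cons, optionCode, List.length_append, List.length_cons,
        List.length_nil, List.reduceOption_cons_of_none]
      omega
    · simp only [List.flatMap_cons, optionCode, List.length_append, List.length_cons,
        List.reduceOption_cons_of_some, add_mul, one_mul]
      have := length_pointCode_le y
      omega

lemma code_request {s d Δ : ℕ} (l : List (Fin s)) :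
    Msg.code (.request l : Msg s d Δ) = l.flatMap fun j : Fin s => natCode j := by
  simp only [Msg.code]
  induction l with
  | nil => rfl
  | cons a l ih => simpa using ih

lemma length_code_request_le {s d Δ : ℕ} (l : List (Fin s)) :
    (Msg.code (.request l : Msg s d Δ)).length ≤ l.length * (2 * Nat.size s + 1) := by
  rw [code_request]
  exact length_flatMap_le (fun j : Fin s => natCode j) _ l fun j _ => length_natCode_le j.2.le

lemma sum_count_eq_length {s : ℕ} (l : List (Fin s)) : ∑ j, l.count j = l.length := by
  induction l with
  | nil => simp
  | cons a l ih =>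
    simp only [List.count_cons, Finset.sum_add_distrib, ih, List.length_cons]
    congr 1
    rw [Finset.sum_eq_single a (fun j _ hj => by simp [hj.symm]) (by simp)]
    simp

lemma sum_le_mul_of_le {s : ℕ} {f : Fin s → ℕ} {b : ℕ} (h : ∀ j, f j ≤ b) : ∑ j, f j ≤ s * b := by
  have := Finset.sum_le_card_nsmul Finset.univ f b fun j _ => h j
  simpa using this

/-! ### Invariants of the algorithm -/

section invariant
variable {s d Δ : ℕ}

namespace PublicState

/-- What holds for the public state after the first point has been chosen. -/
structure Sound (z : ℝ) (X : Fin s → Multiset (GridPoint d Δ)) (q : PublicState s d Δ) : Prop where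
  nonempty : q.S.Nonempty
  cost_le : ∀ j, cost z (X j) (centers q.S) ≤ q.Dt j
  card_le : q.S.card ≤ q.M + 1

/-- What holds for the public state in the inner loop. -/
structure Active (z : ℝ) (X : Fin s → Multiset (GridPoint d Δ)) (k : ℕ)
    (q : PublicState s d Δ) : Prop extends Sound z X q where
  est_ne : ∃ j, q.est j ≠ none
  pos : 0 < d
  one_le : 1 ≤ q.i
  pow_le : 2 ^ q.i ≤ 2 * k

end PublicState

variable (z : ℝ) (X : Fin s → Multiset (GridPoint d Δ)) (k N R : ℕ)

/-- The invariant of the control flow. -/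
def ControlInv (q : PublicState s d Δ) (rounds : ℕ) : Prop :=
  match q.phase with
  | .sizes => q.M = 0 ∧ rounds = 0
  | .chooseFirst size => (∀ j, size j = (X j).card) ∧ q.M = 0 ∧ rounds = 1
  | .first j => X j ≠ 0 ∧ q.M = 0 ∧ rounds = 2
  | .report => q.S.Nonempty ∧ q.S.card ≤ 1 ∧ q.M = 0 ∧ rounds = 3
  -- The sequence started with `M < N`, and the batches before batch `i` have fewer than `2 ^ i`
  -- requests in total.
  | .lazyRequest => q.Active z X k ∧ q.M ≤ N + 2 ^ q.i
  | .lazyReply l => q.Active z X k ∧ q.M ≤ N + 2 ^ q.i ∧ l.length = 2 ^ q.i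
  | .l1Request => q.Active z X k ∧ q.M ≤ N + 2 ^ (q.i + 1)
  | .l1Reply l => q.Active z X k ∧ q.M ≤ N + 2 ^ (q.i + 1) ∧ l.length = R
  | .refresh => q.Sound z X ∧ q.M ≤ N + 4 * k ∧ 0 < d
  -- In dimension zero all costs vanish and the run ends after four rounds. This case is recorded
  -- because `k * d` then gives no control over `log k`.
  | .done => q.Sound z X ∧ q.M ≤ N + 4 * k ∧ (N ≤ q.M ∨ ∀ j, q.est j = none) ∧
      (0 < d ∨ rounds ≤ 4)

/-- The bits of a point. -/
def pointBits (d Δ : ℕ) : ℕ := d * (2 * Nat.size Δ + 1)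

/-- A bound on the bits of a round, except for the sampled points and the sizes of the datasets. -/
def roundBits (s d k R E : ℕ) : ℕ :=
  -- The factor `d` may be included since batches occur only for `0 < d`; it makes the bound
  -- comparable with `k * d + s`.
  (2 * k * d + 1 + R) * (2 * Nat.size s + 1) + 2 * k * d + s * (2 * Nat.size E + 3)

/-- A bound on the number of bits. -/
def bitsBound (n E : ℕ) (q : PublicState s d Δ) (rounds : ℕ) : ℕ :=
  rounds * roundBits s d k R E + q.M * pointBits d Δ +
    match q.phase with
    | .sizes => 0
    | .chooseFirst _ => s * (2 * Nat.size n + 1)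
    | .first _ => s * (2 * Nat.size n + 1)
    | _ => s * (2 * Nat.size n + 1) + pointBits d Δ

variable {z X k N R}

lemma controlInv_outerLoop {q : PublicState s d Δ} (hk : 1 ≤ k) (h : q.Sound z X)
    (hM : q.M ≤ N + 4 * k) (hd : (∃ j, q.est j ≠ none) → 0 < d) {rounds : ℕ}
    (hr : 0 < d ∨ rounds ≤ 4) : ControlInv z X k N R (q.outerLoop N) rounds := by
  unfold PublicState.outerLoop
  split_ifs with hc
  · refine ⟨⟨⟨h.nonempty, h.cost_le, h.card_le⟩, hc.2, hd hc.2, le_rfl, ?_⟩, ?_⟩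
    · show 2 ^ 1 ≤ 2 * k
      omega
    · exact hc.1.le.trans (Nat.le_add_right _ _)
  · refine ⟨⟨h.nonempty, h.cost_le, h.card_le⟩, hM, ?_, hr⟩
    show N ≤ q.M ∨ ∀ j, q.est j = none
    by_contra hcon
    push Not at hcon
    exact hc ⟨hcon.1, hcon.2⟩

lemma bitsBound_outerLoop {n E : ℕ} {q : PublicState s d Δ} {rounds : ℕ} :
    bitsBound k R n E (q.outerLoop N) rounds = rounds * roundBits s d k R E + q.M * pointBits d Δ +
      (s * (2 * Nat.size n + 1) + pointBits d Δ) := by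
  unfold PublicState.outerLoop bitsBound
  split_ifs <;> rfl

lemma length_exponent_le {r : Option ℕ} {E : ℕ} (h : ∀ e, r = some e → e ≤ E) :
    (Msg.code (.exponent r : Msg s d Δ)).length ≤ 2 * Nat.size E + 3 := by
  have := length_optionCode_le (f := natCode) (o := r) fun e he => length_natCode_le (h e he)
  exact this.trans (by omega)

lemma cost_eq_zero_of_dim (hz : 1 ≤ z) (hd : d = 0) {S : Finset (GridPoint d Δ)}
    (Y : Multiset (GridPoint d Δ)) : cost z Y (centers S) = 0 := by
  rw [cost_eq_sum]
  refine Finset.sum_eq_zero fun y _ => ?_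
  rcases S.eq_empty_or_nonempty with rfl | ⟨c, hc⟩
  -- The distance to the empty set is zero by convention.
  · simp [pointCost, centers, Real.zero_rpow (show z ≠ 0 by linarith)]
  · have : y = c := by subst hd; exact Subsingleton.elim _ _
    rw [this, pointCost_eq_zero hz hc, mul_zero]

variable [NeZero s]

/-- The invariant holds on the whole support. It bounds `|S|` surely and the bits in terms of the
rounds, so that only the number of rounds has to be controlled in probability. -/
lemma invariant_step (hz : 1 ≤ z) (hk : 1 ≤ k) {n E : ℕ} (hn : 1 ≤ n)
    (hX : ∑ j, (X j).card = n)
    (hE : ∀ (S : Finset (GridPoint d Δ)) j r, S.Nonempty →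
      powerApprox 2 (cost z (X j) (centers S)) = some r → r ≤ E)
    (c : (lazyAdaptiveSampling s d Δ z k N R).Config)
    (hc : ControlInv z X k N R c.state c.rounds ∧
      c.bits ≤ bitsBound k R n E c.state c.rounds)
    (c' : (lazyAdaptiveSampling s d Δ z k N R).Config)
    (hc' : c' ∈ ((lazyAdaptiveSampling s d Δ z k N R).round X c).support) :
    ControlInv z X k N R c'.state c'.rounds ∧ c'.bits ≤ bitsBound k R n E c'.state c'.rounds := by
  classical
  obtain ⟨⟨phase, S, est, M, i⟩, bits, rounds⟩ := c
  obtain ⟨hc, hb⟩ := hc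
  have hcard : ∀ j, (X j).card ≤ n := fun j =>
    hX ▸ Finset.single_le_sum (f := fun j => (X j).card) (fun _ _ => Nat.zero_le _)
      (Finset.mem_univ j)
  have hbits0 : ∀ (m : Msg s d Δ), m ∈ (PMF.pure Msg.silent).support → (Msg.code m).length = 0 := by
    intro m hm
    simp only [PMF.support_pure, Set.mem_singleton_iff] at hm
    rw [hm]; rfl
  by_cases hdone : phase = .done
  · subst hdone
    rw [BlackboardProtocol.round_of_output (o := S) _ _ rfl] at hc'
    simp only [PMF.support_pure, Set.mem_singleton_iff] at hc'
    subst hc'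
    exact ⟨hc, hb⟩
  have hnone : (lazyAdaptiveSampling s d Δ z k N R).output ⟨phase, S, est, M, i⟩ = none := by
    cases phase <;> first | rfl | exact absurd rfl hdone
  obtain ⟨mc, hmc, ms, hms, rfl⟩ := BlackboardProtocol.mem_support_round _ _ hnone hc'
  clear hc'
  cases phase with
  | done => exact absurd rfl hdone
  | sizes =>
    obtain ⟨hM, hr⟩ := hc
    have h0 := hbits0 mc hmc
    have hms' : ∀ j, ms j = .number (X j).card := fun j => eq_of_mem_support_pure (hms j)
    refine ⟨⟨fun j => by simp [hms', Msg.getNumber], hM, congrArg (· + 1) hr⟩, ?_⟩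
    have h1 : ∑ j, (Msg.code (ms j)).length ≤ s * (2 * Nat.size n + 1) :=
      sum_le_mul_of_le fun j => by rw [hms']; exact length_natCode_le (hcard j)
    simp only [bitsBound, lazyAdaptiveSampling, PublicState.advance] at hb ⊢
    rw [h0, add_mul]; omega
  | chooseFirst size =>
    obtain ⟨hsize, hM, hr⟩ := hc
    -- Since `n ≥ 1`, the weights are not all zero, so `draw` does not fall back on its default and
    -- the chosen site has a point.
    have hw : ∑ j, ((size j : ℕ) : ℝ≥0) ≠ 0 := by
      simp only [hsize]
      rw [← Nat.cast_sum, hX]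
      exact_mod_cast (by omega : n ≠ 0)
    have hmc' : mc ∈ ((drawSite fun j => ((size j : ℕ) : ℝ≥0)).map
        fun j => (Msg.request [j] : Msg s d Δ)).support := hmc
    rw [PMF.support_map] at hmc'
    obtain ⟨j, hj, rfl⟩ := hmc'
    have hj0 := ne_zero_of_mem_support_draw hw hj
    have h0 : ∀ j, (Msg.code (ms j)).length = 0 := fun j => hbits0 _ (hms j)
    refine ⟨⟨?_, hM, congrArg (· + 1) hr⟩, ?_⟩
    · intro h; simp [hsize, h] at hj0
    have h1 := length_code_request_le (d := d) (Δ := Δ) [j]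
    have h2 : 1 * (2 * Nat.size s + 1) ≤ roundBits s d k R E := by
      unfold roundBits
      refine le_trans (Nat.mul_le_mul_right _ ?_) ((Nat.le_add_right _ _).trans
        (Nat.le_add_right _ _))
      omega
    have h3 : ∑ j, (Msg.code (ms j)).length = 0 := Finset.sum_eq_zero fun j _ => h0 j
    simp only [bitsBound, lazyAdaptiveSampling, PublicState.advance, Msg.getRequest,
      List.length_singleton] at hb h1 ⊢
    rw [h3, add_mul]; omega
  | first j₀ =>
    obtain ⟨hj₀, hM, hr⟩ := hc
    have h0 := hbits0 mc hmc
    have hw : ∑ o : Option (GridPoint d Δ), (match o with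
        | none => 0
        | some y => ((X j₀).count y : ℝ≥0)) ≠ 0 := by
      intro h
      rw [Finset.sum_eq_zero_iff] at h
      obtain ⟨y, hy⟩ := Multiset.exists_mem_of_ne_zero hj₀
      have := h (some y) (Finset.mem_univ _)
      simp only [Nat.cast_eq_zero, Multiset.count_eq_zero] at this
      exact this hy
    have h1 : ∃ y, ms j₀ = .samples [some y] := by
      have h2 := hms j₀
      simp only [lazyAdaptiveSampling, if_true] at h2
      rw [PMF.support_map] at h2
      obtain ⟨o, ho, hoe⟩ := h2
      have ho0 := ne_zero_of_mem_support_draw hw ho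
      rcases o with _ | y
      · exact absurd rfl ho0
      · exact ⟨y, hoe.symm⟩
    obtain ⟨y, hy⟩ := h1
    have h2 : ∀ j ≠ j₀, (Msg.code (ms j)).length = 0 := by
      intro j hj
      have h3 := hms j
      simp only [lazyAdaptiveSampling, if_neg hj] at h3
      exact hbits0 _ h3
    have h3 : ∑ j, (Msg.code (ms j)).length = (Msg.code (ms j₀)).length :=
      Finset.sum_eq_single _ (fun j _ hj => h2 j hj) (by simp)
    have hS : (ms j₀).getPoints.toFinset = {y} := by rw [hy]; rfl
    refine ⟨⟨?_, ?_, hM, congrArg (· + 1) hr⟩, ?_⟩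
    · show (ms j₀).getPoints.toFinset.Nonempty
      rw [hS]; exact Finset.singleton_nonempty _
    · show (ms j₀).getPoints.toFinset.card ≤ 1
      rw [hS]; rfl
    have h4 : (Msg.code (ms j₀)).length ≤ 1 + 1 * pointBits d Δ := by
      rw [hy]; exact length_code_samples_le _
    have h5 : 1 ≤ roundBits s d k R E := by
      unfold roundBits
      have : 1 * 1 ≤ (2 * k * d + 1 + R) * (2 * Nat.size s + 1) :=
        Nat.mul_le_mul (by omega) (by omega)
      omega
    simp only [bitsBound, lazyAdaptiveSampling, PublicState.advance] at hb h3 ⊢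
    rw [h3, h0, add_mul]; omega
  | report =>
    obtain ⟨hS, hScard, hM, hr⟩ := hc
    have h0 := hbits0 mc hmc
    have hms' : ∀ j, ms j = .exponent (powerApprox 2 (cost z (X j) (centers S))) := fun j =>
      eq_of_mem_support_pure (hms j)
    have hest : ∀ j, (ms j).getExponent = powerApprox 2 (cost z (X j) (centers S)) := fun j => by
      rw [hms']; rfl
    simp only [lazyAdaptiveSampling, PublicState.advance]
    refine ⟨controlInv_outerLoop hk ?_ ?_ ?_ (Or.inr (by have : rounds = 3 := hr; show rounds + 1 ≤ 4; omega)), ?_⟩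
    · refine ⟨hS, fun j => ?_, hScard.trans (by omega)⟩
      simp only [PublicState.Dt, hest]
      exact le_powerValue (cost_nonneg _ _)
    · exact le_trans (le_of_eq hM) (Nat.zero_le _)
    · rintro ⟨j, hj⟩
      by_contra hd
      refine hj ?_
      simp only [hest]
      rw [cost_eq_zero_of_dim hz (by omega), powerApprox_zero]
    · have h1 : ∑ j, (Msg.code (ms j)).length ≤ s * (2 * Nat.size E + 3) :=
        sum_le_mul_of_le fun j => by
          rw [hms']; exact length_exponent_le fun e he => hE S j e hS he
      have h2 : s * (2 * Nat.size E + 3) ≤ roundBits s d k R E := Nat.le_add_left _ _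
      rw [bitsBound_outerLoop]
      simp only [bitsBound] at hb h0 h1 ⊢
      rw [h0, add_mul]; omega
  | lazyRequest =>
    obtain ⟨hA, hM⟩ := hc
    have hmc' : mc ∈ ((iidList (drawSite (PublicState.Dt ⟨.lazyRequest, S, est, M, i⟩)) (2 ^ i)).map
        (Msg.request : _ → Msg s d Δ)).support := hmc
    rw [PMF.support_map] at hmc'
    obtain ⟨l, hl, rfl⟩ := hmc'
    have hlen := (mem_support_iidList hl).1
    have h0 : ∀ j, (Msg.code (ms j)).length = 0 := fun j => hbits0 _ (hms j)
    refine ⟨⟨⟨⟨hA.nonempty, hA.cost_le, hA.card_le⟩, hA.est_ne, hA.pos, hA.one_le, hA.pow_le⟩,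
      hM, hlen⟩, ?_⟩
    have h1 := length_code_request_le (d := d) (Δ := Δ) l
    have h2 : l.length * (2 * Nat.size s + 1) ≤ roundBits s d k R E := by
      unfold roundBits
      refine le_trans (Nat.mul_le_mul_right _ ?_) ((Nat.le_add_right _ _).trans
        (Nat.le_add_right _ _))
      have h3 : 2 * k * 1 ≤ 2 * k * d := Nat.mul_le_mul_left _ hA.pos
      have h4 : 2 ^ i ≤ 2 * k := hA.pow_le
      omega
    have h3 : ∑ j, (Msg.code (ms j)).length = 0 := Finset.sum_eq_zero fun j _ => h0 j
    simp only [bitsBound, lazyAdaptiveSampling, PublicState.advance, Msg.getRequest] at hb h1 ⊢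
    rw [h3, add_mul]; omega
  | lazyReply l =>
    obtain ⟨hA, hM, hlen⟩ := hc
    have h0 := hbits0 mc hmc
    have hms' : ∀ j, ∃ a : List (Option (GridPoint d Δ)), a.length = l.count j ∧
        ms j = .samples a := by
      intro j
      have h1 : ms j ∈ ((iidList (lazyAnswer z (X j) S
        (PublicState.Dt ⟨.lazyReply l, S, est, M, i⟩ j)) (l.count j)).map
          (Msg.samples : _ → Msg s d Δ)).support := hms j
      rw [PMF.support_map] at h1
      obtain ⟨a, ha, hae⟩ := h1
      exact ⟨a, (mem_support_iidList ha).1, hae.symm⟩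
    have hcount : ∀ j, (ms j).getPoints.length ≤ l.count j := by
      intro j
      obtain ⟨a, ha, hae⟩ := hms' j
      rw [hae, ← ha]; exact List.reduceOption_length_le a
    have hsum : ∑ j, (ms j).getPoints.length ≤ 2 ^ i := by
      have h1 := Finset.sum_le_sum fun j (_ : j ∈ Finset.univ) => hcount j
      rw [sum_count_eq_length, hlen] at h1
      exact h1
    have hsub : S ⊆ S ∪ Finset.univ.biUnion fun j => (ms j).getPoints.toFinset :=
      Finset.subset_union_left
    refine ⟨⟨⟨⟨hA.nonempty.mono hsub, fun j => ?_, ?_⟩, hA.est_ne, hA.pos, hA.one_le, hA.pow_le⟩,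
      ?_⟩, ?_⟩
    · exact (cost_anti (by linarith) hA.nonempty hsub _).trans (hA.cost_le j)
    · refine (Finset.card_union_le _ _).trans ?_
      have h1 : (Finset.univ.biUnion fun j => (ms j).getPoints.toFinset).card ≤
          ∑ j, (ms j).getPoints.length :=
        Finset.card_biUnion_le.trans (Finset.sum_le_sum fun j _ => List.toFinset_card_le _)
      have h2 := hA.card_le
      simp only [lazyAdaptiveSampling, PublicState.advance] at h2 ⊢
      omega
    · simp only [lazyAdaptiveSampling, PublicState.advance] at hM ⊢
      rw [pow_succ]; omega
    · have h1 : ∑ j, (Msg.code (ms j)).length ≤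
          ∑ j, (l.count j + (ms j).getPoints.length * pointBits d Δ) := by
        refine Finset.sum_le_sum fun j _ => ?_
        obtain ⟨a, ha, hae⟩ := hms' j
        rw [← ha, hae]; exact length_code_samples_le a
      rw [Finset.sum_add_distrib, sum_count_eq_length, hlen, ← Finset.sum_mul] at h1
      have h2 : 2 ^ i ≤ roundBits s d k R E := by
        have h3 : 2 * k * 1 ≤ 2 * k * d := Nat.mul_le_mul_left _ hA.pos
        have h4 : 2 ^ i ≤ 2 * k := hA.pow_le
        unfold roundBits; omega
      simp only [bitsBound, lazyAdaptiveSampling, PublicState.advance] at hb h1 ⊢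
      rw [h0, add_mul, add_mul]; omega
  | l1Request =>
    obtain ⟨hA, hM⟩ := hc
    have hmc' : mc ∈ ((iidList (drawSite (PublicState.Dt ⟨.l1Request, S, est, M, i⟩)) R).map
        (Msg.request : _ → Msg s d Δ)).support := hmc
    rw [PMF.support_map] at hmc'
    obtain ⟨l, hl, rfl⟩ := hmc'
    have hlen := (mem_support_iidList hl).1
    have h0 : ∀ j, (Msg.code (ms j)).length = 0 := fun j => hbits0 _ (hms j)
    refine ⟨⟨⟨⟨hA.nonempty, hA.cost_le, hA.card_le⟩, hA.est_ne, hA.pos, hA.one_le, hA.pow_le⟩,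
      hM, hlen⟩, ?_⟩
    have h1 := length_code_request_le (d := d) (Δ := Δ) l
    have h2 : l.length * (2 * Nat.size s + 1) ≤ roundBits s d k R E := by
      unfold roundBits
      refine le_trans (Nat.mul_le_mul_right _ ?_) ((Nat.le_add_right _ _).trans
        (Nat.le_add_right _ _))
      omega
    have h3 : ∑ j, (Msg.code (ms j)).length = 0 := Finset.sum_eq_zero fun j _ => h0 j
    simp only [bitsBound, lazyAdaptiveSampling, PublicState.advance, Msg.getRequest] at hb h1 ⊢
    rw [h3, add_mul]; omega
  | l1Reply l =>
    obtain ⟨hA, hM, hlen⟩ := hc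
    have h0 := hbits0 mc hmc
    have h1 : ∑ j, (Msg.code (ms j)).length ≤ s * (2 * Nat.size E + 3) := by
      refine sum_le_mul_of_le fun j => ?_
      have h2 := hms j
      simp only [lazyAdaptiveSampling] at h2
      split_ifs at h2 with hj
      -- The base of L1Sampling is `8 / 4 = 2`, so the bound `hE` on the exponents applies here as
      -- well.
      · rw [eq_of_mem_support_pure h2, coe_l1Base]
        exact length_exponent_le fun e he => hE S j e hA.nonempty he
      · rw [hbits0 _ h2]; omega
    have h2 : s * (2 * Nat.size E + 3) ≤ roundBits s d k R E := Nat.le_add_left _ _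
    have hpow : 2 ^ (i + 1) ≤ 4 * k := by
      have h4 : 2 ^ i ≤ 2 * k := hA.pow_le
      rw [pow_succ]; omega
    have hM' : M ≤ N + 2 ^ (i + 1) := hM
    simp only [lazyAdaptiveSampling, PublicState.advance]
    split_ifs with ht hi
    · refine ⟨⟨⟨hA.nonempty, hA.cost_le, hA.card_le⟩, ?_, hA.pos⟩, ?_⟩
      · show M ≤ _
        omega
      · simp only [bitsBound] at hb h1 h0 ⊢
        rw [h0, add_mul]; omega
    · refine ⟨⟨⟨⟨hA.nonempty, hA.cost_le, hA.card_le⟩, hA.est_ne, hA.pos, ?_, ?_⟩, hM⟩, ?_⟩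
      · show 1 ≤ i + 1
        omega
      · show 2 ^ (i + 1) ≤ _
        omega
      · simp only [bitsBound] at hb h1 h0 ⊢
        rw [h0, add_mul]; omega
    · refine ⟨controlInv_outerLoop hk hA.toSound ?_ (fun _ => hA.pos) (Or.inl hA.pos), ?_⟩
      · show M ≤ _
        omega
      · rw [bitsBound_outerLoop]
        simp only [bitsBound] at hb h1 h0 ⊢
        rw [h0, add_mul]; omega
  | refresh =>
    obtain ⟨hA, hM, hd⟩ := hc
    have h0 := hbits0 mc hmc
    have hms' : ∀ j, ms j = .update (if powerApprox 2 (cost z (X j) (centers S)) = est j then none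
        else some (powerApprox 2 (cost z (X j) (centers S)))) := fun j =>
      eq_of_mem_support_pure (hms j)
    have hest : ∀ j, (ms j).getUpdate (est j) = powerApprox 2 (cost z (X j) (centers S)) := by
      intro j
      rw [hms']
      split_ifs with h
      · exact h.symm
      · rfl
    simp only [lazyAdaptiveSampling, PublicState.advance]
    refine ⟨controlInv_outerLoop hk ?_ ?_ (fun _ => hd) (Or.inl hd), ?_⟩
    · refine ⟨hA.nonempty, fun j => ?_, hA.card_le⟩
      simp only [PublicState.Dt, hest]
      exact le_powerValue (cost_nonneg _ _)
    · exact hM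
    · have h1 : ∑ j, (Msg.code (ms j)).length ≤ s * (2 * Nat.size E + 3) :=
        sum_le_mul_of_le fun j => by
          rw [hms']
          split_ifs
          · show 1 ≤ _
            omega
          · have h3 := length_optionCode_le (f := natCode)
              (o := powerApprox 2 (cost z (X j) (centers S)))
              fun e he => length_natCode_le (hE S j e hA.nonempty he)
            simp only [Msg.code, optionCode, List.length_cons] at h3 ⊢
            omega
      have h2 : s * (2 * Nat.size E + 3) ≤ roundBits s d k R E := Nat.le_add_left _ _
      rw [bitsBound_outerLoop]
      simp only [bitsBound] at hb h0 h1 ⊢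
      rw [h0, add_mul]; omega

end invariant

/-! ### Self-delimiting codes -/

/-- A code that can be decoded when it is followed by other text. -/
def UniquelyDecodable {α : Type} (f : α → List Bool) : Prop :=
  ∀ a b u v, f a ++ u = f b ++ v → a = b

lemma bits_injective {m m' : ℕ} (h : m.bits = m'.bits) : m = m' := by
  have : ∀ (m : ℕ), m.bits.foldr (fun b n => Nat.bit b n) 0 = m := by
    intro m
    induction m using Nat.binaryRec' with
    | zero => simp
    | bit b n hn ih => rw [Nat.bits_append_bit n b hn, List.foldr_cons, ih]
  rw [← this m, ← this m', h]

lemma replicate_append_cancel : ∀ {a b : ℕ} {x y : List Bool},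
    List.replicate a true ++ false :: x = List.replicate b true ++ false :: y → a = b ∧ x = y
  | 0, 0, x, y, h => by simpa using h
  | 0, b + 1, x, y, h => by simp [List.replicate_succ] at h
  | a + 1, 0, x, y, h => by simp [List.replicate_succ] at h
  | a + 1, b + 1, x, y, h => by
      simp only [List.replicate_succ, List.cons_append, List.cons.injEq, true_and] at h
      have := replicate_append_cancel h
      exact ⟨by omega, this.2⟩

/-- The unary prefix announces the length of the binary expansion, so two codes that begin a common
text have expansions of the same length. -/
lemma decodable_natCode : UniquelyDecodable natCode := by
  intro a b u v h
  simp only [natCode, List.append_assoc, List.cons_append] at h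
  obtain ⟨h1, h2⟩ := replicate_append_cancel h
  refine bits_injective (List.append_inj_left h2 ?_)
  rw [Nat.size_eq_bits_len, Nat.size_eq_bits_len, h1]

lemma decodable_optionCode {α : Type} {f : α → List Bool} (hf : UniquelyDecodable f) :
    UniquelyDecodable (optionCode f) := by
  intro a b u v h
  rcases a with _ | a <;> rcases b with _ | b
  · rfl
  · simp [optionCode] at h
  · simp [optionCode] at h
  · simp only [optionCode, List.cons_append, List.cons.injEq, true_and] at h
    rw [hf a b u v h]

/-- Lists carry no end marker. They can be parsed because the number of entries is known in advance;
hence the hypothesis of equal lengths. -/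
lemma flatMap_decode {α : Type} {f : α → List Bool} (hf : UniquelyDecodable f) :
    ∀ (l l' : List α) (u v : List Bool), l.length = l'.length →
      l.flatMap f ++ u = l'.flatMap f ++ v → l = l'
  | [], [], _, _, _, _ => rfl
  | [], _ :: _, _, _, hl, _ => by simp at hl
  | _ :: _, [], _, _, hl, _ => by simp at hl
  | a :: l, b :: l', u, v, hl, h => by
      simp only [List.flatMap_cons, List.append_assoc] at h
      have hab := hf _ _ _ _ h
      subst hab
      rw [flatMap_decode hf l l' u v (by simpa using hl) (List.append_cancel_left h)]

lemma decodable_pointCode {d Δ : ℕ} : UniquelyDecodable (pointCode (d := d) (Δ := Δ)) := by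
  intro p q u v h
  have key : ∀ (l : List (Fin d)) (u v : List Bool),
      (l.flatMap fun t => natCode (p t)) ++ u = (l.flatMap fun t => natCode (q t)) ++ v →
      ∀ t ∈ l, p t = q t := by
    intro l
    induction l with
    | nil => simp
    | cons a l ih =>
      intro u v h
      simp only [List.flatMap_cons, List.append_assoc] at h
      have hab := decodable_natCode _ _ _ _ h
      rw [hab] at h
      exact List.forall_mem_cons.2 ⟨Fin.ext hab, ih u v (List.append_cancel_left h)⟩
  funext t
  exact key _ u v h t (List.mem_finRange t)

lemma decodable_finCode {s : ℕ} : UniquelyDecodable fun j : Fin s => natCode j :=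
  fun _ _ u v h => Fin.ext (decodable_natCode _ _ u v h)

lemma UniquelyDecodable.eq_of_prefix {α : Type} {f : α → List Bool} (hf : UniquelyDecodable f) {a b : α}
    (h : f a <+: f b) : a = b := by
  obtain ⟨v, hv⟩ := h
  exact hf a b v [] (by simpa using hv)

lemma flatMap_prefix {α : Type} {f : α → List Bool} (hf : UniquelyDecodable f) {l l' : List α}
    (hl : l.length = l'.length) (h : l.flatMap f <+: l'.flatMap f) : l = l' := by
  obtain ⟨v, hv⟩ := h
  exact flatMap_decode hf l l' v [] hl (by simpa using hv)

variable {s d Δ : ℕ} [NeZero s] {z : ℝ} {k N R : ℕ}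

/-- The blackboard determines the kind of each message and the length of each list: `1`, `2 ^ i`,
`R`, or the number of requests to a site. A silent participant has no alternative message, so the
empty code is harmless. -/
lemma selfDelimiting_lazyAdaptiveSampling :
    (lazyAdaptiveSampling s d Δ z k N R).SelfDelimiting := by
  have hreq : ∀ l l' : List (Fin s), l.length = l'.length →
      (Msg.request l : Msg s d Δ).code <+: (Msg.request l' : Msg s d Δ).code →
      (Msg.request l : Msg s d Δ) = .request l' := by
    intro l l' hl h
    rw [code_request, code_request] at h
    rw [flatMap_prefix decodable_finCode hl h]
  have hsam : ∀ l l' : List (Option (GridPoint d Δ)), l.length = l'.length →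
      (Msg.samples l : Msg s d Δ).code <+: (Msg.samples l' : Msg s d Δ).code →
      (Msg.samples l : Msg s d Δ) = .samples l' := by
    intro l l' hl h
    rw [flatMap_prefix (decodable_optionCode decodable_pointCode) hl h]
  constructor
  · rintro ⟨phase, S, est, M, i⟩ m hm m' hm' h
    have hsilent : m ∈ (PMF.pure (Msg.silent : Msg s d Δ)).support →
        m' ∈ (PMF.pure (Msg.silent : Msg s d Δ)).support → m = m' := fun h1 h2 =>
      (eq_of_mem_support_pure h1).trans (eq_of_mem_support_pure h2).symm
    cases phase with
    | chooseFirst size =>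
      simp only [lazyAdaptiveSampling] at hm hm' h
      rw [PMF.support_map] at hm hm'
      obtain ⟨j, -, rfl⟩ := hm
      obtain ⟨j', -, rfl⟩ := hm'
      exact hreq _ _ rfl h
    | lazyRequest =>
      simp only [lazyAdaptiveSampling] at hm hm' h
      rw [PMF.support_map] at hm hm'
      obtain ⟨l, hl, rfl⟩ := hm
      obtain ⟨l', hl', rfl⟩ := hm'
      exact hreq _ _ ((mem_support_iidList hl).1.trans (mem_support_iidList hl').1.symm) h
    | l1Request =>
      simp only [lazyAdaptiveSampling] at hm hm' h
      rw [PMF.support_map] at hm hm'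
      obtain ⟨l, hl, rfl⟩ := hm
      obtain ⟨l', hl', rfl⟩ := hm'
      exact hreq _ _ ((mem_support_iidList hl).1.trans (mem_support_iidList hl').1.symm) h
    | _ => exact hsilent hm hm'
  · rintro ⟨phase, S, est, M, i⟩ j x y m hm m' hm' h
    have hsilent : m ∈ (PMF.pure (Msg.silent : Msg s d Δ)).support →
        m' ∈ (PMF.pure (Msg.silent : Msg s d Δ)).support → m = m' := fun h1 h2 =>
      (eq_of_mem_support_pure h1).trans (eq_of_mem_support_pure h2).symm
    have hexp : ∀ r r', (Msg.exponent r : Msg s d Δ).code <+: (Msg.exponent r' : Msg s d Δ).code →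
        (Msg.exponent r : Msg s d Δ) = .exponent r' := fun r r' h => by
      rw [(decodable_optionCode decodable_natCode).eq_of_prefix h]
    cases phase with
    | sizes =>
      simp only [lazyAdaptiveSampling] at hm hm' h
      have h1 := eq_of_mem_support_pure hm
      have h2 := eq_of_mem_support_pure hm'
      subst h1 h2
      exact congrArg _ (decodable_natCode.eq_of_prefix h)
    | first j' =>
      simp only [lazyAdaptiveSampling] at hm hm' h
      split_ifs at hm hm'
      · rw [PMF.support_map] at hm hm'
        obtain ⟨o, -, rfl⟩ := hm
        obtain ⟨o', -, rfl⟩ := hm'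
        exact hsam _ _ rfl h
      · exact hsilent hm hm'
    | report =>
      simp only [lazyAdaptiveSampling] at hm hm' h
      have h1 := eq_of_mem_support_pure hm
      have h2 := eq_of_mem_support_pure hm'
      subst h1 h2
      exact hexp _ _ h
    | lazyReply l =>
      simp only [lazyAdaptiveSampling] at hm hm' h
      rw [PMF.support_map] at hm hm'
      obtain ⟨a, ha, rfl⟩ := hm
      obtain ⟨a', ha', rfl⟩ := hm'
      exact hsam _ _ ((mem_support_iidList ha).1.trans (mem_support_iidList ha').1.symm) h
    | l1Reply l =>
      simp only [lazyAdaptiveSampling] at hm hm' h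
      split_ifs at hm hm'
      · have h1 := eq_of_mem_support_pure hm
        have h2 := eq_of_mem_support_pure hm'
        subst h1 h2
        exact hexp _ _ h
      · exact hsilent hm hm'
    | refresh =>
      simp only [lazyAdaptiveSampling] at hm hm' h
      have h1 := eq_of_mem_support_pure hm
      have h2 := eq_of_mem_support_pure hm'
      subst h1 h2
      exact congrArg _ ((decodable_optionCode (decodable_optionCode
        decodable_natCode)).eq_of_prefix h)
    | _ => exact hsilent hm hm'

/-! ### Potential functions -/

section potential
variable {s d Δ : ℕ} [NeZero s]

open Classical in
/-- The public state after a batch of LazySampling with the answers `ms`. -/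
def afterBatch (S : Finset (GridPoint d Δ)) (est : Fin s → Option ℕ) (M i : ℕ)
    (ms : Fin s → Msg s d Δ) : PublicState s d Δ where
  phase := .l1Request
  S := S ∪ Finset.univ.biUnion fun j => (ms j).getPoints.toFinset
  est := est
  M := M + ∑ j, (ms j).getPoints.length
  i := i

open Classical in
/-- The exponents that are written in L1Sampling. -/
def l1Exponents (z : ℝ) (X : Fin s → Multiset (GridPoint d Δ)) (S : Finset (GridPoint d Δ))
    (l : List (Fin s)) (j : Fin s) : Option ℕ :=
  if j ∈ l then powerApprox 2 (cost z (X j) (centers S)) else none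

open Classical in
/-- The public state after L1Sampling with the requests `l`. -/
def afterL1 (z : ℝ) (X : Fin s → Multiset (GridPoint d Δ)) (k N : ℕ) (S : Finset (GridPoint d Δ))
    (est : Fin s → Option ℕ) (M i : ℕ) (l : List (Fin s)) : PublicState s d Δ :=
  if l1Test (fun j => powerValue 2 (est j)) l (l1Exponents z X S l) then ⟨.refresh, S, est, M, i⟩
  else if 2 ^ (i + 1) ≤ k then ⟨.lazyRequest, S, est, M, i + 1⟩
  else PublicState.outerLoop N ⟨.l1Request, S, est, M, i⟩

/-- The public state after an update of the exponents. -/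
def afterRefresh (z : ℝ) (X : Fin s → Multiset (GridPoint d Δ)) (N : ℕ)
    (S : Finset (GridPoint d Δ)) (M i : ℕ) : PublicState s d Δ :=
  PublicState.outerLoop N
    ⟨.refresh, S, fun j => powerApprox 2 (cost z (X j) (centers S)), M, i⟩

variable (z : ℝ) (X : Fin s → Multiset (GridPoint d Δ)) (k N R : ℕ)

/-- The extension of a potential function to the states in the middle of LazySampling and
L1Sampling. -/
def extend (φ : PublicState s d Δ → ℕ → ℝ≥0∞)
    (c : (lazyAdaptiveSampling s d Δ z k N R).Config) : ℝ≥0∞ :=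
  match c.state.phase with
  | .lazyReply _ =>
    ex ((lazyAdaptiveSampling s d Δ z k N R).round X c) fun c' => φ c'.state c'.rounds
  | .l1Reply _ =>
    ex ((lazyAdaptiveSampling s d Δ z k N R).round X c) fun c' => φ c'.state c'.rounds
  | _ => φ c.state c.rounds

variable {z X k N R} (φ : PublicState s d Δ → ℕ → ℝ≥0∞)

/-- `f` is kept general because both `extend z X k N R φ` and `φ` itself are needed; they agree on
the states after a batch. -/
lemma ex_round_lazyReply (l : List (Fin s)) (S : Finset (GridPoint d Δ)) (est : Fin s → Option ℕ)
    (M i bits rounds : ℕ) (f : (lazyAdaptiveSampling s d Δ z k N R).Config → ℝ≥0∞)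
    (hf : ∀ ms b, f ⟨afterBatch S est M i ms, b, rounds + 1⟩ =
      φ (afterBatch S est M i ms) (rounds + 1)) :
    ex ((lazyAdaptiveSampling s d Δ z k N R).round X ⟨⟨.lazyReply l, S, est, M, i⟩, bits, rounds⟩)
      f = ex (lazyReplies z X S (fun j => powerValue 2 (est j)) l) fun ms =>
        φ (afterBatch S est M i ms) (rounds + 1) := by
  rw [BlackboardProtocol.ex_round _ _ rfl]
  refine (ex_pure _ _).trans ?_
  exact ex_congr _ fun ms _ => hf ms _

/-- By the definition of `extend` on reply states, one round of requests already accounts for the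
replies: a whole batch appears as one step of two rounds. -/
lemma ex_round_lazyRequest (S : Finset (GridPoint d Δ)) (est : Fin s → Option ℕ)
    (M i bits rounds : ℕ) :
    ex ((lazyAdaptiveSampling s d Δ z k N R).round X ⟨⟨.lazyRequest, S, est, M, i⟩, bits, rounds⟩)
      (extend z X k N R φ) = batchEx z X S (fun j => powerValue 2 (est j)) (2 ^ i) fun ms =>
        φ (afterBatch S est M i ms) (rounds + 2) := by
  rw [BlackboardProtocol.ex_round _ _ rfl]
  refine (ex_map _ _ _).trans ?_
  refine ex_congr _ fun l _ => ?_
  have h1 : independent s (fun j => (lazyAdaptiveSampling s d Δ z k N R).site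
      ⟨.lazyRequest, S, est, M, i⟩ j (X j)) = PMF.pure fun _ => Msg.silent := independent_pure _
  refine (congrArg (fun p => ex p _) h1).trans ((ex_pure _ _).trans ?_)
  exact ex_round_lazyReply φ l S est M i _ _ _ fun ms b => rfl

/-- Given the requests, the exponents are determined, so all the randomness of L1Sampling lies in
the list `l`. -/
lemma ex_round_l1Reply (l : List (Fin s)) (S : Finset (GridPoint d Δ)) (est : Fin s → Option ℕ)
    (M i bits rounds : ℕ) :
    ex ((lazyAdaptiveSampling s d Δ z k N R).round X ⟨⟨.l1Reply l, S, est, M, i⟩, bits, rounds⟩)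
      (fun c' => φ c'.state c'.rounds) = φ (afterL1 z X k N S est M i l) (rounds + 1) := by
  classical
  rw [BlackboardProtocol.ex_round _ _ rfl]
  refine (ex_pure _ _).trans ?_
  have h1 : (fun j => (lazyAdaptiveSampling s d Δ z k N R).site
      ⟨.l1Reply l, S, est, M, i⟩ j (X j)) = fun j => PMF.pure (if j ∈ l then
        (Msg.exponent (powerApprox 2 (cost z (X j) (centers S))) : Msg s d Δ) else .silent) := by
    funext j
    simp only [lazyAdaptiveSampling, coe_l1Base]
    split_ifs <;> rfl
  refine (congrArg (fun p => ex p _) ((congrArg (independent s) h1).trans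
    (independent_pure _))).trans ((ex_pure _ _).trans ?_)
  have h2 : ∀ j, Msg.getExponent (if j ∈ l then
      (Msg.exponent (powerApprox 2 (cost z (X j) (centers S))) : Msg s d Δ) else .silent) =
      l1Exponents z X S l j := by
    intro j; unfold l1Exponents; split_ifs <;> rfl
  have h3 : (lazyAdaptiveSampling s d Δ z k N R).next ⟨.l1Reply l, S, est, M, i⟩ .silent
      (fun j => if j ∈ l then (Msg.exponent (powerApprox 2 (cost z (X j) (centers S))) : Msg s d Δ)
        else .silent) = afterL1 z X k N S est M i l := by
    simp only [lazyAdaptiveSampling, PublicState.advance, afterL1, h2]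
    rfl
  exact congrArg (fun q => φ q (rounds + 1)) h3

lemma ex_round_l1Request (S : Finset (GridPoint d Δ)) (est : Fin s → Option ℕ)
    (M i bits rounds : ℕ) :
    ex ((lazyAdaptiveSampling s d Δ z k N R).round X ⟨⟨.l1Request, S, est, M, i⟩, bits, rounds⟩)
      (extend z X k N R φ) = ex (iidList (drawSite fun j => powerValue 2 (est j)) R) fun l =>
        φ (afterL1 z X k N S est M i l) (rounds + 2) := by
  rw [BlackboardProtocol.ex_round _ _ rfl]
  refine (ex_map _ _ _).trans ?_
  refine ex_congr _ fun l _ => ?_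
  have h1 : independent s (fun j => (lazyAdaptiveSampling s d Δ z k N R).site
      ⟨.l1Request, S, est, M, i⟩ j (X j)) = PMF.pure fun _ => Msg.silent := independent_pure _
  refine (congrArg (fun p => ex p _) h1).trans ((ex_pure _ _).trans ?_)
  exact ex_round_l1Reply φ l S est M i _ _

lemma ex_round_refresh (S : Finset (GridPoint d Δ)) (est : Fin s → Option ℕ)
    (M i bits rounds : ℕ) :
    ex ((lazyAdaptiveSampling s d Δ z k N R).round X ⟨⟨.refresh, S, est, M, i⟩, bits, rounds⟩)
      (extend z X k N R φ) = φ (afterRefresh z X N S M i) (rounds + 1) := by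
  classical
  rw [BlackboardProtocol.ex_round _ _ rfl]
  refine (ex_pure _ _).trans ?_
  set ms : Fin s → Msg s d Δ := fun j => .update (if powerApprox 2 (cost z (X j) (centers S)) =
    est j then none else some (powerApprox 2 (cost z (X j) (centers S))))
  have h1 : independent s (fun j => (lazyAdaptiveSampling s d Δ z k N R).site
      ⟨.refresh, S, est, M, i⟩ j (X j)) = PMF.pure ms := by
    refine Eq.trans ?_ (independent_pure ms)
    congr 1
  refine (congrArg (fun p => ex p _) h1).trans ((ex_pure _ _).trans ?_)
  have h2 : (lazyAdaptiveSampling s d Δ z k N R).next ⟨.refresh, S, est, M, i⟩ .silent ms =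
      afterRefresh z X N S M i := by
    have h3 : (fun j => (ms j).getUpdate (est j)) =
        fun j => powerApprox 2 (cost z (X j) (centers S)) := by
      funext j
      simp only [ms]
      split_ifs with h
      · exact h.symm
      · rfl
    unfold afterRefresh
    rw [← h3]
    rfl
  have h4 : ∀ b, extend z X k N R φ ⟨afterRefresh z X N S M i, b, rounds + 1⟩ =
      φ (afterRefresh z X N S M i) (rounds + 1) := by
    intro b
    unfold extend afterRefresh PublicState.outerLoop
    split_ifs <;> rfl
  rw [h2]
  exact h4 _

lemma ex_round_report (S : Finset (GridPoint d Δ)) (est : Fin s → Option ℕ)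
    (M i bits rounds : ℕ) :
    ex ((lazyAdaptiveSampling s d Δ z k N R).round X ⟨⟨.report, S, est, M, i⟩, bits, rounds⟩)
      (extend z X k N R φ) = φ (afterRefresh z X N S M i) (rounds + 1) := by
  rw [BlackboardProtocol.ex_round _ _ rfl]
  refine (ex_pure _ _).trans ?_
  have h1 : independent s (fun j => (lazyAdaptiveSampling s d Δ z k N R).site
      ⟨.report, S, est, M, i⟩ j (X j)) =
      PMF.pure fun j => .exponent (powerApprox 2 (cost z (X j) (centers S))) := independent_pure _
  refine (congrArg (fun p => ex p _) h1).trans ((ex_pure _ _).trans ?_)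
  show extend z X k N R φ ⟨afterRefresh z X N S M i, _, rounds + 1⟩ = _
  unfold extend afterRefresh PublicState.outerLoop
  split_ifs <;> rfl

/-- A function on the public states is a supermartingale if it satisfies inequalities for the
batches of LazySampling, for L1Sampling, and for the updates. -/
lemma ex_round_extend_le (I : (lazyAdaptiveSampling s d Δ z k N R).Config → Prop)
    (hI : ∀ c, I c → ControlInv z X k N R c.state c.rounds) (b : ℕ → ℝ≥0∞)
    (hb : ∀ r, b (r + 1) ≤ b r)
    (hsizes : ∀ S est M i r, φ ⟨.sizes, S, est, M, i⟩ r = b r)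
    (hchoose : ∀ size S est M i r, φ ⟨.chooseFirst size, S, est, M, i⟩ r = b r)
    (hfirst : ∀ j S est M i r, φ ⟨.first j, S, est, M, i⟩ r = b r)
    (hreport : ∀ S est M i r, φ ⟨.report, S, est, M, i⟩ r = b r)
    -- The report is always the fourth round, and no point has been counted in `M` before it.
    (hsetup : ∀ S i, S.Nonempty → φ (afterRefresh z X N S 0 i) 4 ≤ b 3)
    (hbatch : ∀ S est M i r,
      PublicState.Active z X k (⟨.lazyRequest, S, est, M, i⟩ : PublicState s d Δ) →
      M ≤ N + 2 ^ i →
      batchEx z X S (fun j => powerValue 2 (est j)) (2 ^ i)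
        (fun ms => φ (afterBatch S est M i ms) (r + 2)) ≤ φ ⟨.lazyRequest, S, est, M, i⟩ r)
    (hl1 : ∀ S est M i r,
      PublicState.Active z X k (⟨.l1Request, S, est, M, i⟩ : PublicState s d Δ) →
      M ≤ N + 2 ^ (i + 1) →
      ex (iidList (drawSite fun j => powerValue 2 (est j)) R)
        (fun l => φ (afterL1 z X k N S est M i l) (r + 2)) ≤ φ ⟨.l1Request, S, est, M, i⟩ r)
    (hrefresh : ∀ S est M i r,
      PublicState.Sound z X (⟨.refresh, S, est, M, i⟩ : PublicState s d Δ) → M ≤ N + 4 * k →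
      φ (afterRefresh z X N S M i) (r + 1) ≤ φ ⟨.refresh, S, est, M, i⟩ r)
    (c : (lazyAdaptiveSampling s d Δ z k N R).Config) (hc : I c) :
    ex ((lazyAdaptiveSampling s d Δ z k N R).round X c) (extend z X k N R φ) ≤
      extend z X k N R φ c := by
  have hinv := hI c hc
  obtain ⟨⟨phase, S, est, M, i⟩, bits, rounds⟩ := c
  cases phase with
  | done =>
    rw [BlackboardProtocol.round_of_output (o := S) _ _ rfl, ex_pure]
  | sizes =>
    refine ex_le_const _ fun c' hc' => ?_
    obtain ⟨mc, -, ms, -, rfl⟩ := BlackboardProtocol.mem_support_round _ _ rfl hc'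
    exact (hchoose _ _ _ _ _ _).le.trans ((hb _).trans (hsizes _ _ _ _ _).ge)
  | chooseFirst size =>
    refine ex_le_const _ fun c' hc' => ?_
    obtain ⟨mc, hmc, ms, -, rfl⟩ := BlackboardProtocol.mem_support_round _ _ rfl hc'
    have hmc' : mc ∈ ((drawSite fun j => ((size j : ℕ) : ℝ≥0)).map
        fun j => (Msg.request [j] : Msg s d Δ)).support := hmc
    rw [PMF.support_map] at hmc'
    obtain ⟨j, hj, rfl⟩ := hmc'
    exact (hfirst _ _ _ _ _ _).le.trans ((hb _).trans (hchoose _ _ _ _ _ _).ge)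
  | first j =>
    refine ex_le_const _ fun c' hc' => ?_
    obtain ⟨mc, -, ms, -, rfl⟩ := BlackboardProtocol.mem_support_round _ _ rfl hc'
    exact (hreport _ _ _ _ _).le.trans ((hb _).trans (hfirst _ _ _ _ _ _).ge)
  | report =>
    obtain ⟨hS, -, hM, hr⟩ := hinv
    rw [ex_round_report]
    simp only at hM hr
    subst hM hr
    exact (hsetup S i hS).trans (hreport _ _ _ _ _).ge
  | lazyRequest =>
    rw [ex_round_lazyRequest]
    exact hbatch S est M i rounds hinv.1 hinv.2
  | lazyReply l =>
    rw [ex_round_lazyReply φ l S est M i bits rounds _ fun ms b => rfl]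
    refine le_of_eq ?_
    exact (ex_round_lazyReply φ l S est M i bits rounds _ fun ms b => rfl).symm
  | l1Request =>
    rw [ex_round_l1Request]
    exact hl1 S est M i rounds hinv.1 hinv.2
  | l1Reply l =>
    -- No reply state directly follows a reply state, so `extend` does not change `φ` after this
    -- round.
    show _ ≤ ex _ _
    refine ex_mono _ fun c' hc' => ?_
    obtain ⟨mc, -, ms, -, rfl⟩ := BlackboardProtocol.mem_support_round _ _ rfl hc'
    refine le_of_eq ?_
    simp only [lazyAdaptiveSampling, PublicState.advance, PublicState.outerLoop]
    unfold extend
    split_ifs <;> rfl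
  | refresh =>
    rw [ex_round_refresh]
    exact hrefresh S est M i rounds hinv.1 hinv.2.1

end potential

/-! ### Numerical inequalities for the coverage of the clusters -/

lemma exp_neg_le_one_sub {t : ℝ} (h0 : 0 ≤ t) (h1 : t ≤ 1) : Real.exp (-t) ≤ 1 - t / 2 := by
  rw [Real.exp_neg, inv_le_comm₀ (Real.exp_pos _) (by linarith)]
  refine le_trans ?_ (Real.add_one_le_exp t)
  rw [inv_eq_one_div, div_le_iff₀ (by linarith)]
  nlinarith

lemma exp_neg_le_three_eighths {t : ℝ} (h : 1 ≤ t) : Real.exp (-t) ≤ 3 / 8 := by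
  rw [Real.exp_neg, inv_le_comm₀ (Real.exp_pos _) (by norm_num)]
  have h1 := Real.exp_one_gt_d9
  have h2 := Real.exp_le_exp.2 h
  norm_num
  linarith

/-- Here `u` is the expected number of points in an uncovered cluster and `q` bounds the probability
that it stays uncovered. With `q ≤ 1 - κ * u / 2`, the loss `72 / κ * (κ * u / 2) = 36 * u` pays for
`4 * u + 32 * u`. -/
lemma coverage_of_le_one {u q κ : ℝ} (hu : 0 ≤ u) (hκ : 0 < κ) (hq : q ≤ Real.exp (-(κ * u)))
    (h : κ * u ≤ 1) : 4 * u + (72 / κ + 32 * u) * q ≤ 72 / κ := by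
  have h1 := hq.trans (exp_neg_le_one_sub (by positivity) h)
  have h2 : (72 / κ + 32 * u) * q ≤ (72 / κ + 32 * u) * (1 - κ * u / 2) :=
    mul_le_mul_of_nonneg_left h1 (by positivity)
  have h3 : 72 / κ * (κ * u / 2) = 36 * u := by field_simp; ring
  have h4 : 0 ≤ u * (κ * u) := by positivity
  nlinarith

/-- For large `u` the bounded weight of the cluster cannot pay for all the points. The constants fit
since `exp (-1) ≤ 3 / 8` and `4 + 32 * 3 / 8 = 16`; the remaining `16 * u` is covered by the credit.
-/
lemma coverage_le {u q κ : ℝ} (hu : 0 ≤ u) (hκ : 0 < κ) (hq : q ≤ Real.exp (-(κ * u))) :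
    4 * u + (72 / κ + 32 * u) * q ≤ 72 / κ + 16 * u := by
  rcases le_total (κ * u) 1 with h | h
  · have := coverage_of_le_one hu hκ hq h; linarith
  · have h1 := hq.trans (exp_neg_le_three_eighths h)
    have h2 : (72 / κ + 32 * u) * q ≤ (72 / κ + 32 * u) * (3 / 8) :=
      mul_le_mul_of_nonneg_left h1 (by positivity)
    have h3 : 0 ≤ 72 / κ := by positivity
    linarith

lemma one_sub_pow_le_exp {p : ℝ} (h : p ≤ 1) (m : ℕ) : (1 - p) ^ m ≤ Real.exp (-(m * p)) := by
  have h1 := pow_le_pow_left₀ (by linarith) (Real.one_sub_le_exp_neg p) m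
  rwa [← Real.exp_nat_mul, mul_neg] at h1

/-! ### The answers of a batch -/

section answers
variable {s d Δ : ℕ}

lemma length_getPoints (m : Msg s d Δ) : ((m.getPoints).length : ℝ≥0∞) =
    (m.answers.map fun o => if ∃ y ∈ (Finset.univ : Finset (GridPoint d Δ)), o = some y then
      (1 : ℝ≥0∞) else 0).sum := by
  cases m with
  | samples l =>
    simp only [Msg.getPoints, Msg.answers]
    induction l with
    | nil => simp
    | cons o l ih =>
      rcases o with _ | y
      · simpa using ih
      · simp only [List.reduceOption_cons_of_some, List.length_cons, List.map_cons, List.sum_cons,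
          ← ih]
        simp [add_comm]
  | _ => simp [Msg.getPoints, Msg.answers]

lemma mem_getPoints_iff (m : Msg s d Δ) (y : GridPoint d Δ) :
    y ∈ m.getPoints ↔ some y ∈ m.answers := by
  cases m <;> simp [Msg.getPoints, Msg.answers, List.reduceOption_mem_iff]

open Classical in
/-- The indicator function of the event that no answer is a point of `A`. -/
def missed (A : Finset (GridPoint d Δ)) (ms : Fin s → Msg s d Δ) : ℝ≥0∞ :=
  ∏ j, ((ms j).answers.map fun o => if ∃ y ∈ A, o = some y then (0 : ℝ≥0∞) else 1).prod

lemma missed_eq_one {A : Finset (GridPoint d Δ)} {ms : Fin s → Msg s d Δ}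
    (h : ∀ j, ∀ y ∈ (ms j).getPoints, y ∉ A) : missed A ms = 1 := by
  refine Finset.prod_eq_one fun j _ => List.prod_eq_one ?_
  intro v hv
  obtain ⟨o, ho, rfl⟩ := List.mem_map.1 hv
  rw [if_neg]
  rintro ⟨y, hy, rfl⟩
  exact h j y ((mem_getPoints_iff _ _).2 ho) hy

variable [NeZero s] {z : ℝ} {X : Fin s → Multiset (GridPoint d Δ)} {S : Finset (GridPoint d Δ)}
  {Dt : Fin s → ℝ≥0}

lemma batchEx_missed (hD : ∀ j, cost z (X j) (centers S) ≤ Dt j) (hDt : ∑ j, Dt j ≠ 0)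
    (A : Finset (GridPoint d Δ)) (m : ℕ) : batchEx z X S Dt m (missed A) =
      ENNReal.ofReal ((1 - partCost z (∑ j, X j) S A / ∑ j, (Dt j : ℝ)) ^ m) := by
  classical
  unfold missed
  rw [batchEx_prod, requestEx_not_mem hD hDt, ENNReal.ofReal_pow]
  have hpos : 0 < ∑ j, (Dt j : ℝ) := by
    have : 0 < ∑ j, Dt j := pos_iff_ne_zero.2 hDt
    exact_mod_cast this
  rw [sub_nonneg, div_le_one hpos]
  exact (partCost_le_cost _ _).trans (cost_sum_le hD)

lemma batchEx_points (hD : ∀ j, cost z (X j) (centers S) ≤ Dt j) (hDt : ∑ j, Dt j ≠ 0) (m : ℕ) :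
    batchEx z X S Dt m (fun ms => ((∑ j, (ms j).getPoints.length : ℕ) : ℝ≥0∞)) =
      ENNReal.ofReal (m * (cost z (∑ j, X j) (centers S) / ∑ j, (Dt j : ℝ))) := by
  classical
  simp only [Nat.cast_sum, length_getPoints]
  rw [batchEx_sum, requestEx_mem hD hDt, partCost_univ, ENNReal.ofReal_mul (Nat.cast_nonneg _),
    ENNReal.ofReal_natCast]

lemma batchEx_add (m : ℕ) (f g : (Fin s → Msg s d Δ) → ℝ≥0∞) :
    batchEx z X S Dt m (fun ms => f ms + g ms) = batchEx z X S Dt m f + batchEx z X S Dt m g := by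
  simp only [batchEx, ex_add]

lemma batchEx_const (m : ℕ) (c : ℝ≥0∞) : batchEx z X S Dt m (fun _ => c) = c := by
  simp only [batchEx, ex_const]

lemma batchEx_mul_left (m : ℕ) (c : ℝ≥0∞) (f : (Fin s → Msg s d Δ) → ℝ≥0∞) :
    batchEx z X S Dt m (fun ms => c * f ms) = c * batchEx z X S Dt m f := by
  simp only [batchEx, ex_mul_left]

lemma batchEx_sum_finset {ι : Type*} (m : ℕ) (T : Finset ι)
    (f : ι → (Fin s → Msg s d Δ) → ℝ≥0∞) :
    batchEx z X S Dt m (fun ms => ∑ c ∈ T, f c ms) = ∑ c ∈ T, batchEx z X S Dt m (f c) := by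
  simp only [batchEx, ex_sum]

lemma batchEx_mono (m : ℕ) {f g : (Fin s → Msg s d Δ) → ℝ≥0∞} (h : ∀ ms, f ms ≤ g ms) :
    batchEx z X S Dt m f ≤ batchEx z X S Dt m g :=
  ex_mono _ fun _ _ => ex_mono _ fun ms _ => h ms

end answers

/-! ### The potential function for the cost -/

section costPotential
variable {s d Δ : ℕ} {z : ℝ} {k : ℕ} {Y : Multiset (GridPoint d Δ)} (Cl : Clusters z k Y)

open Classical in
/-- The clusters that are not covered by `S`. -/
def Clusters.uncovered (S : Finset (GridPoint d Δ)) : Finset (GridPoint d Δ) :=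
  Cl.K.filter fun c => coverFactor z * Cl.o c < partCost z Y S (Cl.A c)

/-- The total cost of the clusters. -/
def Clusters.total : ℝ := ∑ c ∈ Cl.K, Cl.o c

/-- The approximation factor with respect to the total cost of the clusters. -/
def approxFactor (z : ℝ) : ℝ := 32 * coverFactor z

/-- The weight of an uncovered cluster in the potential function. -/
def clusterWeight (z : ℝ) : ℝ := 72 / goodShare z

/-- The sum of the estimates. -/
def estSum (est : Fin s → Option ℕ) : ℝ := ∑ j, (powerValue 2 (est j) : ℝ)

open Classical in
/-- The potential function for the cost: the number of sampled points, plus a constant for each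
uncovered cluster, plus the credit for the next batch. -/
def costPotential (q : PublicState s d Δ) : ℝ≥0∞ :=
  match q.phase with
  | .sizes | .chooseFirst _ | .first _ | .report => ENNReal.ofReal (clusterWeight z * k)
  | phase =>
    -- A small cost stays small because `S` only grows, so setting the potential to zero is
    -- consistent.
    if cost z Y (centers q.S) ≤ approxFactor z * Cl.total then 0
    else ENNReal.ofReal (q.M + clusterWeight z * (Cl.uncovered q.S).card + match phase with
      | .lazyRequest =>
        -- As `16 * 2 ^ i = 32 * 2 ^ (i - 1)`, this is exactly the credit left by the preceding
        -- batch of the sequence; a first batch needs none.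
        if 2 ≤ q.i then 16 * (2 ^ q.i * (cost z Y (centers q.S) / estSum q.est)) else 0
      | .l1Request => 32 * (2 ^ q.i * (cost z Y (centers q.S) / estSum q.est))
      | _ => 0)

lemma coverFactor_pos : 0 < coverFactor z := by unfold coverFactor; positivity

lemma goodShare_pos : 0 < goodShare z := by unfold goodShare; positivity

lemma goodShare_le (hz : 1 ≤ z) : goodShare z ≤ 1 / 8 := by
  have hH1 : (1 : ℝ) ≤ 2 ^ (z - 1) := Real.one_le_rpow (by norm_num) (by linarith)
  unfold goodShare
  refine one_div_le_one_div_of_le (by norm_num) ?_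
  nlinarith

lemma clusterWeight_pos : 0 < clusterWeight z := div_pos (by norm_num) goodShare_pos

lemma Clusters.total_nonneg : 0 ≤ Cl.total := Finset.sum_nonneg fun c _ => Cl.o_nonneg c

lemma Clusters.card_uncovered_le (S : Finset (GridPoint d Δ)) : (Cl.uncovered S).card ≤ k :=
  (Finset.card_filter_le _ _).trans Cl.card_le

lemma partCost_anti (hz : 0 ≤ z) {S S' : Finset (GridPoint d Δ)} (hS : S.Nonempty) (h : S ⊆ S')
    (A : Finset (GridPoint d Δ)) : partCost z Y S' A ≤ partCost z Y S A :=
  Finset.sum_le_sum fun y _ =>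
    mul_le_mul_of_nonneg_left (pointCost_anti hz hS h y) (Nat.cast_nonneg _)

lemma Clusters.cost_le (S : Finset (GridPoint d Δ)) :
    cost z Y (centers S) ≤ coverFactor z * Cl.total +
      ∑ c ∈ Cl.uncovered S, partCost z Y S (Cl.A c) := by
  classical
  rw [← Cl.sum_partCost, Clusters.total, Finset.mul_sum, Clusters.uncovered, Finset.sum_filter,
    ← Finset.sum_add_distrib]
  refine Finset.sum_le_sum fun c _ => ?_
  have h := mul_nonneg (coverFactor_pos (z := z)).le (Cl.o_nonneg c)
  split_ifs with hc
  · linarith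
  · push Not at hc; linarith

lemma Clusters.sum_uncovered_le (S : Finset (GridPoint d Δ)) :
    ∑ c ∈ Cl.uncovered S, partCost z Y S (Cl.A c) ≤ cost z Y (centers S) := by
  rw [← Cl.sum_partCost]
  exact Finset.sum_le_sum_of_subset_of_nonneg (Finset.filter_subset _ _)
    fun c _ _ => partCost_nonneg _ _

lemma Clusters.mem_uncovered_of_subset (hz : 1 ≤ z) {S S' : Finset (GridPoint d Δ)}
    (hS : S.Nonempty) (h : S ⊆ S') {c : GridPoint d Δ} (hc : c ∈ Cl.uncovered S') :
    c ∈ Cl.uncovered S ∧ ∀ y ∈ S', y ∉ Cl.G c := by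
  classical
  obtain ⟨hcK, hlt⟩ := Finset.mem_filter.1 hc
  refine ⟨Finset.mem_filter.2 ⟨hcK, hlt.trans_le (partCost_anti (by linarith) hS h _)⟩, ?_⟩
  intro y hy hyG
  exact absurd (Cl.covered S' c y hy hyG) (not_le.2 hlt)

lemma costPotential_loop_le {N : ℕ} (q : PublicState s d Δ) :
    costPotential Cl (q.outerLoop N) ≤
      if cost z Y (centers q.S) ≤ approxFactor z * Cl.total then 0
      else ENNReal.ofReal (q.M + clusterWeight z * (Cl.uncovered q.S).card) := by
  unfold PublicState.outerLoop
  split_ifs with h1 h2 h2 <;> simp [costPotential, h2]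

lemma estSum_pos {est : Fin s → Option ℕ} (h : ∃ j, est j ≠ none) : 0 < estSum est := by
  obtain ⟨j, hj⟩ := h
  refine Finset.sum_pos' (fun j _ => NNReal.coe_nonneg _) ⟨j, Finset.mem_univ j, ?_⟩
  have := one_le_powerValue hj
  have h1 : (1 : ℝ) ≤ powerValue 2 (est j) := by exact_mod_cast this
  linarith

lemma sum_powerValue_ne_zero {est : Fin s → Option ℕ} (h : ∃ j, est j ≠ none) :
    ∑ j, powerValue 2 (est j) ≠ 0 := by
  have := estSum_pos h
  unfold estSum at this
  intro h0
  rw [← NNReal.coe_sum, h0] at this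
  simp at this

lemma costPotential_afterBatch (S : Finset (GridPoint d Δ)) (est : Fin s → Option ℕ) (M i : ℕ)
    (ms : Fin s → Msg s d Δ) : costPotential Cl (afterBatch S est M i ms) =
      if cost z Y (centers (afterBatch S est M i ms).S) ≤ approxFactor z * Cl.total then 0
      else ENNReal.ofReal ((M + ∑ j, (ms j).getPoints.length : ℕ) +
        clusterWeight z * (Cl.uncovered (afterBatch S est M i ms).S).card +
        32 * (2 ^ i * (cost z Y (centers (afterBatch S est M i ms).S) / estSum est))) := rfl

variable [NeZero s] {X : Fin s → Multiset (GridPoint d Δ)}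

open Classical in
-- After the batch the potential is bounded by a sum over the clusters uncovered before it, each
-- term multiplied by the indicator that its good points were missed. Taking expectations leaves a
-- numerical inequality for each cluster.
lemma costPotential_batch (hz : 1 ≤ z) (hY : ∑ j, X j = Y) (S : Finset (GridPoint d Δ))
    (est : Fin s → Option ℕ) (M i : ℕ)
    (hA : PublicState.Active z X k (⟨.lazyRequest, S, est, M, i⟩ : PublicState s d Δ)) :
    batchEx z X S (fun j => powerValue 2 (est j)) (2 ^ i)
      (fun ms => costPotential Cl (afterBatch S est M i ms)) ≤
        costPotential Cl (⟨.lazyRequest, S, est, M, i⟩ : PublicState s d Δ) := by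
  have hS : S.Nonempty := hA.nonempty
  have hDt := sum_powerValue_ne_zero hA.est_ne
  have hpos := estSum_pos hA.est_ne
  have hcl : ∀ j, cost z (X j) (centers S) ≤ powerValue 2 (est j) := hA.cost_le
  set D := cost z Y (centers S) with hDdef
  have hDle : D ≤ estSum est := by
    rw [hDdef, ← hY]; exact cost_sum_le hcl
  have hsub : ∀ ms : Fin s → Msg s d Δ, S ⊆ (afterBatch S est M i ms).S :=
    fun ms => Finset.subset_union_left
  by_cases hsmall : D ≤ approxFactor z * Cl.total
  · have h1 : ∀ ms : Fin s → Msg s d Δ, costPotential Cl (afterBatch S est M i ms) = 0 := by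
      intro ms
      have h2 : cost z Y (centers (afterBatch S est M i ms).S) ≤ approxFactor z * Cl.total :=
        (cost_anti (by linarith) hS (hsub ms) _).trans hsmall
      rw [costPotential_afterBatch, if_pos h2]
    simp only [h1, batchEx_const]
    exact zero_le
  set E := estSum est with hE
  set T := Cl.uncovered S with hT
  set m : ℝ := 2 ^ i with hm
  have hm0 : 0 < m := by positivity
  set pc : GridPoint d Δ → ℝ := fun c => partCost z Y S (Cl.A c) with hpc
  have hpc0 : ∀ c, 0 ≤ pc c := fun c => partCost_nonneg _ _
  set u : GridPoint d Δ → ℝ := fun c => m * (pc c / E) with hu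
  have hu0 : ∀ c, 0 ≤ u c := fun c => mul_nonneg hm0.le (div_nonneg (hpc0 c) hpos.le)
  set v : ℝ := m * (D / E) with hv
  have hD0 : 0 ≤ D := cost_nonneg _ _
  have hv0 : 0 ≤ v := mul_nonneg hm0.le (div_nonneg hD0 hpos.le)
  have hW := clusterWeight_pos (z := z)
  -- the pointwise bound
  have hpoint : ∀ ms : Fin s → Msg s d Δ, costPotential Cl (afterBatch S est M i ms) ≤
      ENNReal.ofReal (M + v) + (((∑ j, (ms j).getPoints.length : ℕ) : ℝ≥0∞) +
        ∑ c ∈ T, ENNReal.ofReal (clusterWeight z + 32 * u c) * missed (Cl.G c) ms) := by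
    intro ms
    set S' := (afterBatch S est M i ms).S with hS'
    set pts := ∑ j, (ms j).getPoints.length with hpts
    have hTsub : Cl.uncovered S' ⊆ T := fun c hc =>
      (Cl.mem_uncovered_of_subset hz hS (hsub ms) hc).1
    have hmiss : ∀ c ∈ Cl.uncovered S', missed (Cl.G c) ms = 1 := by
      intro c hc
      refine missed_eq_one fun j y hy => (Cl.mem_uncovered_of_subset hz hS (hsub ms) hc).2 y ?_
      exact Finset.mem_union_right _ (Finset.mem_biUnion.2
        ⟨j, Finset.mem_univ j, List.mem_toFinset.2 hy⟩)
    -- As the cost was still large, `coverFactor z * Cl.total` is less than `D / 32`; only the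
    -- clusters that remain uncovered contribute more.
    have hcost : cost z Y (centers S') ≤ D / 32 + ∑ c ∈ Cl.uncovered S', pc c := by
      refine (Cl.cost_le S').trans (add_le_add ?_ (Finset.sum_le_sum fun c _ =>
        partCost_anti (by linarith) hS (hsub ms) _))
      push Not at hsmall
      unfold approxFactor at hsmall
      linarith
    have hval : (M + pts : ℝ) + clusterWeight z * (Cl.uncovered S').card +
        32 * (m * (cost z Y (centers S') / E)) ≤
        (M + v) + (pts + ∑ c ∈ Cl.uncovered S', (clusterWeight z + 32 * u c)) := by
      have h1 : m * (cost z Y (centers S') / E) ≤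
          m * ((D / 32 + ∑ c ∈ Cl.uncovered S', pc c) / E) := by gcongr
      have h2 : m * ((D / 32 + ∑ c ∈ Cl.uncovered S', pc c) / E) =
          v / 32 + ∑ c ∈ Cl.uncovered S', u c := by
        simp only [hu, hv]
        rw [← Finset.mul_sum, ← Finset.sum_div]; ring
      rw [Finset.sum_add_distrib, ← Finset.mul_sum, Finset.sum_const, nsmul_eq_mul]
      linarith
    calc costPotential Cl (afterBatch S est M i ms)
        ≤ ENNReal.ofReal ((M + pts : ℝ) + clusterWeight z * (Cl.uncovered S').card +
            32 * (m * (cost z Y (centers S') / E))) := by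
          rw [costPotential_afterBatch]
          split_ifs
          · exact zero_le
          · rw [← hpts, ← hS', ← hm, Nat.cast_add]
      _ ≤ ENNReal.ofReal ((M + v) +
            (pts + ∑ c ∈ Cl.uncovered S', (clusterWeight z + 32 * u c))) :=
          ENNReal.ofReal_le_ofReal hval
      _ = ENNReal.ofReal (M + v) + ((pts : ℝ≥0∞) +
            ∑ c ∈ Cl.uncovered S', ENNReal.ofReal (clusterWeight z + 32 * u c)) := by
          have hnn : ∀ c, 0 ≤ clusterWeight z + 32 * u c := fun c => by linarith [hu0 c]
          rw [ENNReal.ofReal_add (by positivity) (add_nonneg (Nat.cast_nonneg _)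
            (Finset.sum_nonneg fun c _ => hnn c)), ENNReal.ofReal_add (Nat.cast_nonneg _)
            (Finset.sum_nonneg fun c _ => hnn c), ENNReal.ofReal_natCast,
            ENNReal.ofReal_sum_of_nonneg fun c _ => hnn c]
      _ ≤ _ := by
          gcongr
          refine le_trans (Finset.sum_le_sum (g := fun c =>
            ENNReal.ofReal (clusterWeight z + 32 * u c) * missed (Cl.G c) ms) fun c hc => ?_)
            (Finset.sum_le_sum_of_subset hTsub)
          rw [hmiss c hc, mul_one]
  refine (batchEx_mono _ hpoint).trans ?_
  rw [batchEx_add, batchEx_add, batchEx_const, batchEx_points hcl hDt, batchEx_sum_finset]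
  simp only [batchEx_mul_left, batchEx_missed hcl hDt, hY]
  set q : GridPoint d Δ → ℝ := fun c => (1 - partCost z Y S (Cl.G c) / E) ^ 2 ^ i with hq
  have hGle : ∀ c, partCost z Y S (Cl.G c) / E ≤ 1 := fun c => by
    rw [div_le_one hpos]; exact (partCost_le_cost _ _).trans hDle
  have hq0 : ∀ c, 0 ≤ q c := fun c => pow_nonneg (by linarith [hGle c]) _
  have hqexp : ∀ c ∈ T, q c ≤ Real.exp (-(goodShare z * u c)) := by
    intro c hc
    refine (one_sub_pow_le_exp (hGle c) _).trans (Real.exp_le_exp.2 (neg_le_neg ?_))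
    have h1 := Cl.share S c (Finset.mem_filter.1 hc).2
    push_cast
    rw [← hm]
    calc goodShare z * (m * (pc c / E)) = m * ((goodShare z * pc c) / E) := by ring
      _ ≤ _ := by gcongr
  have hvu : v ≤ 2 * ∑ c ∈ T, u c := by
    have h1 := Cl.cost_le S
    push Not at hsmall
    unfold approxFactor at hsmall
    have h2 : D ≤ 2 * ∑ c ∈ T, pc c := by linarith
    calc v ≤ m * ((2 * ∑ c ∈ T, pc c) / E) := by simp only [hv]; gcongr
      _ = _ := by simp only [hu]; rw [← Finset.mul_sum, ← Finset.sum_div]; ring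
  have huv : ∑ c ∈ T, u c ≤ v := by
    have h1 := Cl.sum_uncovered_le S
    calc ∑ c ∈ T, u c = m * ((∑ c ∈ T, pc c) / E) := by
          simp only [hu]; rw [← Finset.mul_sum, ← Finset.sum_div]
      _ ≤ _ := by simp only [hv]; gcongr
  -- One `v` stands for the expected sampled points and one for `32 * (v / 32)` from `hcost`. By
  -- `hvu` they are at most `4 * ∑ u c`, and by `huv` the credit `16 * v` pays for `16 * ∑ u c`.
  have hgoal : (M + v) + (m * (D / E) + ∑ c ∈ T, (clusterWeight z + 32 * u c) * q c) ≤
      M + clusterWeight z * T.card + (if 2 ≤ i then 16 * (m * (D / E)) else 0) := by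
    have h1 : m * (D / E) = v := rfl
    rw [h1]
    split_ifs with hi
    · have h2 : ∑ c ∈ T, (4 * u c + (clusterWeight z + 32 * u c) * q c) ≤
          ∑ c ∈ T, (clusterWeight z + 16 * u c) :=
        Finset.sum_le_sum fun c hc => coverage_le (hu0 c) goodShare_pos (hqexp c hc)
      simp only [Finset.sum_add_distrib, ← Finset.mul_sum, Finset.sum_const, nsmul_eq_mul] at h2 ⊢
      linarith
    -- Without credit, the sharper inequality is needed; it applies because two requests give `u c ≤
    -- 2`, while `goodShare z ≤ 1 / 8`.
    · have hi1 : i = 1 := by have := hA.one_le; simp only at this; omega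
      have h2 : ∑ c ∈ T, (4 * u c + (clusterWeight z + 32 * u c) * q c) ≤
          ∑ _c ∈ T, clusterWeight z := by
        refine Finset.sum_le_sum fun c hc =>
          coverage_of_le_one (hu0 c) goodShare_pos (hqexp c hc) ?_
        have h3 : pc c / E ≤ 1 := by
          rw [div_le_one hpos]; exact (partCost_le_cost _ _).trans hDle
        have h4 : m = 2 := by rw [hm, hi1]; norm_num
        have h5 : u c ≤ 2 := by simp only [hu, h4]; linarith
        have h6 := goodShare_le hz
        have h7 := goodShare_pos (z := z)
        nlinarith [hu0 c]
      simp only [Finset.sum_add_distrib, ← Finset.mul_sum, Finset.sum_const, nsmul_eq_mul] at h2 ⊢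
      linarith
  have hnn : ∀ c, 0 ≤ clusterWeight z + 32 * u c := fun c => by linarith [hu0 c]
  have hsumE : (∑ j, ((powerValue 2 (est j) : ℝ≥0) : ℝ)) = E := rfl
  rw [hsumE]
  have hlhs : ENNReal.ofReal (M + v) + (ENNReal.ofReal (((2 ^ i : ℕ) : ℝ) * (D / E)) +
      ∑ c ∈ T, ENNReal.ofReal (clusterWeight z + 32 * u c) * ENNReal.ofReal (q c)) =
      ENNReal.ofReal ((M + v) + (m * (D / E) + ∑ c ∈ T, (clusterWeight z + 32 * u c) * q c)) := by
    have hs0 : 0 ≤ ∑ c ∈ T, (clusterWeight z + 32 * u c) * q c :=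
      Finset.sum_nonneg fun c _ => mul_nonneg (hnn c) (hq0 c)
    have hcast : ((2 ^ i : ℕ) : ℝ) = m := by push_cast; rfl
    rw [hcast, ENNReal.ofReal_add (by positivity) (add_nonneg hv0 hs0),
      ENNReal.ofReal_add hv0 hs0,
      ENNReal.ofReal_sum_of_nonneg fun c _ => mul_nonneg (hnn c) (hq0 c)]
    congr 2
    exact Finset.sum_congr rfl fun c _ => (ENNReal.ofReal_mul (hnn c)).symm
  refine hlhs.le.trans ((ENNReal.ofReal_le_ofReal hgoal).trans (le_of_eq ?_))
  simp only [costPotential]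
  rw [if_neg hsmall]

end costPotential

/-! ### The probability of a bad solution -/

section costBound
variable {s d Δ : ℕ} [NeZero s] {z : ℝ} {k N R : ℕ} {X : Fin s → Multiset (GridPoint d Δ)}
  {Y : Multiset (GridPoint d Δ)}

lemma phase_of_output {q : PublicState s d Δ} {o : Finset (GridPoint d Δ)}
    (h : (lazyAdaptiveSampling s d Δ z k N R).output q = some o) : q.phase = .done ∧ q.S = o := by
  obtain ⟨phase, S, est, M, i⟩ := q
  cases phase <;> first
    | exact ⟨rfl, Option.some.inj h⟩
    | exact absurd (show none = some o from h) (by simp)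

/-- The potential starts at `clusterWeight z * k` and is at least `N` in a bad final configuration.
-/
lemma toOuterMeasure_bad_cost_le (hz : 1 ≤ z) (hk : 1 ≤ k) {n E : ℕ} (hn : 1 ≤ n)
    (hX : ∑ j, (X j).card = n)
    (hE : ∀ (S : Finset (GridPoint d Δ)) j r, S.Nonempty →
      powerApprox 2 (cost z (X j) (centers S)) = some r → r ≤ E)
    (hY : ∑ j, X j = Y) (Cl : Clusters z k Y) (hN : 0 < N) (t : ℕ) :
    ((lazyAdaptiveSampling s d Δ z k N R).run X t).toOuterMeasure
      {c | ∃ o, (lazyAdaptiveSampling s d Δ z k N R).output c.state = some o ∧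
        ¬ cost z Y (centers o) ≤ approxFactor z * Cl.total} ≤
      ENNReal.ofReal (clusterWeight z * k / N) := by
  set P := lazyAdaptiveSampling s d Δ z k N R with hP
  set I : P.Config → Prop := fun c => ControlInv z X k N R c.state c.rounds ∧
    c.bits ≤ bitsBound k R n E c.state c.rounds with hI
  have hI0 : I ⟨P.start, 0, 0⟩ := ⟨⟨rfl, rfl⟩, Nat.zero_le _⟩
  have hIs := invariant_step (R := R) (N := N) hz hk hn hX hE
  have hW := clusterWeight_pos (z := z)
  have hstep : ∀ c, I c → ex (P.round X c) (extend z X k N R fun q _ => costPotential Cl q) ≤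
      extend z X k N R (fun q _ => costPotential Cl q) c := by
    refine ex_round_extend_le (fun q _ => costPotential Cl q) I (fun c hc => hc.1)
      (fun _ => ENNReal.ofReal (clusterWeight z * k)) (fun _ => le_rfl)
      (fun _ _ _ _ _ => rfl) (fun _ _ _ _ _ _ => rfl) (fun _ _ _ _ _ _ => rfl)
      (fun _ _ _ _ _ => rfl) ?_ ?_ ?_ ?_
    · intro S i _
      refine (costPotential_loop_le Cl _).trans ?_
      split_ifs
      · exact zero_le
      · refine ENNReal.ofReal_le_ofReal ?_
        rw [Nat.cast_zero, zero_add]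
        have := Cl.card_uncovered_le S
        gcongr
    · intro S est M i r hA _
      exact costPotential_batch Cl hz hY S est M i hA
    -- Every outcome of L1Sampling is acceptable here: the credit is dropped, or passed on to the
    -- next batch by `32 * 2 ^ i = 16 * 2 ^ (i + 1)`.
    · intro S est M i r hA _
      refine ex_le_const _ fun l _ => ?_
      have hpos := estSum_pos hA.est_ne
      have h0 : 0 ≤ 32 * (2 ^ i * (cost z Y (centers S) / estSum est)) :=
        mul_nonneg (by norm_num) (mul_nonneg (by positivity)
          (div_nonneg (cost_nonneg _ _) hpos.le))
      unfold afterL1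
      split_ifs
      · simp only [costPotential]
        split_ifs
        · exact le_rfl
        · exact ENNReal.ofReal_le_ofReal (by linarith)
      · have h1 := hA.one_le
        simp only at h1
        simp only [costPotential]
        split_ifs
        · exact le_rfl
        · refine ENNReal.ofReal_le_ofReal (le_of_eq ?_)
          rw [pow_succ]; ring
        · omega
      · refine (costPotential_loop_le Cl _).trans ?_
        simp only [costPotential]
        split_ifs
        · exact le_rfl
        · exact ENNReal.ofReal_le_ofReal (by linarith)
    · intro S est M i r _ _
      refine (costPotential_loop_le Cl _).trans ?_
      simp only [costPotential]
      split_ifs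
      · exact le_rfl
      · exact ENNReal.ofReal_le_ofReal (by linarith)
  have hex := P.ex_run_le X I hI0 hIs _ hstep t
  have hmark := mul_toOuterMeasure_le_ex (P.run X t)
    (extend z X k N R fun q _ => costPotential Cl q)
    {c | ∃ o, P.output c.state = some o ∧ ¬ cost z Y (centers o) ≤ approxFactor z * Cl.total}
    (ENNReal.ofReal N) (by
      intro c hc hbad
      have hinv := (P.invariant_run X I hI0 hIs t c hc).1
      obtain ⟨⟨phase, S, est, M, i⟩, bits, rounds⟩ := c
      obtain ⟨o, ho, hcost⟩ := hbad
      obtain ⟨hph, hoS⟩ := phase_of_output ho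
      simp only at hph hoS
      subst hph hoS
      obtain ⟨hs, -, hdone, -⟩ := hinv
      -- The alternative reason to stop, that all the estimates are zero, forces cost zero and hence
      -- a good solution.
      have hM : N ≤ M := by
        refine hdone.resolve_right fun hnone => hcost ?_
        have hc0 : cost z Y (centers S) = ∑ j, cost z (X j) (centers S) := by rw [← hY, cost_sum]
        rw [hc0]
        refine le_trans (le_of_eq (Finset.sum_eq_zero fun j _ => le_antisymm ?_
          (cost_nonneg _ _))) (mul_nonneg (mul_nonneg (by norm_num) coverFactor_pos.le)
            Cl.total_nonneg)
        have h1 := hs.cost_le j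
        have h2 := hnone j
        simp only [PublicState.Dt] at h1 h2
        rw [h2] at h1
        simpa [powerValue] using h1
      show _ ≤ costPotential Cl (⟨.done, S, est, M, i⟩ : PublicState s d Δ)
      simp only [costPotential]
      rw [if_neg hcost]
      refine ENNReal.ofReal_le_ofReal ?_
      have : (N : ℝ) ≤ M := by exact_mod_cast hM
      have h3 : 0 ≤ clusterWeight z * (Cl.uncovered S).card := by positivity
      linarith)
  have hstart : extend z X k N R (fun q _ => costPotential Cl q) ⟨P.start, 0, 0⟩ =
      ENNReal.ofReal (clusterWeight z * k) := rfl
  have hN' : (0 : ℝ) < N := by exact_mod_cast hN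
  rw [ENNReal.ofReal_div_of_pos hN', ENNReal.le_div_iff_mul_le
    (by left; simpa using hN.ne') (by simp), mul_comm]
  exact hmark.trans (hex.trans hstart.le)

end costBound

/-! ### The number of answers in a batch -/

section batchLength
variable {s d Δ : ℕ}

lemma length_getPoints_le (m : Msg s d Δ) : m.getPoints.length ≤ m.answers.length := by
  cases m <;> simp [Msg.getPoints, Msg.answers, List.reduceOption_length_le]

/-- The number of answers that are not points. -/
def rejections (ms : Fin s → Msg s d Δ) : ℕ :=
  ∑ j, ((ms j).answers.length - (ms j).getPoints.length)

lemma points_add_rejections (ms : Fin s → Msg s d Δ) :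
    ∑ j, (ms j).getPoints.length + rejections ms = ∑ j, (ms j).answers.length := by
  unfold rejections
  rw [← Finset.sum_add_distrib]
  exact Finset.sum_congr rfl fun j _ => Nat.add_sub_cancel' (length_getPoints_le _)

variable [NeZero s] {z : ℝ} {X : Fin s → Multiset (GridPoint d Δ)}
  {S : Finset (GridPoint d Δ)} {Dt : Fin s → ℝ≥0}

lemma batchEx_mono_support (m : ℕ) {f g : (Fin s → Msg s d Δ) → ℝ≥0∞}
    (h : ∀ ms, ∑ j, (ms j).answers.length = m → f ms ≤ g ms) :
    batchEx z X S Dt m f ≤ batchEx z X S Dt m g := by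
  refine ex_mono _ fun l hl => ex_mono _ fun ms hms => h ms ?_
  rw [← (mem_support_iidList hl).1, ← sum_count_eq_length]
  refine Finset.sum_congr rfl fun j _ => ?_
  have h1 := mem_support_independent hms j
  rw [PMF.support_map] at h1
  obtain ⟨a, ha, hae⟩ := h1
  rw [← hae]
  exact (mem_support_iidList ha).1

/-- Sampled points lower the rounds potential. Counting rejections turns this decrease into a
nonnegative cost, as expectations in `ℝ≥0∞` require. -/
lemma batchEx_rejections (hD : ∀ j, cost z (X j) (centers S) ≤ Dt j) (hDt : ∑ j, Dt j ≠ 0)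
    (m : ℕ) : batchEx z X S Dt m (fun ms => (rejections ms : ℝ≥0∞)) =
      ENNReal.ofReal (m * (1 - cost z (∑ j, X j) (centers S) / ∑ j, (Dt j : ℝ))) := by
  classical
  have h1 : ∀ m : Msg s d Δ, ((m.answers.length - m.getPoints.length : ℕ) : ℝ≥0∞) =
      (m.answers.map fun o => if ∃ y ∈ (Finset.univ : Finset (GridPoint d Δ)), o = some y then
        (0 : ℝ≥0∞) else 1).sum := by
    intro m
    cases m with
    | samples l =>
      simp only [Msg.getPoints, Msg.answers]
      induction l with
      | nil => simp
      | cons o l ih =>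
        have h2 := List.reduceOption_length_le l
        rcases o with _ | y
        · simp only [List.reduceOption_cons_of_none, List.length_cons, List.map_cons,
            List.sum_cons, ← ih]
          rw [show l.length + 1 - l.reduceOption.length = 1 + (l.length - l.reduceOption.length) by
            omega]
          simp
        · simp only [List.reduceOption_cons_of_some, List.length_cons, List.map_cons,
            List.sum_cons, ← ih]
          simp
    | _ => simp [Msg.getPoints, Msg.answers]
  unfold rejections
  simp only [Nat.cast_sum, h1]
  rw [batchEx_sum, requestEx_not_mem hD hDt, partCost_univ, ENNReal.ofReal_mul (Nat.cast_nonneg _),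
    ENNReal.ofReal_natCast]

lemma mul_exp_neg_le_one (t : ℝ) : t * Real.exp (-t) ≤ 1 := by
  rw [Real.exp_neg, ← div_eq_mul_inv, div_le_one (Real.exp_pos _)]
  linarith [Real.add_one_le_exp t]

/-- The expected cost after a batch of `m` requests is at most `n / m` times the estimate. -/
lemma batchEx_cost_le (hz : 1 ≤ z) (hS : S.Nonempty)
    (hD : ∀ j, cost z (X j) (centers S) ≤ Dt j) (hDt : ∑ j, Dt j ≠ 0) {m : ℕ} (hm : 0 < m)
    (S' : (Fin s → Msg s d Δ) → Finset (GridPoint d Δ)) (hsub : ∀ ms, S ⊆ S' ms)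
    (hmem : ∀ ms j, ∀ y ∈ (ms j).getPoints, y ∈ S' ms) :
    batchEx z X S Dt m (fun ms => ENNReal.ofReal (cost z (∑ j, X j) (centers (S' ms)))) ≤
      ENNReal.ofReal ((∑ j, X j).card * ((∑ j, (Dt j : ℝ)) / m)) := by
  classical
  set Y := ∑ j, X j with hY
  set E := ∑ j, (Dt j : ℝ) with hE
  have hpos : 0 < E := by
    have : 0 < ∑ j, Dt j := pos_iff_ne_zero.2 hDt
    rw [hE]; exact_mod_cast this
  have hw0 : ∀ (y : GridPoint d Δ) (S : Finset (GridPoint d Δ)),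
      0 ≤ (Y.count y : ℝ) * pointCost z (centers S) y := fun y S =>
    mul_nonneg (Nat.cast_nonneg _) (pointCost_nonneg _ _)
  -- Only the distinct data points are summed, not the whole grid, so that there are at most `n`
  -- terms below.
  have hsum : ∀ S : Finset (GridPoint d Δ), cost z Y (centers S) =
      ∑ y ∈ Y.toFinset, (Y.count y : ℝ) * pointCost z (centers S) y := by
    intro S
    unfold cost
    rw [Finset.sum_multiset_map_count]
    simp only [nsmul_eq_mul]
  have hpoint : ∀ ms, ENNReal.ofReal (cost z Y (centers (S' ms))) ≤
      ∑ y ∈ Y.toFinset, ENNReal.ofReal ((Y.count y : ℝ) * pointCost z (centers S) y) *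
        missed {y} ms := by
    intro ms
    rw [hsum, ENNReal.ofReal_sum_of_nonneg fun y _ => hw0 y _]
    refine Finset.sum_le_sum fun y _ => ?_
    by_cases hy : y ∈ S' ms
    · rw [pointCost_eq_zero hz hy]; simp
    · rw [missed_eq_one, mul_one]
      · refine ENNReal.ofReal_le_ofReal (mul_le_mul_of_nonneg_left
          (pointCost_anti (by linarith) hS (hsub ms) y) (Nat.cast_nonneg _))
      · intro j y' hy' h
        rw [Finset.mem_singleton] at h
        exact hy (h ▸ hmem ms j y' hy')
  refine (batchEx_mono _ hpoint).trans ?_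
  rw [batchEx_sum_finset]
  simp only [batchEx_mul_left, batchEx_missed hD hDt]
  have hterm : ∀ y ∈ Y.toFinset, ENNReal.ofReal ((Y.count y : ℝ) * pointCost z (centers S) y) *
      ENNReal.ofReal ((1 - partCost z Y S {y} / E) ^ m) ≤ ENNReal.ofReal (E / m) := by
    intro y _
    rw [← ENNReal.ofReal_mul (hw0 y S)]
    refine ENNReal.ofReal_le_ofReal ?_
    have h1 : partCost z Y S {y} = (Y.count y : ℝ) * pointCost z (centers S) y := by
      simp [partCost]
    rw [← h1]
    set w := partCost z Y S {y}
    have hw : 0 ≤ w := partCost_nonneg _ _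
    have hw1 : w / E ≤ 1 := by
      rw [div_le_one hpos]; exact (partCost_le_cost _ _).trans (cost_sum_le hD)
    have h2 := one_sub_pow_le_exp hw1 m
    have h3 := mul_exp_neg_le_one (m * (w / E))
    have hm' : (0 : ℝ) < m := by exact_mod_cast hm
    -- A point of cost `w` keeps it only if all `m` requests miss it; `t * exp (-t) ≤ 1` with `t = m
    -- * w / E` gives at most `E / m` per point.
    calc w * (1 - w / E) ^ m ≤ w * Real.exp (-(m * (w / E))) := by gcongr
      _ = E / m * (m * (w / E) * Real.exp (-(m * (w / E)))) := by field_simp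
      _ ≤ E / m * 1 := by gcongr
      _ = _ := mul_one _
  refine (Finset.sum_le_sum hterm).trans ?_
  rw [Finset.sum_const, nsmul_eq_mul, ENNReal.ofReal_mul (Nat.cast_nonneg _),
    ENNReal.ofReal_natCast]
  gcongr
  exact Multiset.toFinset_card_le Y

end batchLength

/-! ### The potential function for the number of rounds -/

/-- The height of a sum of estimates: roughly its binary logarithm. -/
def height (t : ℝ) : ℝ := if t = 0 then 0 else Real.logb 2 t + 2

lemma height_nonneg {t : ℝ} (h : t = 0 ∨ 1 ≤ t) : 0 ≤ height t := by
  unfold height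
  split_ifs with h0
  · exact le_rfl
  · have := Real.logb_nonneg (b := 2) (by norm_num) (h.resolve_left h0)
    linarith

lemma height_mono {t u : ℝ} (h : t = 0 ∨ 1 ≤ t) (hu : u = 0 ∨ 1 ≤ u) (htu : t ≤ u) :
    height t ≤ height u := by
  rcases h with rfl | h
  · rw [height, if_pos rfl]; exact height_nonneg hu
  · unfold height
    rw [if_neg (by linarith), if_neg (by linarith)]
    have := Real.logb_le_logb_of_le (b := 2) (by norm_num) (by linarith) htu
    linarith

lemma two_le_height {t : ℝ} (h : 1 ≤ t) : 2 ≤ height t := by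
  unfold height
  rw [if_neg (by linarith)]
  have := Real.logb_nonneg (b := 2) (by norm_num) h
  linarith

/-- The offset `2` in `height` makes a drop to zero count as two units as well. -/
lemma height_add_two_le {t u : ℝ} (h : t = 0 ∨ 1 ≤ t) (hu : 1 ≤ u) (htu : 4 * t ≤ u) :
    height t + 2 ≤ height u := by
  rcases h with rfl | h
  · have := two_le_height hu
    rw [height, if_pos rfl]; linarith
  · unfold height
    rw [if_neg (by linarith), if_neg (by linarith)]
    have h1 := Real.logb_le_logb_of_le (b := 2) (by norm_num) (by linarith) htu
    rw [Real.logb_mul (by norm_num) (by linarith)] at h1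
    have h2 : Real.logb 2 4 = 2 := by
      rw [show (4 : ℝ) = 2 ^ (2 : ℝ) by norm_num, Real.logb_rpow (by norm_num) (by norm_num)]
    linarith

lemma estSum_eq_zero_or_one_le {s : ℕ} (est : Fin s → Option ℕ) :
    estSum est = 0 ∨ 1 ≤ estSum est := by
  by_cases h : ∃ j, est j ≠ none
  · right
    obtain ⟨j, hj⟩ := h
    have h1 : (1 : ℝ) ≤ powerValue 2 (est j) := by exact_mod_cast one_le_powerValue hj
    exact h1.trans (Finset.single_le_sum (f := fun j => (powerValue 2 (est j) : ℝ))
      (fun j _ => NNReal.coe_nonneg _) (Finset.mem_univ j))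
  · left
    push Not at h
    exact Finset.sum_eq_zero fun j _ => by rw [h j]; simp [powerValue]

/-- The risk of wrong decisions of L1Sampling from the batch `i` on. -/
def risk (δ : ℝ) (n k i : ℕ) : ℝ :=
  δ * ∑ i' ∈ Finset.Ico i (Nat.log 2 (2 * k) + 1), min (1 : ℝ) (8 * (n : ℝ) / 2 ^ i')

lemma risk_nonneg {δ : ℝ} (hδ : 0 ≤ δ) (n k i : ℕ) : 0 ≤ risk δ n k i :=
  mul_nonneg hδ (Finset.sum_nonneg fun _ _ => by positivity)

lemma risk_eq {δ : ℝ} {n k i : ℕ} (h : i ≤ Nat.log 2 (2 * k)) :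
    risk δ n k i = δ * min (1 : ℝ) (8 * (n : ℝ) / 2 ^ i) + risk δ n k (i + 1) := by
  unfold risk
  rw [Finset.sum_eq_sum_Ico_succ_bot (by omega), mul_add]

/-- The first `L` terms are at most one and the rest is a geometric series. The bound does not
depend on `m`, hence later not on `k`. -/
lemma sum_min_le (L : ℕ) (m : ℕ) : ∑ i ∈ Finset.range m, min (1 : ℝ) (2 ^ L / 2 ^ i) ≤ L + 2 := by
  have h1 : ∀ i ∈ Finset.range m, min (1 : ℝ) (2 ^ L / 2 ^ i) ≤
      (if i < L then 1 else 0) + (if L ≤ i then (1 / 2 : ℝ) ^ (i - L) else 0) := by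
    intro i _
    rcases lt_or_ge i L with h | h
    · rw [if_pos h, if_neg (by omega)]; simp
    · rw [if_neg (by omega), if_pos h, zero_add]
      refine (min_le_right _ _).trans (le_of_eq ?_)
      rw [div_pow, one_pow, pow_sub₀ _ (by norm_num) h]
      field_simp
  refine (Finset.sum_le_sum h1).trans ?_
  rw [Finset.sum_add_distrib]
  refine add_le_add ?_ ?_
  · rw [Finset.sum_boole]
    have : ((Finset.range m).filter fun i => i < L).card ≤ (Finset.range L).card :=
      Finset.card_le_card fun i hi => by simp at hi ⊢; omega
    rw [Finset.card_range] at this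
    exact_mod_cast this
  · rw [← Finset.sum_filter]
    have h2 : ∑ i ∈ (Finset.range m).filter (fun i => L ≤ i), (1 / 2 : ℝ) ^ (i - L) ≤
        ∑ i ∈ Finset.range m, (1 / 2 : ℝ) ^ i := by
      have h3 : ∑ i ∈ (Finset.range m).filter (fun i => L ≤ i), (1 / 2 : ℝ) ^ (i - L) =
          ∑ i ∈ ((Finset.range m).filter fun i => L ≤ i).image (fun i => i - L),
            (1 / 2 : ℝ) ^ i := by
        rw [Finset.sum_image]
        intro i hi j hj hij
        simp at hi hj hij
        omega
      rw [h3]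
      refine Finset.sum_le_sum_of_subset_of_nonneg ?_ fun _ _ _ => by positivity
      intro i hi
      simp only [Finset.mem_image, Finset.mem_filter, Finset.mem_range] at hi ⊢
      omega
    refine h2.trans ?_
    exact sum_geometric_two_le m

lemma risk_le {δ : ℝ} (hδ : 0 ≤ δ) {n L : ℕ} (k i : ℕ) (h : 8 * n ≤ 2 ^ L) :
    risk δ n k i ≤ δ * (L + 2) := by
  unfold risk
  refine mul_le_mul_of_nonneg_left ?_ hδ
  refine le_trans (Finset.sum_le_sum (g := fun i => min (1 : ℝ) (2 ^ L / 2 ^ i)) fun i' _ => ?_)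
    (le_trans (Finset.sum_le_sum_of_subset_of_nonneg (t := Finset.range (Nat.log 2 (2 * k) + 1)) ?_
      fun _ _ _ => by positivity) (sum_min_le L _))
  · have : (8 * n : ℝ) ≤ 2 ^ L := by exact_mod_cast h
    gcongr
  · intro i' hi'
    simp only [Finset.mem_Ico, Finset.mem_range] at hi' ⊢
    omega

section roundsPotential
variable {s d Δ : ℕ} (z : ℝ) (X : Fin s → Multiset (GridPoint d Δ)) (k N n : ℕ) (δ : ℝ)

/-- A bound on the number of batch sequences that are still to come, up to constants. -/
def progress (E : ℝ) (M : ℕ) : ℝ := height E + 256 * (((N : ℝ) + 4 * k - M) / k)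

/-- The number of rounds that are charged to a unit of progress. -/
def roundCharge : ℝ := 4 * Nat.log 2 (2 * k) + 5

open Classical in
/-- The potential function for the number of rounds. -/
def roundsPotential (b : ℝ≥0∞) (q : PublicState s d Δ) (r : ℕ) : ℝ≥0∞ :=
  match q.phase with
  | .sizes | .chooseFirst _ | .first _ | .report => b
  -- At most `5 + 4 * (log - i)` rounds remain in this sequence: four per batch and one update. The
  -- `-2` anticipates the two units of progress that the sequence is expected to make.
  | .lazyRequest => r + ENNReal.ofReal (5 + 4 * ((Nat.log 2 (2 * k) : ℝ) - q.i) +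
      roundCharge k * (progress k N (estSum q.est) q.M - 2 + 2 * risk δ n k q.i + 2 * δ))
  -- The first `2 * δ` insures against a wrong False in the last batch, the second one against a
  -- wrong True now. The final `2` replaces the missing progress if the last batch may end with
  -- False although the estimates are fair.
  | .l1Request => r + ENNReal.ofReal (3 + 4 * ((Nat.log 2 (2 * k) : ℝ) - q.i) +
      roundCharge k * (progress k N (estSum q.est) q.M - 2 + 2 * risk δ n k (q.i + 1) + 2 * δ +
        (if estSum q.est ≤ 8 * cost z (∑ j, X j) (centers q.S) then 2 * δ else 0) +
        if k < 2 ^ (q.i + 1) ∧ estSum q.est ≤ 64 * cost z (∑ j, X j) (centers q.S) then 2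
          else 0))
  -- The update is determined by `S`, so the new estimates are used already.
  | .refresh => r + ENNReal.ofReal (1 + roundCharge k *
      progress k N (estSum fun j => powerApprox 2 (cost z (X j) (centers q.S))) q.M)
  | .lazyReply _ | .l1Reply _ | .done => r

variable {z X k N n δ}

lemma roundCharge_pos : 0 < roundCharge k := by unfold roundCharge; positivity

lemma progress_nonneg {E : ℝ} (hE : E = 0 ∨ 1 ≤ E) {M : ℕ} (hM : M ≤ N + 4 * k) :
    0 ≤ progress k N E M := by
  have h1 := height_nonneg hE
  have h2 : (M : ℝ) ≤ N + 4 * k := by exact_mod_cast hM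
  unfold progress
  have : 0 ≤ ((N : ℝ) + 4 * k - M) / k := div_nonneg (by linarith) (Nat.cast_nonneg _)
  linarith

lemma two_le_progress {E : ℝ} (hE : 1 ≤ E) {M : ℕ} (hM : M ≤ N + 4 * k) :
    2 ≤ progress k N E M := by
  have h1 := two_le_height hE
  have h2 : (M : ℝ) ≤ N + 4 * k := by exact_mod_cast hM
  unfold progress
  have : 0 ≤ ((N : ℝ) + 4 * k - M) / k := div_nonneg (by linarith) (Nat.cast_nonneg _)
  linarith

/-- Of the two units of progress that are advanced to a new sequence, one pays for its rounds and
the other for its risks. -/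
lemma roundsPotential_loop_le (hrisk : risk δ n k 1 + δ ≤ 1 / 2) (b : ℝ≥0∞)
    (q : PublicState s d Δ) (r : ℕ) :
    roundsPotential z X k N n δ b (q.outerLoop N) r ≤
      r + ENNReal.ofReal (roundCharge k * progress k N (estSum q.est) q.M) := by
  unfold PublicState.outerLoop
  split_ifs
  · simp only [roundsPotential]
    gcongr
    have hK := roundCharge_pos (k := k)
    have h1 : roundCharge k * (risk δ n k 1 + δ) ≤ roundCharge k * (1 / 2) := by gcongr
    have h2 : roundCharge k = 4 * (Nat.log 2 (2 * k) : ℝ) + 5 := rfl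
    push_cast
    linarith
  · exact le_self_add

/-- The new estimates are at most twice the cost, and at most the old estimates. -/
lemma estSum_powerApprox_bounds (hz : 1 ≤ z) {S : Finset (GridPoint d Δ)} (hS : S.Nonempty)
    {est : Fin s → Option ℕ} (hD : ∀ j, cost z (X j) (centers S) ≤ powerValue 2 (est j)) :
    cost z (∑ j, X j) (centers S) ≤ estSum (fun j => powerApprox 2 (cost z (X j) (centers S))) ∧
    estSum (fun j => powerApprox 2 (cost z (X j) (centers S))) ≤
      2 * cost z (∑ j, X j) (centers S) ∧
    estSum (fun j => powerApprox 2 (cost z (X j) (centers S))) ≤ estSum est := by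
  refine ⟨?_, ?_, ?_⟩
  · rw [cost_sum]
    exact Finset.sum_le_sum fun j _ => le_powerValue (cost_nonneg _ _)
  · rw [cost_sum, Finset.mul_sum]
    exact Finset.sum_le_sum fun j _ => powerValue_le_two_mul (cost_eq_zero_or_one_le hz hS _)
  · refine Finset.sum_le_sum fun j _ => ?_
    exact_mod_cast powerValue_powerApprox_le (cost_nonneg _ _) (hD j)

lemma progress_mono {E E' : ℝ} (h : E = 0 ∨ 1 ≤ E) (hE' : E' = 0 ∨ 1 ≤ E') (hE : E ≤ E') (M : ℕ) :
    progress k N E M ≤ progress k N E' M := by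
  unfold progress
  have := height_mono h hE' hE
  linarith

variable [NeZero s]

/-- A True with `E > 8 * D` gives `E' ≤ 2 * D < E / 4`, which is two units of height. A True with `E
≤ 8 * D`, and a final False with `E > 64 * D`, have probability at most `δ`, because `D ≤ E' ≤ 2 *
D`. A False before the last batch only moves on to the next one. -/
lemma roundsPotential_l1 (hz : 1 ≤ z) (hδ : 0 ≤ δ) (hrisk : risk δ n k 1 + δ ≤ 1 / 2)
    {R : ℕ} (hR : (0.99 : ℝ) ^ R ≤ δ) (b : ℝ≥0∞) (S : Finset (GridPoint d Δ))
    (est : Fin s → Option ℕ) (M i r : ℕ)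
    (hA : PublicState.Active z X k (⟨.l1Request, S, est, M, i⟩ : PublicState s d Δ))
    (hM : M ≤ N + 4 * k) :
    ex (iidList (drawSite fun j => powerValue 2 (est j)) R)
        (fun l => roundsPotential z X k N n δ b (afterL1 z X k N S est M i l) (r + 2)) ≤
      roundsPotential z X k N n δ b ⟨.l1Request, S, est, M, i⟩ r := by
  classical
  have hne := hA.est_ne
  have hD : ∀ j, cost z (X j) (centers S) ≤ powerValue 2 (est j) := hA.cost_le
  have hSne : S.Nonempty := hA.nonempty
  have hpow : 2 ^ i ≤ 2 * k := hA.pow_le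
  have hE1 : 1 ≤ estSum est :=
    (estSum_eq_zero_or_one_le est).resolve_left (estSum_pos hne).ne'
  have hDt := sum_powerValue_ne_zero hne
  obtain ⟨hDV, hVD, hVE⟩ := estSum_powerApprox_bounds hz hSne hD
  set V : Fin s → ℝ≥0 := fun j => powerValue 2 (powerApprox 2 (cost z (X j) (centers S))) with hV
  have hVle : ∀ j, V j ≤ powerValue 2 (est j) := fun j =>
    powerValue_powerApprox_le (cost_nonneg _ _) (hD j)
  have hV0 := estSum_eq_zero_or_one_le fun j => powerApprox 2 (cost z (X j) (centers S))
  set E' := estSum fun j => powerApprox 2 (cost z (X j) (centers S)) with hE'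
  have hVs : ∑ j, (V j : ℝ) = E' := rfl
  set E := estSum est with hE
  have hEs : ∑ j, (powerValue 2 (est j) : ℝ) = E := rfl
  set D := cost z (∑ j, X j) (centers S) with hDdef
  have hiff : ∀ l : List (Fin s), l1Test (fun j => powerValue 2 (est j)) l (l1Exponents z X S l) ↔
      16 * (l.map fun j => ((V j / powerValue 2 (est j) : ℝ≥0) : ℝ)).sum ≤ l.length := by
    intro l
    refine l1Test_iff hDt fun j hj => ?_
    unfold l1Exponents
    rw [if_pos hj, hV]
    congr 1
    exact_mod_cast coe_l1Base
  set T : Set (List (Fin s)) :=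
    {l | 16 * (l.map fun j => ((V j / powerValue 2 (est j) : ℝ≥0) : ℝ)).sum ≤ l.length} with hT
  set p := iidList (drawSite fun j => powerValue 2 (est j)) R with hp
  set K := roundCharge k with hK
  have hKpos : 0 < K := roundCharge_pos
  set ρ := risk δ n k (i + 1) with hρ
  have hρ0 : 0 ≤ ρ := risk_nonneg hδ _ _ _
  have hi : i ≤ Nat.log 2 (2 * k) :=
    Nat.le_log_of_pow_le (by norm_num) hpow
  have hi' : (0 : ℝ) ≤ (Nat.log 2 (2 * k) : ℝ) - i := by
    have : (i : ℝ) ≤ Nat.log 2 (2 * k) := by exact_mod_cast hi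
    linarith
  set G := progress k N E M with hG
  have hG2 : 2 ≤ G := two_le_progress hE1 hM
  have hG' : progress k N E' M ≤ G := progress_mono hV0 (Or.inr hE1) hVE M
  set x : ℝ := if k < 2 ^ (i + 1) then 0 else 2 * δ with hx
  set y : ℝ := if k < 2 ^ (i + 1) ∧ E ≤ 64 * D then 2 else 0 with hy
  have hx0 : 0 ≤ x := by rw [hx]; split_ifs <;> linarith
  have hy0 : 0 ≤ y := by rw [hy]; split_ifs <;> norm_num
  set c : ℝ := 1 + 4 * ((Nat.log 2 (2 * k) : ℝ) - i) + K * (G - 2 + 2 * ρ + x + y) with hc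
  have hc0 : 0 ≤ c := by
    have : 0 ≤ K * (G - 2 + 2 * ρ + x + y) := mul_nonneg hKpos.le (by linarith)
    linarith
  have hext : 0 ≤ K * (2 * ρ + x + y) := mul_nonneg hKpos.le (by linarith)
  -- `A` is the event of a wrong True and `B` that of a wrong False in the last batch; each costs at
  -- most `2 * K`.
  set A : Set (List (Fin s)) := if E ≤ 8 * D then T else ∅ with hAdef
  set B : Set (List (Fin s)) := if k < 2 ^ (i + 1) ∧ ¬ E ≤ 64 * D then Tᶜ else ∅ with hBdef
  have hpoint : ∀ l, roundsPotential z X k N n δ b (afterL1 z X k N S est M i l) (r + 2) ≤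
      ((r : ℝ≥0∞) + 2 + ENNReal.ofReal c) + (ENNReal.ofReal (2 * K) * A.indicator 1 l +
        ENNReal.ofReal (2 * K) * B.indicator 1 l) := by
    intro l
    have hloop : ∀ v : ℝ, v ≤ c + 2 * K → ((r + 2 : ℕ) : ℝ≥0∞) + ENNReal.ofReal v ≤
        ((r : ℝ≥0∞) + 2 + ENNReal.ofReal c) + ENNReal.ofReal (2 * K) := by
      intro v hv
      push_cast
      rw [add_assoc ((r : ℝ≥0∞) + 2), ← ENNReal.ofReal_add hc0 (by linarith)]
      gcongr
    unfold afterL1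
    rw [hiff l]
    split_ifs with h1 h2
    · simp only [roundsPotential]
      by_cases h8 : E ≤ 8 * D
      · have hl : A.indicator (1 : List (Fin s) → ℝ≥0∞) l = 1 := by
          rw [hAdef, if_pos h8]; exact Set.indicator_of_mem (M := ℝ≥0∞) h1 1
        rw [hl, mul_one]
        refine (hloop _ ?_).trans (add_le_add le_rfl le_self_add)
        have : K * progress k N E' M ≤ K * G := by gcongr
        rw [hc]; linarith
      · refine le_trans ?_ le_self_add
        push_cast
        gcongr
        have h4 : progress k N E' M + 2 ≤ G := by
          have := height_add_two_le hV0 hE1 (by linarith)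
          rw [hG]; unfold progress; linarith
        have : K * (progress k N E' M + 2) ≤ K * G := by gcongr
        rw [hc]; linarith
    · refine le_trans ?_ le_self_add
      simp only [roundsPotential]
      push_cast
      gcongr
      rw [hc, hx, if_neg (by omega)]
      have : 0 ≤ K * y := mul_nonneg hKpos.le hy0
      linarith
    · refine (roundsPotential_loop_le hrisk b _ _).trans ?_
      show ((r + 2 : ℕ) : ℝ≥0∞) + ENNReal.ofReal (K * G) ≤ _
      by_cases h64 : E ≤ 64 * D
      · refine le_trans ?_ le_self_add
        push_cast
        gcongr
        rw [hc, hy, if_pos ⟨by omega, h64⟩]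
        have : 0 ≤ K * (2 * ρ + x) := mul_nonneg hKpos.le (by linarith)
        linarith
      · have hl : B.indicator (1 : List (Fin s) → ℝ≥0∞) l = 1 := by
          rw [hBdef, if_pos ⟨by omega, h64⟩]; exact Set.indicator_of_mem (M := ℝ≥0∞) h1 1
        rw [hl, mul_one]
        refine (hloop _ ?_).trans (add_le_add le_rfl le_add_self)
        rw [hc]; linarith
  have hAp : p.toOuterMeasure A ≤ ENNReal.ofReal (if E ≤ 8 * D then δ else 0) := by
    rw [hAdef]
    split_ifs with h8
    · exact (l1Test_true_le hDt hVle (by rw [hEs, hVs]; linarith) R).trans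
        (ENNReal.ofReal_le_ofReal hR)
    · simp
  have hBp : p.toOuterMeasure B ≤ ENNReal.ofReal (if k < 2 ^ (i + 1) then δ else 0) := by
    rw [hBdef]
    split_ifs with h1 h2 h2
    · exact (l1Test_false_le hDt hVle (by rw [hEs, hVs]; linarith) R).trans
        (ENNReal.ofReal_le_ofReal hR)
    · exact absurd h1.1 h2
    · simp
    · simp
  refine (ex_mono _ fun l _ => hpoint l).trans ?_
  rw [ex_add, ex_const, ex_add, ex_mul_left, ex_mul_left, ← toOuterMeasure_eq_ex,
    ← toOuterMeasure_eq_ex]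
  refine (add_le_add le_rfl (add_le_add (mul_le_mul_right hAp _)
    (mul_le_mul_right hBp _))).trans ?_
  have hn1 : (0 : ℝ) ≤ if E ≤ 8 * D then δ else 0 := by split_ifs <;> linarith
  have hn2 : (0 : ℝ) ≤ if k < 2 ^ (i + 1) then δ else 0 := by split_ifs <;> linarith
  rw [← ENNReal.ofReal_mul (by linarith), ← ENNReal.ofReal_mul (by linarith),
    ← ENNReal.ofReal_add (by positivity) (by positivity), add_assoc,
    ← ENNReal.ofReal_add hc0 (by positivity), add_assoc (r : ℝ≥0∞),
    show (2 : ℝ≥0∞) = ENNReal.ofReal 2 by simp,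
    ← ENNReal.ofReal_add (by norm_num) (by positivity)]
  refine add_le_add le_rfl (ENNReal.ofReal_le_ofReal ?_)
  have h1 : x + 2 * (if k < 2 ^ (i + 1) then δ else 0) = 2 * δ := by
    rw [hx]; split_ifs <;> ring
  have h2 : (if E ≤ 8 * D then 2 * δ else 0) = 2 * (if E ≤ 8 * D then δ else 0) := by
    split_ifs <;> ring
  refine le_trans (le_of_eq ?_) (le_of_eq (congrArg (fun t => 3 +
    4 * ((Nat.log 2 (2 * k) : ℝ) - i) + K * (G - 2 + 2 * ρ + 2 * δ + t + y)) h2.symm))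
  rw [hc, ← h1]
  ring

/-- The batch yields `m * D / E` points in expectation, each worth `256 / k` units. If it is the
last one and `E ≤ 64 * D`, this is at least `256 * (1 / 2) * (1 / 64) = 2` units, as required before
L1Sampling. The charge for a wrong True occurs with probability at most `min 1 (8 * n / m)`, which
is the term of `risk` for batch `i`. -/
lemma roundsPotential_batch (hz : 1 ≤ z) (hk : 1 ≤ k) (hδ : 0 ≤ δ) (hn : (∑ j, X j).card = n)
    (b : ℝ≥0∞) (S : Finset (GridPoint d Δ)) (est : Fin s → Option ℕ) (M i r : ℕ)
    (hA : PublicState.Active z X k (⟨.lazyRequest, S, est, M, i⟩ : PublicState s d Δ))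
    (hM : M ≤ N + 2 ^ i) :
    batchEx z X S (fun j => powerValue 2 (est j)) (2 ^ i)
        (fun ms => roundsPotential z X k N n δ b (afterBatch S est M i ms) (r + 2)) ≤
      roundsPotential z X k N n δ b ⟨.lazyRequest, S, est, M, i⟩ r := by
  classical
  have hne := hA.est_ne
  have hD : ∀ j, cost z (X j) (centers S) ≤ powerValue 2 (est j) := hA.cost_le
  have hSne : S.Nonempty := hA.nonempty
  have hpow : 2 ^ i ≤ 2 * k := hA.pow_le
  have hE1 : 1 ≤ estSum est :=
    (estSum_eq_zero_or_one_le est).resolve_left (estSum_pos hne).ne'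
  have hDt := sum_powerValue_ne_zero hne
  set E := estSum est with hE
  have hEs : ∑ j, (powerValue 2 (est j) : ℝ) = E := rfl
  set D := cost z (∑ j, X j) (centers S) with hDdef
  have hD0 : 0 ≤ D := cost_nonneg _ _
  set m := 2 ^ i with hm
  have hm0 : 0 < m := by positivity
  have hmR : (0 : ℝ) < m := by exact_mod_cast hm0
  have hkR : (0 : ℝ) < k := by exact_mod_cast hk
  set K := roundCharge k with hK
  have hKpos : 0 < K := roundCharge_pos
  set ρ := risk δ n k (i + 1) with hρ
  have hρ0 : 0 ≤ ρ := risk_nonneg hδ _ _ _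
  have hi : i ≤ Nat.log 2 (2 * k) := Nat.le_log_of_pow_le (by norm_num) hpow
  have hi' : (0 : ℝ) ≤ (Nat.log 2 (2 * k) : ℝ) - i := by
    have : (i : ℝ) ≤ Nat.log 2 (2 * k) := by exact_mod_cast hi
    linarith
  set S' : (Fin s → Msg s d Δ) → Finset (GridPoint d Δ) := fun ms => (afterBatch S est M i ms).S
    with hS'
  have hsub : ∀ ms, S ⊆ S' ms := fun ms => Finset.subset_union_left
  have hmem : ∀ ms j, ∀ y ∈ (ms j).getPoints, y ∈ S' ms := fun ms j y hy =>
    Finset.mem_union_right _ (Finset.mem_biUnion.2 ⟨j, Finset.mem_univ j, List.mem_toFinset.2 hy⟩)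
  -- The cost can only fall during the batch, so its old value gives a bound that does not depend on
  -- the answers.
  set y : ℝ := if k < 2 ^ (i + 1) ∧ E ≤ 64 * D then 2 else 0 with hy
  have hy0 : 0 ≤ y := by rw [hy]; split_ifs <;> norm_num
  -- This is what remains if all `m` answers are points; each rejection adds `256 / k`. It is
  -- nonnegative since `M + m ≤ N + 2 * 2 ^ i ≤ N + 4 * k`.
  set w : ℝ := 256 * (((N : ℝ) + 4 * k - M - m) / k) with hw
  have hw0 : 0 ≤ w := by
    have h1 : M + m ≤ N + 4 * k := by omega
    have h2 : (M : ℝ) + m ≤ N + 4 * k := by exact_mod_cast h1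
    exact mul_nonneg (by norm_num) (div_nonneg (by linarith) hkR.le)
  have hh := two_le_height hE1
  set c : ℝ := 5 + 4 * ((Nat.log 2 (2 * k) : ℝ) - i) +
    K * (height E + w - 2 + 2 * ρ + 2 * δ + y) with hc
  have hc0 : 0 ≤ c := by
    have : 0 ≤ K * (height E + w - 2 + 2 * ρ + 2 * δ + y) := mul_nonneg hKpos.le (by linarith)
    linarith
  set J : (Fin s → Msg s d Δ) → ℝ≥0∞ := fun ms =>
    if E ≤ 8 * cost z (∑ j, X j) (centers (S' ms)) then 1 else 0 with hJ
  have hpoint : ∀ ms : Fin s → Msg s d Δ, ∑ j, (ms j).answers.length = m →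
      roundsPotential z X k N n δ b (afterBatch S est M i ms) (r + 2) ≤
        ((r : ℝ≥0∞) + ENNReal.ofReal c) + (ENNReal.ofReal (256 * K / k) * (rejections ms : ℝ≥0∞) +
          ENNReal.ofReal (2 * δ * K) * J ms) := by
    intro ms hms
    have hrej := points_add_rejections ms
    rw [hms] at hrej
    have hrejR : ((∑ j, (ms j).getPoints.length : ℕ) : ℝ) = m - rejections ms := by
      have : ((∑ j, (ms j).getPoints.length : ℕ) : ℝ) + rejections ms = m := by exact_mod_cast hrej
      linarith
    have hJr : J ms = ENNReal.ofReal (if E ≤ 8 * cost z (∑ j, X j) (centers (S' ms)) then 1 else 0)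
        := by
      simp only [hJ]; split_ifs <;> simp
    set x : ℝ := if E ≤ 8 * cost z (∑ j, X j) (centers (S' ms)) then 1 else 0 with hx
    have hx0 : 0 ≤ x := by rw [hx]; split_ifs <;> norm_num
    rw [hJr, ← ENNReal.ofReal_natCast (rejections ms), ← ENNReal.ofReal_mul (by positivity),
      ← ENNReal.ofReal_mul (by positivity), ← ENNReal.ofReal_add (by positivity) (by positivity),
      add_assoc, ← ENNReal.ofReal_add hc0 (by positivity)]
    have h1 : progress k N E (afterBatch S est M i ms).M =
        height E + w + 256 * (rejections ms / k) := by
      unfold progress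
      simp only [afterBatch]
      push_cast at hrejR ⊢
      rw [hrejR, hw]
      field_simp
      ring
    have h2 : (if E ≤ 8 * cost z (∑ j, X j) (centers (S' ms)) then 2 * δ else 0) = 2 * δ * x := by
      rw [hx]; split_ifs <;> ring
    have h3 : (if k < 2 ^ (i + 1) ∧ E ≤ 64 * cost z (∑ j, X j) (centers (S' ms)) then (2 : ℝ)
        else 0) ≤ y := by
      rw [hy]
      by_cases h : k < 2 ^ (i + 1) ∧ E ≤ 64 * cost z (∑ j, X j) (centers (S' ms))
      · rw [if_pos h, if_pos ⟨h.1, h.2.trans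
          (by
          have := cost_anti (z := z) (by linarith) hSne (hsub ms) (∑ j, X j)
          linarith)⟩]
      · rw [if_neg h]; exact hy0
    have h4 : roundsPotential z X k N n δ b (afterBatch S est M i ms) (r + 2) =
      ((r + 2 : ℕ) : ℝ≥0∞) + ENNReal.ofReal (3 + 4 * ((Nat.log 2 (2 * k) : ℝ) - i) +
        K * (progress k N E (afterBatch S est M i ms).M - 2 + 2 * ρ + 2 * δ +
          (if E ≤ 8 * cost z (∑ j, X j) (centers (S' ms)) then 2 * δ else 0) +
          if k < 2 ^ (i + 1) ∧ E ≤ 64 * cost z (∑ j, X j) (centers (S' ms)) then 2 else 0)) := rfl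
    rw [h4, h2, h1]
    push_cast
    rw [add_assoc]
    refine add_le_add le_rfl ?_
    have h5 : K * (if k < 2 ^ (i + 1) ∧ E ≤ 64 * cost z (∑ j, X j) (centers (S' ms)) then (2 : ℝ)
        else 0) ≤ K * y := by gcongr
    rw [show (2 : ℝ≥0∞) = ENNReal.ofReal 2 by simp, ← ENNReal.ofReal_add (by norm_num)]
    · refine ENNReal.ofReal_le_ofReal ?_
      have h6 : 256 * K / k * (rejections ms : ℝ) = K * (256 * (rejections ms / k)) := by ring
      rw [h6, hc]
      linarith
    · have h7 : (0 : ℝ) ≤ if k < 2 ^ (i + 1) ∧ E ≤ 64 * cost z (∑ j, X j) (centers (S' ms)) then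
          (2 : ℝ) else 0 := by split_ifs <;> norm_num
      have h8 : (0 : ℝ) ≤ 256 * (rejections ms / k) := by positivity
      have h9 : 0 ≤ 2 * δ * x := by positivity
      have : 0 ≤ K * (height E + w + 256 * (rejections ms / k) - 2 + 2 * ρ + 2 * δ + 2 * δ * x +
        if k < 2 ^ (i + 1) ∧ E ≤ 64 * cost z (∑ j, X j) (centers (S' ms)) then
          (2 : ℝ) else 0) := mul_nonneg hKpos.le (by linarith)
      linarith
  have hJ1 : batchEx z X S (fun j => powerValue 2 (est j)) m J ≤
      ENNReal.ofReal (min 1 (8 * (n : ℝ) / 2 ^ i)) := by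
    rw [ENNReal.ofReal_min]
    refine le_min ?_ ?_
    · rw [ENNReal.ofReal_one]
      refine (batchEx_mono m (g := fun _ => 1) fun ms => ?_).trans (batchEx_const m 1).le
      simp only [hJ]; split_ifs <;> simp
    · refine (batchEx_mono m (g := fun ms => ENNReal.ofReal (8 / E) *
        ENNReal.ofReal (cost z (∑ j, X j) (centers (S' ms)))) fun ms => ?_).trans ?_
      · rw [← ENNReal.ofReal_mul (by positivity)]
        simp only [hJ]
        split_ifs with h
        · rw [ENNReal.one_le_ofReal, div_mul_eq_mul_div, one_le_div (by linarith)]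
          exact h
        · exact zero_le
      · rw [batchEx_mul_left]
        refine (mul_le_mul_right (batchEx_cost_le hz hSne hD hDt hm0 S' hsub hmem) _).trans ?_
        rw [← ENNReal.ofReal_mul (by positivity), hn]
        refine ENNReal.ofReal_le_ofReal (le_of_eq ?_)
        show 8 / E * ((n : ℝ) * (E / m)) = _
        have hE0 : E ≠ 0 := by linarith
        rw [hm]; push_cast
        field_simp
  have hrisk := risk_eq (δ := δ) (n := n) hi
  have hDE : D / E ≤ 1 := by
    rw [div_le_one (by linarith)]; exact cost_sum_le hD
  have hfinal : y ≤ 256 * (m * (D / E) / k) := by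
    rw [hy]
    split_ifs with h
    · have h1 : 1 / 64 ≤ D / E := by
        rw [div_le_div_iff₀ (by norm_num) (by linarith)]; linarith [h.2]
      have h2 : (k : ℝ) ≤ 2 * m := by
        have : k ≤ 2 * m := by have := h.1; rw [pow_succ] at this; omega
        exact_mod_cast this
      have h3 : (1 : ℝ) / 2 ≤ m / k := by
        rw [div_le_div_iff₀ (by norm_num) hkR]; linarith
      have h4 : (1 : ℝ) / 2 * (1 / 64) ≤ m / k * (D / E) :=
        mul_le_mul h3 h1 (by norm_num) (by positivity)
      calc (2 : ℝ) = 256 * (1 / 2 * (1 / 64)) := by norm_num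
        _ ≤ 256 * (m / k * (D / E)) := by gcongr
        _ = _ := by ring
    · exact mul_nonneg (by norm_num) (div_nonneg (mul_nonneg hmR.le
        (div_nonneg hD0 (by linarith))) hkR.le)
  refine (batchEx_mono_support m hpoint).trans ?_
  rw [batchEx_add, batchEx_const, batchEx_add, batchEx_mul_left, batchEx_mul_left,
    batchEx_rejections hD hDt]
  refine (add_le_add le_rfl (add_le_add le_rfl (mul_le_mul_right hJ1 _))).trans ?_
  have hq : 0 ≤ (m : ℝ) * (1 - D / E) := mul_nonneg hmR.le (by linarith)
  show (r : ℝ≥0∞) + ENNReal.ofReal c + (ENNReal.ofReal (256 * K / k) *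
    ENNReal.ofReal (m * (1 - D / E)) + _) ≤ r + ENNReal.ofReal (5 +
      4 * ((Nat.log 2 (2 * k) : ℝ) - i) + K * (progress k N E M - 2 + 2 * risk δ n k i + 2 * δ))
  rw [← ENNReal.ofReal_mul (by positivity), ← ENNReal.ofReal_mul (by positivity),
    ← ENNReal.ofReal_add (by positivity) (by positivity), add_assoc,
    ← ENNReal.ofReal_add hc0 (by positivity)]
  refine add_le_add le_rfl (ENNReal.ofReal_le_ofReal ?_)
  rw [hc, hrisk]
  have h1 : progress k N E M = height E + w + 256 * (m / k) := by
    unfold progress; rw [hw]; field_simp; ring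
  have h2 : 256 * K / k * (m * (1 - D / E)) = K * (256 * (m / k)) - K * (256 * (m * (D / E) / k)) := by
    ring
  have h3 : K * y ≤ K * (256 * (m * (D / E) / k)) := by gcongr
  rw [h1, h2]
  linarith

/-- The expected number of rounds. -/
lemma ex_rounds_le (hz : 1 ≤ z) (hk : 1 ≤ k) (hn : 1 ≤ n) (hX : ∑ j, (X j).card = n)
    (hδ : 0 ≤ δ) (hrisk : risk δ n k 1 + δ ≤ 1 / 2) {R : ℕ} (hR : (0.99 : ℝ) ^ R ≤ δ) {A : ℝ} (hA0 : 0 ≤ A)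
    (hA : ∀ S : Finset (GridPoint d Δ), S.Nonempty →
      height (estSum fun j => powerApprox 2 (cost z (X j) (centers S))) ≤ A) {E : ℕ}
    (hE : ∀ (S : Finset (GridPoint d Δ)) j r, S.Nonempty →
      powerApprox 2 (cost z (X j) (centers S)) = some r → r ≤ E) (t : ℕ) :
    ex ((lazyAdaptiveSampling s d Δ z k N R).run X t) (fun c => (c.rounds : ℝ≥0∞)) ≤
      ENNReal.ofReal (4 + roundCharge k * (A + 256 * (((N : ℝ) + 4 * k) / k))) := by
  set b := ENNReal.ofReal (4 + roundCharge k * (A + 256 * (((N : ℝ) + 4 * k) / k))) with hb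
  set P := lazyAdaptiveSampling s d Δ z k N R with hP
  set I : P.Config → Prop := fun c => ControlInv z X k N R c.state c.rounds ∧
    c.bits ≤ bitsBound k R n E c.state c.rounds with hI
  have hI0 : I ⟨P.start, 0, 0⟩ := ⟨⟨rfl, rfl⟩, Nat.zero_le _⟩
  have hIs := invariant_step (R := R) (N := N) hz hk hn hX hE
  have hK := roundCharge_pos (k := k)
  have hcard : (∑ j, X j).card = n := by rw [← hX]; exact map_sum Multiset.cardHom X _
  have hsetup : ∀ (S : Finset (GridPoint d Δ)) (i : ℕ), S.Nonempty →
      roundsPotential z X k N n δ b (afterRefresh z X N S 0 i) 4 ≤ b := by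
    intro S i hS
    refine (roundsPotential_loop_le hrisk b _ _).trans ?_
    have h0 := progress_nonneg (k := k) (N := N) (estSum_eq_zero_or_one_le
      fun j => powerApprox 2 (cost z (X j) (centers S))) (Nat.zero_le _)
    rw [← ENNReal.ofReal_natCast, ← ENNReal.ofReal_add (by norm_num) (mul_nonneg hK.le h0), hb]
    refine ENNReal.ofReal_le_ofReal (add_le_add (by norm_num)
      (mul_le_mul_of_nonneg_left ?_ hK.le))
    unfold progress
    rw [Nat.cast_zero, sub_zero]
    exact add_le_add (hA S hS) le_rfl
  have hstep : ∀ c, I c → ex (P.round X c) (extend z X k N R (roundsPotential z X k N n δ b)) ≤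
      extend z X k N R (roundsPotential z X k N n δ b) c := by
    refine ex_round_extend_le _ I (fun c hc => hc.1) (fun _ => b) (fun _ => le_rfl)
      (fun _ _ _ _ _ => rfl) (fun _ _ _ _ _ _ => rfl) (fun _ _ _ _ _ _ => rfl)
      (fun _ _ _ _ _ => rfl) hsetup ?_ ?_ ?_
    · intro S est M i r hact hM
      exact roundsPotential_batch hz hk hδ hcard b S est M i r hact hM
    · intro S est M i r hact hM
      have h1 : 2 ^ i ≤ 2 * k := hact.pow_le
      exact roundsPotential_l1 hz hδ hrisk hR b S est M i r hact (by rw [pow_succ] at hM; omega)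
    · intro S est M i r _ hM
      refine (roundsPotential_loop_le hrisk b _ _).trans ?_
      have h0 := progress_nonneg (k := k) (N := N) (estSum_eq_zero_or_one_le
        fun j => powerApprox 2 (cost z (X j) (centers S))) hM
      simp only [roundsPotential]
      rw [ENNReal.ofReal_add (by norm_num) (mul_nonneg hK.le h0), ENNReal.ofReal_one]
      push_cast
      rw [add_assoc]
  refine le_trans (ex_mono _ fun c hc => ?_) (P.ex_run_le X I hI0 hIs _ hstep t)
  have hinv := (P.invariant_run X I hI0 hIs t c hc).1
  obtain ⟨⟨phase, S, est, M, i⟩, bits, rounds⟩ := c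
  have hb3 : ∀ r : ℕ, r ≤ 3 → (r : ℝ≥0∞) ≤ b := by
    intro r hr
    rw [hb, ← ENNReal.ofReal_natCast]
    refine ENNReal.ofReal_le_ofReal ?_
    have h1 : (r : ℝ) ≤ 3 := by exact_mod_cast hr
    have h2 : 0 ≤ roundCharge k * (A + 256 * (((N : ℝ) + 4 * k) / k)) := by positivity
    linarith
  cases phase with
  | sizes => exact hb3 _ (Eq.trans_le hinv.2 (by norm_num))
  | chooseFirst size => exact hb3 _ (Eq.trans_le hinv.2.2 (by norm_num))
  | first j => exact hb3 _ (Eq.trans_le hinv.2.2 (by norm_num))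
  | report => exact hb3 _ (Eq.trans_le hinv.2.2.2 (by norm_num))
  | lazyRequest => exact le_self_add
  | l1Request => exact le_self_add
  | refresh => exact le_self_add
  | done => exact le_rfl
  -- In a reply state the extended potential is an expectation over the next round, where it is at
  -- least the number of rounds.
  | lazyReply l =>
    refine (ex_const (P.round X ⟨⟨.lazyReply l, S, est, M, i⟩, bits, rounds⟩) _).ge.trans
      (ex_mono _ fun c' hc' => ?_)
    obtain ⟨mc, -, ms, -, rfl⟩ := P.mem_support_round X rfl hc'
    refine le_trans ?_ le_self_add
    exact_mod_cast Nat.le_succ _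
  | l1Reply l =>
    refine (ex_const (P.round X ⟨⟨.l1Reply l, S, est, M, i⟩, bits, rounds⟩) _).ge.trans
      (ex_mono _ fun c' hc' => ?_)
    obtain ⟨mc, -, ms, -, rfl⟩ := P.mem_support_round X rfl hc'
    have h1 : (rounds : ℝ≥0∞) ≤ ((rounds + 1 : ℕ) : ℝ≥0∞) := by exact_mod_cast Nat.le_succ _
    refine h1.trans ?_
    show _ ≤ roundsPotential z X k N n δ b
      (PublicState.advance k N ⟨.l1Reply l, S, est, M, i⟩ mc ms) (rounds + 1)
    simp only [PublicState.advance, PublicState.outerLoop]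
    split_ifs
    · exact le_self_add
    · exact le_self_add
    · exact le_self_add
    · exact le_rfl

end roundsPotential

/-! ### The parameters -/

section parameters

lemma half_le_log_add_one {n : ℕ} (hn : 1 ≤ n) : 1 / 2 ≤ Real.log ((n : ℝ) + 1) := by
  have h1 : Real.log 2 ≤ Real.log ((n : ℝ) + 1) := by
    have : (1 : ℝ) ≤ n := by exact_mod_cast hn
    exact Real.log_le_log (by norm_num) (by linarith)
  linarith [Real.log_two_gt_d9]

lemma logb_two_le {x : ℝ} (hx : 1 ≤ x) : Real.logb 2 x ≤ 2 * Real.log x := by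
  have h := Real.log_two_gt_d9
  rw [Real.logb, div_le_iff₀ (by linarith)]
  nlinarith [Real.log_nonneg hx]

lemma natLog_two_le {m : ℕ} (hm : 1 ≤ m) : (Nat.log 2 m : ℝ) ≤ 2 * Real.log m := by
  have hm' : (1 : ℝ) ≤ m := by exact_mod_cast hm
  refine le_trans ?_ (logb_two_le hm')
  have := Real.natLog_le_logb m 2
  exact_mod_cast this

lemma size_le_log (m : ℕ) : (Nat.size m : ℝ) ≤ 1 + 2 * Real.log ((m : ℝ) + 1) := by
  have h1 : Nat.size m ≤ Nat.log 2 (m + 1) + 1 :=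
    Nat.size_le.2 ((Nat.lt_succ_self m).trans (Nat.lt_pow_succ_log_self (by norm_num) _))
  have h2 : (Nat.size m : ℝ) ≤ Nat.log 2 (m + 1) + 1 := by exact_mod_cast h1
  have h3 := natLog_two_le (Nat.le_add_left 1 m)
  push_cast at h3
  linarith

lemma roundCharge_le {k : ℕ} (hk : 1 ≤ k) : roundCharge k ≤ 26 * Real.log ((k : ℝ) + 1) := by
  have h1 := natLog_two_le (m := 2 * k) (by omega)
  have hk' : (1 : ℝ) ≤ k := by exact_mod_cast hk
  have h2 : Real.log ((2 * k : ℕ) : ℝ) = Real.log 2 + Real.log k := by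
    push_cast; rw [Real.log_mul (by norm_num) (by linarith)]
  have h3 : Real.log k ≤ Real.log ((k : ℝ) + 1) := Real.log_le_log (by linarith) (by linarith)
  have h4 : Real.log 2 ≤ Real.log ((k : ℝ) + 1) := Real.log_le_log (by norm_num) (by linarith)
  have h5 := half_le_log_add_one hk
  unfold roundCharge
  linarith

lemma l1Delta_pos {c : ℝ} (hc : 0 < c) {n : ℕ} (hn : 1 ≤ n) : 0 < l1Delta c n := by
  have := half_le_log_add_one hn
  unfold l1Delta
  positivity

/-- As `0.99 ≤ exp (-0.01)`, the factor `100` in the number of repetitions is enough. -/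
lemma pow_l1Reps_le {δ : ℝ} (hδ : 0 < δ) : (0.99 : ℝ) ^ l1Reps 100 δ ≤ δ := by
  have h1 : 100 * Real.log (1 / δ) ≤ l1Reps 100 δ := Nat.le_ceil _
  have h2 : (0.99 : ℝ) ≤ Real.exp (-0.01) := by
    have := Real.add_one_le_exp (-0.01 : ℝ)
    linarith
  calc (0.99 : ℝ) ^ l1Reps 100 δ ≤ Real.exp (-0.01) ^ l1Reps 100 δ := by gcongr
    _ = Real.exp (l1Reps 100 δ * -0.01) := by rw [← Real.exp_nat_mul]
    _ ≤ Real.exp (Real.log δ) := by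
        rw [one_div, Real.log_inv] at h1
        exact Real.exp_le_exp.2 (by linarith)
    _ = δ := Real.exp_log hδ

/-- With `L = log (n + 1) ≥ 1 / 2`, the left side is at most `16 * L * δ = 1 / (5 * L) ≤ 2 / 5`. -/
lemma risk_l1Delta_le {n : ℕ} (hn : 1 ≤ n) (k : ℕ) :
    risk (l1Delta (1 / 80) n) n k 1 + l1Delta (1 / 80) n ≤ 1 / 2 := by
  have hn' : (1 : ℝ) ≤ n := by exact_mod_cast hn
  have hδ := l1Delta_pos (c := 1 / 80) (by norm_num) hn
  have hL := half_le_log_add_one hn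
  have h1 := risk_le hδ.le k 1 (Nat.lt_pow_succ_log_self (b := 2) (by norm_num) (8 * n)).le
  have h2 := natLog_two_le (m := 8 * n) (by omega)
  have h3 : Real.log ((8 * n : ℕ) : ℝ) = 3 * Real.log 2 + Real.log n := by
    push_cast
    rw [Real.log_mul (by norm_num) (by linarith), show (8 : ℝ) = 2 ^ 3 by norm_num, Real.log_pow]
    norm_num
  have h4 : Real.log n ≤ Real.log ((n : ℝ) + 1) := Real.log_le_log (by linarith) (by linarith)
  have h5 : Real.log 2 ≤ Real.log ((n : ℝ) + 1) := Real.log_le_log (by norm_num) (by linarith)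
  push_cast at h1
  set L := Real.log ((n : ℝ) + 1) with hLdef
  have h6 : (Nat.log 2 (8 * n) : ℝ) + 1 + 2 + 1 ≤ 16 * L := by linarith
  have h7 : l1Delta (1 / 80) n * ((Nat.log 2 (8 * n) : ℝ) + 1 + 2 + 1) ≤
      l1Delta (1 / 80) n * (16 * L) := by gcongr
  have h8 : l1Delta (1 / 80) n * (16 * L) = 1 / 5 / L := by
    unfold l1Delta
    rw [← hLdef]
    have : L ≠ 0 := by linarith
    field_simp
    norm_num
  have h9 : 1 / 5 / L ≤ 1 / 2 := by
    rw [div_le_iff₀ (by linarith)]; linarith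
  linarith

/-- Since `log (1 / δ) = log 80 + 2 * log (log (n + 1)) ≤ 7 + 2 * l`, the ceiling is at most `700 +
200 * l + 1`, and `1 ≤ 2 * l` gives `1602`. -/
lemma l1Reps_l1Delta_le {n : ℕ} (hn : 1 ≤ n) {l : ℝ} (hl : 1 / 2 ≤ l)
    (hln : Real.log (Real.log ((n : ℝ) + 1)) ≤ l) :
    (l1Reps 100 (l1Delta (1 / 80) n) : ℝ) ≤ 1602 * l := by
  have hL := half_le_log_add_one hn
  set L := Real.log ((n : ℝ) + 1) with hLdef
  have h80 : Real.log 80 ≤ 7 := by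
    have h1 : Real.log 80 ≤ Real.log (2 ^ 7) := Real.log_le_log (by norm_num) (by norm_num)
    rw [Real.log_pow] at h1
    push_cast at h1
    linarith [Real.log_two_lt_d9]
  have h1 : Real.log (1 / l1Delta (1 / 80) n) = Real.log 80 + 2 * Real.log L := by
    unfold l1Delta
    rw [← hLdef, show 1 / (1 / 80 / L ^ 2) = 80 * L ^ 2 by
      have : L ≠ 0 := by linarith
      field_simp, Real.log_mul (by norm_num) (by positivity), Real.log_pow]
    norm_num
  have h2 : 0 ≤ 100 * (Real.log 80 + 2 * Real.log L) := by
    have h3 : Real.log (1 / 80) ≤ Real.log (L ^ 2) :=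
      Real.log_le_log (by norm_num) (by nlinarith)
    rw [Real.log_pow, one_div, Real.log_inv] at h3
    push_cast at h3
    linarith
  unfold l1Reps
  rw [h1]
  have h3 := (Nat.ceil_lt_add_one h2).le
  linarith

end parameters

/-! ### Bounds in terms of the number of points -/

section inputSize
variable {s d Δ n a : ℕ} {z : ℝ} {X : Fin s → Multiset (GridPoint d Δ)}

/-- The degree of a polynomial in `n + 1` that bounds the costs. -/
def costDegree (z : ℝ) (a : ℕ) : ℝ := 1 + 2 * a * z

lemma cost_le_rpow (hz : 1 ≤ z) (hΔ : Δ ≤ (n + 1) ^ a) (hd : d ≤ (n + 1) ^ a)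
    {S : Finset (GridPoint d Δ)} (hS : S.Nonempty) {Y : Multiset (GridPoint d Δ)}
    (hY : Y.card ≤ n) : cost z Y (centers S) ≤ ((n : ℝ) + 1) ^ costDegree z a := by
  have hn0 : (0 : ℝ) < (n : ℝ) + 1 := by positivity
  have hΔ' : (Δ : ℝ) ≤ ((n : ℝ) + 1) ^ a := by exact_mod_cast hΔ
  have hd' : (d : ℝ) ≤ ((n : ℝ) + 1) ^ a := by exact_mod_cast hd
  have hY' : (Y.card : ℝ) ≤ n := by exact_mod_cast hY
  have hpow : ((d : ℝ) * Δ) ^ z ≤ ((n : ℝ) + 1) ^ (2 * a * z) := by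
    have h1 : (d : ℝ) * Δ ≤ ((n : ℝ) + 1) ^ (2 * a) := by
      rw [two_mul, pow_add]; gcongr
    refine (Real.rpow_le_rpow (by positivity) h1 (by linarith)).trans (le_of_eq ?_)
    rw [Real.rpow_mul hn0.le, ← Real.rpow_natCast]
    push_cast
    rfl
  calc cost z Y (centers S) ≤ Y.card * ((d : ℝ) * Δ) ^ z := cost_le_of_nonempty (by linarith) hS Y
    _ ≤ ((n : ℝ) + 1) * ((n : ℝ) + 1) ^ (2 * a * z) := by
        gcongr
        linarith
    _ = _ := by
        unfold costDegree
        rw [Real.rpow_add hn0, Real.rpow_one]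

lemma one_le_costDegree (hz : 1 ≤ z) (a : ℕ) : 1 ≤ costDegree z a := by
  unfold costDegree
  have : 0 ≤ 2 * (a : ℝ) * z := by positivity
  linarith

/-- A bound on the exponents. -/
def maxExponent (z : ℝ) (a n : ℕ) : ℕ := ⌈costDegree z a * Real.logb 2 ((n : ℝ) + 1)⌉₊

lemma maxExponent_le (hz : 1 ≤ z) (hn : 1 ≤ n) :
    (maxExponent z a n : ℝ) ≤ 4 * costDegree z a * Real.log ((n : ℝ) + 1) := by
  have h0 := one_le_costDegree hz a
  have hn' : (1 : ℝ) ≤ n := by exact_mod_cast hn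
  have h1 := logb_two_le (x := (n : ℝ) + 1) (by linarith)
  have h2 := half_le_log_add_one hn
  have h3 : 0 ≤ costDegree z a * Real.logb 2 ((n : ℝ) + 1) :=
    mul_nonneg (by linarith) (Real.logb_nonneg (by norm_num) (by linarith))
  have h4 := (Nat.ceil_lt_add_one h3).le
  unfold maxExponent
  nlinarith

lemma le_maxExponent (hz : 1 ≤ z) (hΔ : Δ ≤ (n + 1) ^ a) (hd : d ≤ (n + 1) ^ a)
    {S : Finset (GridPoint d Δ)} (hS : S.Nonempty) {Y : Multiset (GridPoint d Δ)}
    (hY : Y.card ≤ n) {r : ℕ} (hr : powerApprox 2 (cost z Y (centers S)) = some r) :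
    r ≤ maxExponent z a n := by
  unfold powerApprox at hr
  split_ifs at hr with h0
  have hpos : 0 < cost z Y (centers S) := lt_of_le_of_ne (cost_nonneg _ _) (Ne.symm h0)
  have hn0 : (0 : ℝ) < (n : ℝ) + 1 := by positivity
  rw [← Option.some.inj hr]
  refine Nat.ceil_mono ?_
  have h1 := Real.logb_le_logb_of_le (b := 2) (by norm_num) hpos (cost_le_rpow hz hΔ hd hS hY)
  rwa [Real.logb_rpow_eq_mul_logb_of_pos hn0] at h1

lemma height_estSum_le (hz : 1 ≤ z) (hn : 1 ≤ n) (hΔ : Δ ≤ (n + 1) ^ a) (hd : d ≤ (n + 1) ^ a)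
    {S : Finset (GridPoint d Δ)} (hS : S.Nonempty) (hX : ∑ j, (X j).card = n) :
    height (estSum fun j => powerApprox 2 (cost z (X j) (centers S))) ≤
      (6 + 2 * costDegree z a) * Real.log ((n : ℝ) + 1) := by
  have hn' : (1 : ℝ) ≤ n := by exact_mod_cast hn
  have hn0 : (0 : ℝ) < (n : ℝ) + 1 := by positivity
  have h0 := one_le_costDegree hz a
  have hL := half_le_log_add_one hn
  have hcard : (∑ j, X j).card ≤ n := by rw [← hX]; exact (map_sum Multiset.cardHom X _).le
  have h1 : estSum (fun j => powerApprox 2 (cost z (X j) (centers S))) ≤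
      2 * ((n : ℝ) + 1) ^ costDegree z a := by
    refine le_trans ?_ (mul_le_mul_of_nonneg_left (cost_le_rpow hz hΔ hd hS hcard) zero_le_two)
    rw [cost_sum, Finset.mul_sum]
    exact Finset.sum_le_sum fun j _ => powerValue_le_two_mul (cost_eq_zero_or_one_le hz hS _)
  have h2 : (1 : ℝ) ≤ 2 * ((n : ℝ) + 1) ^ costDegree z a := by
    have := Real.one_le_rpow (x := (n : ℝ) + 1) (z := costDegree z a) (by linarith) (by linarith)
    linarith
  refine (height_mono (estSum_eq_zero_or_one_le _) (Or.inr h2) h1).trans ?_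
  unfold height
  rw [if_neg (by linarith), Real.logb_mul (by norm_num) (by positivity),
    Real.logb_self_eq_one (by norm_num), Real.logb_rpow_eq_mul_logb_of_pos hn0]
  have h3 := logb_two_le (x := (n : ℝ) + 1) (by linarith)
  have h4 : costDegree z a * Real.logb 2 ((n : ℝ) + 1) ≤
      costDegree z a * (2 * Real.log ((n : ℝ) + 1)) := by gcongr
  linarith

/-- The constant in the bound on the expected number of rounds. -/
def roundsConst (z : ℝ) (a cN : ℕ) : ℝ := 16 + 26 * (6 + 2 * costDegree z a + 512 * (cN + 4))

lemma rounds_bound_le (hz : 1 ≤ z) (hn : 1 ≤ n) {k : ℕ} (hk : 1 ≤ k) (cN : ℕ) :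
    4 + roundCharge k * ((6 + 2 * costDegree z a) * Real.log ((n : ℝ) + 1) +
      256 * ((((cN * k : ℕ) : ℝ) + 4 * k) / k)) ≤
    roundsConst z a cN * (Real.log ((n : ℝ) + 1) * Real.log ((k : ℝ) + 1)) := by
  have h0 := one_le_costDegree hz a
  have hk' : (0 : ℝ) < k := by exact_mod_cast hk
  have h1 : (((cN * k : ℕ) : ℝ) + 4 * k) / k = cN + 4 := by push_cast; field_simp
  rw [h1]
  have hL := half_le_log_add_one hn
  have hK := half_le_log_add_one hk
  have h2 := roundCharge_le hk
  set L := Real.log ((n : ℝ) + 1)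
  set K := Real.log ((k : ℝ) + 1)
  have h3 : (6 + 2 * costDegree z a) * L + 256 * ((cN : ℝ) + 4) ≤
      (6 + 2 * costDegree z a + 512 * (cN + 4)) * L := by
    have : 256 * ((cN : ℝ) + 4) * 1 ≤ 256 * ((cN : ℝ) + 4) * (2 * L) := by
      gcongr; linarith
    linarith
  have h4 : roundCharge k * ((6 + 2 * costDegree z a) * L + 256 * ((cN : ℝ) + 4)) ≤
      (26 * K) * ((6 + 2 * costDegree z a + 512 * (cN + 4)) * L) :=
    mul_le_mul h2 h3 (by positivity) (by positivity)
  have h5 : (4 : ℝ) ≤ 16 * (L * K) := by nlinarith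
  unfold roundsConst
  linarith

lemma pointBits_le (hn : 1 ≤ n) (hΔ : Δ ≤ (n + 1) ^ a) :
    (pointBits d Δ : ℝ) ≤ (4 * a + 10) * (d * Real.log ((n : ℝ) + 1)) := by
  have hL := half_le_log_add_one hn
  have h1 := size_le_log Δ
  have h2 : (Δ : ℝ) + 1 ≤ ((n : ℝ) + 1) ^ (a + 1) := by
    have h3 : Δ + 1 ≤ (n + 1) ^ (a + 1) := by
      have : 1 ≤ (n + 1) ^ a := Nat.one_le_pow _ _ (by omega)
      rw [pow_succ]
      nlinarith
    exact_mod_cast h3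
  have h3 := Real.log_le_log (by positivity) h2
  rw [Real.log_pow] at h3
  push_cast at h3
  unfold pointBits
  push_cast
  set L := Real.log ((n : ℝ) + 1)
  have h4 : 2 * (Nat.size Δ : ℝ) + 1 ≤ (4 * a + 10) * L := by linarith
  calc (d : ℝ) * (2 * (Nat.size Δ : ℝ) + 1) ≤ d * ((4 * a + 10) * L) := by gcongr
    _ = _ := by ring

/-- The quantity that measures the communication. -/
def commSize (s d k n : ℕ) : ℝ := s * Real.log (n + 1) + k * d * Real.log (n + 1)

/-- The constant in the bound on the number of bits of a round. -/
def roundBitsConst (z : ℝ) (a : ℕ) : ℝ := 22600 + 64 * costDegree z a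

section commSize
variable {k : ℕ}

lemma mul_log_le_commSize (hn : 1 ≤ n) : s * Real.log ((n : ℝ) + 1) ≤ commSize s d k n := by
  have hL := half_le_log_add_one hn
  unfold commSize
  have : 0 ≤ k * d * Real.log ((n : ℝ) + 1) := by positivity
  linarith

lemma mul_mul_log_le_commSize (hn : 1 ≤ n) :
    k * d * Real.log ((n : ℝ) + 1) ≤ commSize s d k n := by
  have hL := half_le_log_add_one hn
  unfold commSize
  have : 0 ≤ s * Real.log ((n : ℝ) + 1) := by positivity
  linarith

lemma log_le_commSize (hn : 1 ≤ n) (hs : 1 ≤ s) : Real.log ((n : ℝ) + 1) ≤ commSize s d k n := by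
  refine le_trans ?_ (mul_log_le_commSize hn)
  have hL := half_le_log_add_one hn
  have hs' : (1 : ℝ) ≤ s := by exact_mod_cast hs
  nlinarith

lemma half_le_log_commSize (hn : 1 ≤ n) (hs : 1 ≤ s) :
    1 / 2 ≤ Real.log (commSize s d k n + 2) := by
  have h1 := log_le_commSize (d := d) (k := k) hn hs
  have hL := half_le_log_add_one hn
  have h2 : Real.log 2 ≤ Real.log (commSize s d k n + 2) :=
    Real.log_le_log (by norm_num) (by linarith)
  linarith [Real.log_two_gt_d9]

lemma log_add_one_le {m : ℕ} {F : ℝ} (h : m * (1 / 2 : ℝ) ≤ F) :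
    Real.log ((m : ℝ) + 1) ≤ 2 * Real.log (F + 2) := by
  have h0 : (0 : ℝ) ≤ m := Nat.cast_nonneg _
  have h1 : (m : ℝ) + 1 ≤ (F + 2) ^ 2 := by nlinarith
  have h2 := Real.log_le_log (by linarith) h1
  rw [Real.log_pow] at h2
  exact_mod_cast h2

/-- Site indices have `O(log s)` bits, exponents are `O(log n)` and thus have `O(log log n)` bits,
and `R = O(log log n)`. All of these are `O(l)` for `l = log (F + 2)`, and constants are absorbed by
`l ≥ 1 / 2`. -/
lemma roundBits_le (hz : 1 ≤ z) (hn : 1 ≤ n) (hs : 1 ≤ s) :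
    (roundBits s d k (l1Reps 100 (l1Delta (1 / 80) n)) (maxExponent z a n) : ℝ) ≤
      roundBitsConst z a * ((k * d + s) * Real.log (commSize s d k n + 2) ^ 2) := by
  have hL := half_le_log_add_one hn
  have h1 := log_le_commSize (d := d) (k := k) hn hs
  have hl := half_le_log_commSize (d := d) (k := k) hn hs
  have hF := mul_log_le_commSize (s := s) (d := d) (k := k) hn
  have hs' : (1 : ℝ) ≤ s := by exact_mod_cast hs
  have hcd := one_le_costDegree hz a
  have hE := maxExponent_le (a := a) hz hn
  have hR := l1Reps_l1Delta_le hn hl (Real.log_le_log (by linarith)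
    (h1.trans (by linarith : commSize s d k n ≤ commSize s d k n + 2)))
  set F := commSize s d k n
  set L := Real.log ((n : ℝ) + 1)
  set l := Real.log (F + 2)
  set e := costDegree z a
  have hsize : (Nat.size s : ℝ) ≤ 6 * l := by
    have h2 := size_le_log s
    have h3 := log_add_one_le (m := s) (F := F) (le_trans (by gcongr) hF)
    linarith
  have hsizeE : (Nat.size (maxExponent z a n) : ℝ) ≤ (4 + 16 * e) * l := by
    have h2 := size_le_log (maxExponent z a n)
    have h3 : (maxExponent z a n : ℝ) + 1 ≤ (4 * e + 1) * (F + 2) := by nlinarith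
    have h4 := Real.log_le_log (by positivity) h3
    rw [Real.log_mul (by linarith) (by linarith)] at h4
    have h5 : Real.log (4 * e + 1) ≤ 4 * e := by
      have := Real.log_le_sub_one_of_pos (x := 4 * e + 1) (by linarith)
      linarith
    have h6 : 8 * e * 1 ≤ 8 * e * (2 * l) := by gcongr; linarith
    have h7 : Real.log (F + 2) = l := rfl
    linarith
  unfold roundBits roundBitsConst
  push_cast
  have hkd : (0 : ℝ) ≤ k * d := by positivity
  have h2 : (2 * (k : ℝ) * d + 1 + (l1Reps 100 (l1Delta (1 / 80) n) : ℝ)) *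
      (2 * (Nat.size s : ℝ) + 1) ≤ (2 * k * d + 1604 * l) * (14 * l) :=
    mul_le_mul (by linarith) (by linarith) (by positivity) (by positivity)
  have h3 : (s : ℝ) * (2 * (Nat.size (maxExponent z a n) : ℝ) + 3) ≤ s * ((14 + 32 * e) * l) := by
    gcongr; linarith
  have hll : l ≤ 2 * l ^ 2 := by nlinarith
  have h1l : 1 ≤ 4 * l ^ 2 := by nlinarith
  have h4 : (k * d : ℝ) * l ≤ k * d * (2 * l ^ 2) := by gcongr
  have h5 : (k * d : ℝ) * 1 ≤ k * d * (4 * l ^ 2) := by gcongr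
  have h6 : s * ((14 + 32 * e) * l) ≤ s * ((14 + 32 * e) * (2 * l ^ 2)) := by gcongr
  have h7 : 1 * l ^ 2 ≤ s * l ^ 2 := by gcongr
  have h8 : 0 ≤ (k * d : ℝ) * l ^ 2 := by positivity
  have h9 : 0 ≤ (k * d : ℝ) * l ^ 2 * e := by positivity
  linarith

/-- The constant in the bound on the number of bits. -/
def bitsConst (z : ℝ) (a cN : ℕ) (C : ℝ) : ℝ :=
  (2 * C + 16) * roundBitsConst z a + 8 * ((cN + 4) * (4 * a + 10) + 10 + (4 * a + 10))

/-- With `L = log (n + 1)`, `O(L * l)` rounds of `O((k * d + s) * l ^ 2)` bits give `O(F * l ^ 3)`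
because `(k * d + s) * L = F`; this is the origin of the exponent `3`. Sampled points and dataset
sizes add only `O(F)`. -/
lemma bits_le (hz : 1 ≤ z) (hn : 1 ≤ n) (hs : 1 ≤ s) (hk : 1 ≤ k) (hΔ : Δ ≤ (n + 1) ^ a)
    {cN M rounds bits : ℕ} {C : ℝ} (hC : 0 ≤ C)
    (hd : 0 < d ∨ rounds ≤ 4) (hM : M ≤ (cN + 4) * k)
    (hr : (rounds : ℝ) ≤ C * (Real.log ((n : ℝ) + 1) * Real.log ((k : ℝ) + 1)))
    (hb : bits ≤ rounds * roundBits s d k (l1Reps 100 (l1Delta (1 / 80) n)) (maxExponent z a n) +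
      M * pointBits d Δ + (s * (2 * Nat.size n + 1) + pointBits d Δ)) :
    (bits : ℝ) ≤ bitsConst z a cN C *
      (commSize s d k n * Real.log (commSize s d k n + 2) ^ 3) := by
  have hL := half_le_log_add_one hn
  have hl := half_le_log_commSize (d := d) (k := k) hn hs
  have hF := mul_log_le_commSize (s := s) (d := d) (k := k) hn
  have hF2 := mul_mul_log_le_commSize (s := s) (d := d) (k := k) hn
  have hk' : (1 : ℝ) ≤ k := by exact_mod_cast hk
  have hcd := one_le_costDegree hz a
  have hrb := roundBits_le (a := a) (d := d) (k := k) hz hn hs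
  have hp := pointBits_le (d := d) (Δ := Δ) hn hΔ
  have hFL : (k * d + s) * Real.log ((n : ℝ) + 1) = commSize s d k n := by unfold commSize; ring
  have hsn := size_le_log n
  have hF0 : 0 ≤ commSize s d k n := le_trans (by positivity) hF
  set rb := roundBits s d k (l1Reps 100 (l1Delta (1 / 80) n)) (maxExponent z a n)
  set F := commSize s d k n with hFdef
  set L := Real.log ((n : ℝ) + 1)
  set l := Real.log (F + 2) with hldef
  set B := roundBitsConst z a with hB
  have hB0 : 0 ≤ B := by rw [hB]; unfold roundBitsConst; linarith
  have hr' : (rounds : ℝ) ≤ (2 * C + 16) * (L * l) := by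
    have hLl : 0 ≤ L * l := by positivity
    -- For `0 < d` the quantity `F` dominates `k / 2`, so `log (k + 1) ≤ 2 * l`; otherwise there are
    -- at most four rounds.
    rcases hd with hd | hd
    · have hd' : (1 : ℝ) ≤ d := by exact_mod_cast hd
      have h1 : (k : ℝ) * (1 / 2) ≤ F := by
        refine le_trans ?_ hF2
        have : (k : ℝ) * 1 * (1 / 2) ≤ k * d * L := by gcongr
        linarith
      have h2 := log_add_one_le h1
      have h3 : C * (L * Real.log ((k : ℝ) + 1)) ≤ C * (L * (2 * l)) := by gcongr
      linarith
    · have h1 : (rounds : ℝ) ≤ 4 := by exact_mod_cast hd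
      have h2 : (1 : ℝ) / 2 * (1 / 2) ≤ L * l := mul_le_mul hL hl (by norm_num) (by linarith)
      have h3 : 0 ≤ C * (L * l) := by positivity
      linarith
  have h1 : (rounds : ℝ) * rb ≤ (2 * C + 16) * (L * l) * (B * ((k * d + s) * l ^ 2)) :=
    mul_le_mul hr' hrb (by positivity) (by positivity)
  have h2 : (2 * C + 16) * (L * l) * (B * ((k * d + s) * l ^ 2)) =
      (2 * C + 16) * B * (F * l ^ 3) := by rw [← hFL]; ring
  have hM' : (M : ℝ) ≤ (cN + 4) * k := by exact_mod_cast hM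
  have h3 : (M : ℝ) * pointBits d Δ ≤ (cN + 4) * k * ((4 * a + 10) * (d * L)) :=
    mul_le_mul hM' hp (by positivity) (by positivity)
  have h4 : (cN + 4 : ℝ) * k * ((4 * a + 10) * (d * L)) ≤ (cN + 4) * (4 * a + 10) * F := by
    calc (cN + 4 : ℝ) * k * ((4 * a + 10) * (d * L)) =
        (cN + 4) * (4 * a + 10) * (k * d * L) := by ring
      _ ≤ _ := by gcongr
  have h5 : (s : ℝ) * (2 * (Nat.size n : ℝ) + 1) ≤ 10 * F := by
    calc (s : ℝ) * (2 * (Nat.size n : ℝ) + 1) ≤ s * (10 * L) := by gcongr; linarith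
      _ = 10 * (s * L) := by ring
      _ ≤ _ := by gcongr
  have h6 : (pointBits d Δ : ℝ) ≤ (4 * a + 10) * F := by
    refine hp.trans ?_
    gcongr
    refine le_trans ?_ hF2
    have : 1 * ((d : ℝ) * L) ≤ k * (d * L) := by gcongr
    linarith
  have h7 : F * 1 ≤ F * (8 * l ^ 3) := by
    have h8 : (1 / 2 : ℝ) ^ 3 ≤ l ^ 3 := by gcongr
    gcongr
    linarith
  have hb' : (bits : ℝ) ≤ rounds * rb + M * pointBits d Δ +
      (s * (2 * Nat.size n + 1) + pointBits d Δ) := by exact_mod_cast hb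
  have h8 : ((cN + 4) * (4 * a + 10) + 10 + (4 * a + 10) : ℝ) * (F * 1) ≤
      ((cN + 4) * (4 * a + 10) + 10 + (4 * a + 10)) * (F * (8 * l ^ 3)) := by gcongr
  unfold bitsConst
  rw [← hB]
  linarith

end commSize

end inputSize

/-! ### The guarantees of the algorithm -/

section guarantees

lemma BlackboardProtocol.prob_le_one {s : ℕ} {Input Output : Type}
    (P : BlackboardProtocol s Input Output) (X : Fin s → Input) (E : Output → ℕ → ℕ → Prop) :
    P.prob X E ≤ 1 := by
  refine iSup_le fun t => ?_
  rw [toOuterMeasure_eq_ex]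
  refine ex_le_const _ fun c _ => ?_
  exact Set.indicator_apply_le' (fun _ => le_rfl) fun _ => zero_le

lemma ofReal_le_of_one_le_add {p : ℝ≥0∞} {x y : ℝ} (hy : 0 ≤ y) (hxy : x + y ≤ 1)
    (h : 1 ≤ p + ENNReal.ofReal y) : ENNReal.ofReal x ≤ p := by
  refine le_trans ?_ (tsub_le_iff_right.2 h)
  rw [← ENNReal.ofReal_one, ← ENNReal.ofReal_sub _ hy]
  exact ENNReal.ofReal_le_ofReal (by linarith)

variable {s d Δ k n a cN : ℕ} {z : ℝ} {X : Fin s → Multiset (GridPoint d Δ)}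

lemma le_maxExponent_of_sum (hz : 1 ≤ z) (hΔ : Δ ≤ (n + 1) ^ a) (hd : d ≤ (n + 1) ^ a)
    (hX : ∑ j, (X j).card = n) (S : Finset (GridPoint d Δ)) (j : Fin s) (r : ℕ) (hS : S.Nonempty)
    (hr : powerApprox 2 (cost z (X j) (centers S)) = some r) : r ≤ maxExponent z a n :=
  le_maxExponent hz hΔ hd hS (hX ▸ Finset.single_le_sum (f := fun j => (X j).card)
    (fun _ _ => Nat.zero_le _) (Finset.mem_univ j)) hr

variable [NeZero s]

/-- The algorithm with the parameters `cδ = 1 / 80` and `cR = 100`. -/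
abbrev tunedSampling (s d Δ : ℕ) [NeZero s] (z : ℝ) (k n cN : ℕ) :
    BlackboardProtocol s (Multiset (GridPoint d Δ)) (Finset (GridPoint d Δ)) :=
  lazyAdaptiveSampling s d Δ z k (cN * k) (l1Reps 100 (l1Delta (1 / 80) n))

lemma ex_rounds_tunedSampling_le (hz : 1 ≤ z) (hk : 1 ≤ k) (hn : 1 ≤ n) (hΔ : Δ ≤ (n + 1) ^ a)
    (hd : d ≤ (n + 1) ^ a) (hX : ∑ j, (X j).card = n) (t : ℕ) :
    ex ((tunedSampling s d Δ z k n cN).run X t) (fun c => (c.rounds : ℝ≥0∞)) ≤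
      ENNReal.ofReal (roundsConst z a cN *
        (Real.log ((n : ℝ) + 1) * Real.log ((k : ℝ) + 1))) := by
  have hδ := l1Delta_pos (c := 1 / 80) (by norm_num) hn
  have h0 := one_le_costDegree hz a
  have hL := half_le_log_add_one hn
  exact (ex_rounds_le (A := (6 + 2 * costDegree z a) * Real.log ((n : ℝ) + 1)) hz hk hn hX hδ.le
    (risk_l1Delta_le hn k) (pow_l1Reps_le hδ) (by positivity)
    (fun S hS => height_estSum_le hz hn hΔ hd hS hX) (le_maxExponent_of_sum hz hΔ hd hX) t).trans
    (ENNReal.ofReal_le_ofReal (rounds_bound_le hz hn hk cN))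

/-- What holds when the algorithm has ended. -/
lemma output_tunedSampling (hz : 1 ≤ z) (hk : 1 ≤ k) (hn : 1 ≤ n) (hΔ : Δ ≤ (n + 1) ^ a)
    (hd : d ≤ (n + 1) ^ a) (hX : ∑ j, (X j).card = n) {t : ℕ}
    {c : (tunedSampling s d Δ z k n cN).Config}
    (hc : c ∈ ((tunedSampling s d Δ z k n cN).run X t).support) {o : Finset (GridPoint d Δ)}
    (ho : (tunedSampling s d Δ z k n cN).output c.state = some o) :
    o.card ≤ (cN + 5) * k ∧ (0 < d ∨ c.rounds ≤ 4) ∧ ∃ M ≤ (cN + 4) * k, c.bits ≤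
      c.rounds * roundBits s d k (l1Reps 100 (l1Delta (1 / 80) n)) (maxExponent z a n) +
        M * pointBits d Δ + (s * (2 * Nat.size n + 1) + pointBits d Δ) := by
  have hinv := (tunedSampling s d Δ z k n cN).invariant_run X _ ⟨⟨rfl, rfl⟩, Nat.zero_le _⟩
    (invariant_step hz hk hn hX (le_maxExponent_of_sum hz hΔ hd hX)) t c hc
  obtain ⟨⟨phase, S, est, M, i⟩, bits, rounds⟩ := c
  obtain ⟨hph, hoS⟩ := phase_of_output ho
  simp only at hph hoS
  subst hph hoS
  obtain ⟨⟨hs, hM, -, hd4⟩, hbits⟩ := hinv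
  have hM' : M ≤ (cN + 4) * k := by rw [add_mul]; exact hM
  refine ⟨?_, hd4, M, hM', hbits⟩
  have h1 : S.card ≤ M + 1 := hs.card_le
  have h2 : (cN + 5) * k = (cN + 4) * k + k := by ring
  omega

/-- Every final configuration in the support satisfies the bound, so the event fails with
probability zero and termination is all that matters. -/
lemma prob_card_le (hz : 1 ≤ z) (hk : 1 ≤ k) (hn : 1 ≤ n) (hΔ : Δ ≤ (n + 1) ^ a)
    (hd : d ≤ (n + 1) ^ a) (hX : ∑ j, (X j).card = n) {C : ℝ} (hC : (cN : ℝ) + 5 ≤ C) :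
    (tunedSampling s d Δ z k n cN).prob X (fun S _ _ => (S.card : ℝ) ≤ C * k) = 1 := by
  refine le_antisymm (BlackboardProtocol.prob_le_one _ _ _) ?_
  rw [← add_zero (BlackboardProtocol.prob _ _ _)]
  refine (tunedSampling s d Δ z k n cN).one_le_prob_add X _ ENNReal.ofReal_ne_top
    (ex_rounds_tunedSampling_le hz hk hn hΔ hd hX) 0 fun t => le_of_eq ?_
  rw [PMF.toOuterMeasure_apply_eq_zero_iff, Set.disjoint_left]
  rintro c hc ⟨o, ho, hcard⟩
  have h1 := (output_tunedSampling hz hk hn hΔ hd hX hc ho).1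
  have h2 : (o.card : ℝ) ≤ (cN + 5) * k := by exact_mod_cast h1
  exact hcard (h2.trans (by gcongr))

lemma le_prob_cost_le (hz : 1 ≤ z) (hk : 1 ≤ k) (hn : 1 ≤ n) (hΔ : Δ ≤ (n + 1) ^ a)
    (hd : d ≤ (n + 1) ^ a) (hX : ∑ j, (X j).card = n) (hcN : 100 * clusterWeight z ≤ cN) {C : ℝ}
    (hC : approxFactor z * 2 ^ z ≤ C) :
    ENNReal.ofReal 0.98 ≤ (tunedSampling s d Δ z k n cN).prob X (fun S _ _ =>
      cost z (∑ j, X j) (centers S) ≤ C * optCost k z (∑ j, X j)) := by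
  have hcard : (∑ j, X j).card = n := by rw [← hX]; exact map_sum Multiset.cardHom X _
  have hne : ∑ j, X j ≠ 0 := by
    intro h
    rw [h, Multiset.card_zero] at hcard
    omega
  obtain ⟨Cl⟩ := exists_clusters hz hk hne
  have hcN0 : 0 < cN := by
    have := clusterWeight_pos (z := z)
    have h1 : (0 : ℝ) < cN := by linarith
    exact_mod_cast h1
  refine ofReal_le_of_one_le_add (y := 0.02) (by norm_num) (by norm_num) ?_
  refine (tunedSampling s d Δ z k n cN).one_le_prob_add X _ ENNReal.ofReal_ne_top
    (ex_rounds_tunedSampling_le hz hk hn hΔ hd hX) _ fun t => ?_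
  have hbad := toOuterMeasure_bad_cost_le (N := cN * k)
    (R := l1Reps 100 (l1Delta (1 / 80) n)) hz hk hn hX (le_maxExponent_of_sum hz hΔ hd hX) rfl Cl
    (by positivity) t
  have happrox : approxFactor z * Cl.total ≤ C * optCost k z (∑ j, X j) := by
    have h1 : Cl.total ≤ 2 ^ z * optCost k z (∑ j, X j) := Cl.sum_o_le
    have h2 : 0 ≤ optCost k z (∑ j, X j) :=
      nonneg_of_mul_nonneg_right (Cl.total_nonneg.trans h1) (by positivity)
    have h3 : 0 < approxFactor z := mul_pos (by norm_num) coverFactor_pos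
    calc approxFactor z * Cl.total ≤ approxFactor z * (2 ^ z * optCost k z (∑ j, X j)) := by gcongr
      _ = approxFactor z * 2 ^ z * optCost k z (∑ j, X j) := by ring
      _ ≤ _ := by gcongr
  refine (toOuterMeasure_mono_support _ _ _ ?_).trans (hbad.trans (ENNReal.ofReal_le_ofReal ?_))
  · rintro c - ⟨o, ho, hcost⟩
    exact ⟨o, ho, fun h => hcost (h.trans happrox)⟩
  · have hk' : (0 : ℝ) < k := by exact_mod_cast hk
    have hc' : (0 : ℝ) < cN := by exact_mod_cast hcN0
    push_cast
    rw [div_le_iff₀ (by positivity)]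
    have : 100 * clusterWeight z * k ≤ cN * k := by gcongr
    have h0 : 0 < (cN : ℝ) * k := by positivity
    linarith

/-- Only the tail of the number of rounds is random: Markov's inequality with the factor `100`
bounds it, and on its complement `bits_le` bounds the bits surely. -/
lemma le_prob_communication (hz : 1 ≤ z) (hk : 1 ≤ k) (hn : 1 ≤ n) (hΔ : Δ ≤ (n + 1) ^ a)
    (hd : d ≤ (n + 1) ^ a) (hX : ∑ j, (X j).card = n) {C : ℝ}
    (hC : 100 * roundsConst z a cN ≤ C)
    (hC' : bitsConst z a cN (100 * roundsConst z a cN) ≤ C) :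
    ENNReal.ofReal 0.99 ≤ (tunedSampling s d Δ z k n cN).prob X (fun _ bits rounds =>
      (bits : ℝ) ≤ C * commSize s d k n * Real.log (commSize s d k n + 2) ^ 3 ∧
      (rounds : ℝ) ≤ C * (Real.log (n + 1) * Real.log (k + 1))) := by
  have hs : 1 ≤ s := Nat.one_le_iff_ne_zero.2 (NeZero.ne s)
  have hL := half_le_log_add_one hn
  have hK := half_le_log_add_one hk
  have hcd := one_le_costDegree hz a
  have hl := half_le_log_commSize (d := d) (k := k) hn hs
  have hF := log_le_commSize (d := d) (k := k) hn hs
  have hex := ex_rounds_tunedSampling_le (cN := cN) hz hk hn hΔ hd hX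
  set B := roundsConst z a cN with hBdef
  have hB : 0 < B := by rw [hBdef]; unfold roundsConst; positivity
  set T := Real.log ((n : ℝ) + 1) * Real.log ((k : ℝ) + 1) with hT
  have hT0 : 0 < T := by positivity
  refine ofReal_le_of_one_le_add (y := 0.01) (by norm_num) (by norm_num) ?_
  refine (tunedSampling s d Δ z k n cN).one_le_prob_add X _ ENNReal.ofReal_ne_top hex _ fun t => ?_
  have hmark := mul_toOuterMeasure_le_ex ((tunedSampling s d Δ z k n cN).run X t)
    (fun c => (c.rounds : ℝ≥0∞)) {c | ¬ (c.rounds : ℝ) ≤ 100 * B * T}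
    (ENNReal.ofReal (100 * B * T)) fun c _ hc => by
      rw [← ENNReal.ofReal_natCast]
      exact ENNReal.ofReal_le_ofReal (not_le.1 hc).le
  have hbad : ((tunedSampling s d Δ z k n cN).run X t).toOuterMeasure
      {c | ¬ (c.rounds : ℝ) ≤ 100 * B * T} ≤ ENNReal.ofReal 0.01 := by
    rw [show (0.01 : ℝ) = B * T / (100 * B * T) by field_simp; norm_num,
      ENNReal.ofReal_div_of_pos (by positivity), ENNReal.le_div_iff_mul_le
      (by left; exact (ENNReal.ofReal_pos.2 (by positivity)).ne') (by simp), mul_comm]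
    exact hmark.trans (hex t)
  refine (toOuterMeasure_mono_support _ _ _ ?_).trans hbad
  rintro c hc ⟨o, ho, hE⟩ hr
  obtain ⟨-, hd4, M, hM, hbits⟩ := output_tunedSampling hz hk hn hΔ hd hX hc ho
  refine hE ⟨?_, hr.trans (by gcongr)⟩
  refine (bits_le hz hn hs hk hΔ (by positivity) hd4 hM hr hbits).trans ?_
  rw [mul_assoc]
  have hF0 : 0 ≤ commSize s d k n := by linarith
  gcongr

end guarantees

end Clustering

end

/-! ### The theorem and its constants -/

theorem mainTheorem3 (z : ℝ) (hz : 1 ≤ z) (a : ℕ) :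
    ∃ (cN p : ℕ) (cδ cR C : ℝ), 0 < cN ∧ 0 < cδ ∧ 0 < cR ∧ 0 < C ∧
      ∀ (s d Δ k n : ℕ) [NeZero s] (X : Fin s → Multiset (Clustering.GridPoint d Δ)),
        1 ≤ k → 1 ≤ n → Δ ≤ (n + 1) ^ a → d ≤ (n + 1) ^ a → ∑ j, (X j).card = n →
        ∀ P, P = Clustering.lazyAdaptiveSampling s d Δ z k (cN * k)
            (Clustering.l1Reps cR (Clustering.l1Delta cδ n)) →
          P.SelfDelimiting ∧
          P.prob X (fun S _ _ => (S.card : ℝ) ≤ C * k) = 1 ∧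
          ENNReal.ofReal 0.98 ≤ P.prob X (fun S _ _ =>
            Clustering.cost z (∑ j, X j) (Clustering.centers S)
              ≤ C * Clustering.optCost k z (∑ j, X j)) ∧
          ENNReal.ofReal 0.99 ≤ P.prob X (fun _ bits rounds =>
            (bits : ℝ) ≤ C * (s * Real.log (n + 1) + k * d * Real.log (n + 1)) *
                Real.log (s * Real.log (n + 1) + k * d * Real.log (n + 1) + 2) ^ p ∧
            (rounds : ℝ) ≤ C * (Real.log (n + 1) * Real.log (k + 1))) := by
  have hW := Clustering.clusterWeight_pos (z := z)
  -- With this choice, `clusterWeight z * k / N ≤ 1 / 100` bounds the probability of a bad solution.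
  set cN : ℕ := ⌈100 * Clustering.clusterWeight z⌉₊ with hcN
  have hcd := Clustering.one_le_costDegree hz a
  have h1 : 0 < Clustering.approxFactor z * 2 ^ z :=
    mul_pos (mul_pos (by norm_num) Clustering.coverFactor_pos) (by positivity)
  have h2 : 0 < Clustering.roundsConst z a cN := by
    unfold Clustering.roundsConst; positivity
  have h3 : 0 < Clustering.bitsConst z a cN (100 * Clustering.roundsConst z a cN) := by
    unfold Clustering.bitsConst Clustering.roundBitsConst; positivity
  -- `C` is the sum of the constants of all the bounds; as each of them is nonnegative, `C`
  -- dominates every one.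
  refine ⟨cN, 3, 1 / 80, 100, ((cN : ℝ) + 5) + Clustering.approxFactor z * 2 ^ z +
    100 * Clustering.roundsConst z a cN +
    Clustering.bitsConst z a cN (100 * Clustering.roundsConst z a cN),
    Nat.ceil_pos.2 (by positivity), by norm_num, by norm_num, by positivity, ?_⟩
  intro s d Δ k n _ X hk hn hΔ hd hX P hP
  subst hP
  have h4 : (0 : ℝ) ≤ cN := Nat.cast_nonneg _
  exact ⟨Clustering.selfDelimiting_lazyAdaptiveSampling,
    Clustering.prob_card_le hz hk hn hΔ hd hX (by linarith),
    Clustering.le_prob_cost_le hz hk hn hΔ hd hX (Nat.le_ceil _) (by linarith),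
    Clustering.le_prob_communication hz hk hn hΔ hd hX (by linarith) (by linarith)⟩
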